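/- Consider the synchronous CONGEST model on a connected weighted undirected graph $G=(V,E,w)$ with $n$ vertices and hop-diameter $D$ (the largest number of edges on a fewest-edge path between two vertices). Vertices have distinct identifiers of $O(\log n)$ bits, edge weights are positive integers polynomially bounded in $n$, the edges at each vertex are numbered by arbitrary port numbers, every vertex has private random bits, local computation is free, and in each round every vertex may send a message of $O(1)$ words of $O(\log n)$ bits through each of its incident edges. Initially a vertex knows $n$, its identifier and its incident edges. Suppose we are given $n$ rooted trees $T_1,\dots,T_n$ with distinct names of $O(\log n)$ bits, each $T_i$ a subgraph of $G$, such that each vertex lies in at most $s$ of them; initially each vertex also knows the names of the trees that contain it and its parent and its children in each of them. Then there is a randomized distributed algorithm which, with high probability (at least $1-n^{-c}$, for any prescribed constant $c$, on which the constant factors may depend), computes within $$\tilde O\bigl(\sqrt{n\cdot s}+D\bigr)$$ rounds routing schemes for all the trees simultaneously, where $\tilde O$ hides factors polylogarithmic in $n$ whose exponent is an absolute constant. That is, after this number of rounds every vertex holds, for each tree $T_i$ containing it, a routing table of $O(\log n)$ words and a label of $O(\log^2 n)$ words, such that for all vertices $x,y$ of $T_i$ a packet that starts at $x$ and carries the label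 of $y$ is delivered to $y$ along a walk in $T_i$ of length $d_{T_i}(x,y)$ (stretch $1$), where every vertex on the way chooses the port through which to forward the packet, or recognizes that the packet has arrived, from its own table for $T_i$ and that label only. -/

import Mathlib

namespace TreeRouting

universe u

/-- The number of bits of `n`, which is `Θ(log n)` for `n ≥ 2` and is positive also for `n = 1`. -/
def bits (n : ℕ) : ℕ := Nat.log 2 n + 1

/-- A machine word of `C * bits n`, that is of `O(log n)`, bits. -/
abbrev Word (C n : ℕ) : Type := Fin (2 ^ (C * bits n))

/-- A message of at most `C`, that is of `O(1)`, words.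
The empty list stands for sending nothing. -/
abbrev Message (C n : ℕ) : Type := {l : List (Word C n) // l.length ≤ C}

/-- A connected weighted network on `n` vertices. Vertices have distinct identifiers below `n ^ κ`,
edge weights are positive integers of size at most `n ^ κ`, and the edges at a vertex `v` are
numbered by arbitrary ports `0, …, deg v - 1`. -/
structure Network (n κ : ℕ) (V : Type u) [Fintype V] where
  card_eq : Fintype.card V = n
  graph : SimpleGraph V
  connected : graph.Connected
  weight : Sym2 V → ℕ
  weight_pos : ∀ e ∈ graph.edgeSet, 1 ≤ weight e
  weight_le : ∀ e ∈ graph.edgeSet, weight e ≤ n ^ κ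
  ident : V → ℕ
  ident_injective : Function.Injective ident
  ident_lt : ∀ v, ident v < n ^ κ
  deg : V → ℕ
  port : (v : V) → Fin (deg v) ≃ graph.neighborSet v

/-- `n` rooted trees, each of them a subgraph of the network, with distinct names below `n ^ κ`. -/
structure TreeFamily {n κ : ℕ} {V : Type u} [Fintype V] (N : Network n κ V) where
  tree : Fin n → N.graph.Subgraph
  isTree : ∀ i, (tree i).coe.IsTree
  root : Fin n → V
  root_mem : ∀ i, root i ∈ (tree i).verts
  name : Fin n → ℕ
  name_injective : Function.Injective name
  name_lt : ∀ i, name i < n ^ κ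

/-- What a vertex knows at the start: its identifier, its incident edges (for each port, the
identifier of the neighbour and the weight of the edge), the names of the trees that contain it,
and for each such tree the ports that lead to its parent and to its children. -/
structure LocalInput where
  ident : ℕ
  deg : ℕ
  nbrIdent : Fin deg → ℕ
  nbrWeight : Fin deg → ℕ
  trees : Set ℕ
  parent : ℕ → Set (Fin deg)
  children : ℕ → Set (Fin deg)

section Input

variable {n κ : ℕ} {V : Type u} [Fintype V] {N : Network n κ V}

/-- In the `i`-th tree, `u` is the parent of `v`: a tree neighbour that is closer to the root. -/
def TreeFamily.IsParent (X : TreeFamily N) (i : Fin n) (v u : V) : Prop :=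
  (X.tree i).Adj v u ∧
    (X.tree i).spanningCoe.dist (X.root i) u < (X.tree i).spanningCoe.dist (X.root i) v

/-- The information that the vertex `v` has initially. -/
def TreeFamily.localInput (X : TreeFamily N) (v : V) : LocalInput where
  ident := N.ident v
  deg := N.deg v
  nbrIdent p := N.ident (N.port v p)
  nbrWeight p := N.weight s(v, N.port v p)
  trees := {a | ∃ i, X.name i = a ∧ v ∈ (X.tree i).verts}
  parent a := {p | ∃ i, X.name i = a ∧ X.IsParent i v (N.port v p)}
  children a := {p | ∃ i, X.name i = a ∧ X.IsParent i (N.port v p) v}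

end Input

/-- What a vertex computes: for each tree, given by its name, a routing table and a label,
which are sequences of words. -/
structure NodeOutput (C n : ℕ) where
  table : ℕ → List (Word C n)
  label : ℕ → List (Word C n)

/-- A randomized algorithm in the CONGEST model for networks on `n` vertices: all vertices run
the same program, which depends on nothing but `n`. A vertex has a private string of `coins` random
bits. In every round it sends a message through each of its ports and then updates its state
according to the messages that arrive through its ports. Local computation is free. -/
structure CongestAlgorithm (C n : ℕ) where
  coins : ℕ
  State : Type
  init : LocalInput → (Fin coins → Bool) → State
  send : State → ℕ → Message C n
  update : State → (ℕ → Message C n) → State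
  output : State → Option (NodeOutput C n)

section Execution

variable {C n κ : ℕ} {V : Type u} [Fintype V] {N : Network n κ V}

/-- The port of the neighbour of `v` behind port `p` that leads back to `v`. -/
def Network.backPort (N : Network n κ V) (v : V) (p : Fin (N.deg v)) :
    Fin (N.deg (N.port v p)) :=
  (N.port (N.port v p)).symm ⟨v, (N.port v p).2.symm⟩

/-- The state of each vertex after `t` rounds, if `ω v` is the random string of the vertex `v`. -/
def CongestAlgorithm.state (A : CongestAlgorithm C n) (X : TreeFamily N)
    (ω : V → Fin A.coins → Bool) : ℕ → V → A.State
  | 0 => fun v => A.init (X.localInput v) (ω v)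
  | t + 1 => fun v =>
      A.update (A.state X ω t v) fun p =>
        if h : p < N.deg v then
          A.send (A.state X ω t (N.port v ⟨p, h⟩)) (N.backPort v ⟨p, h⟩)
        else ⟨[], Nat.zero_le C⟩

/-- The vertex `v` outputs `o` within `R` rounds. Outputs are irrevocable: the first one counts. -/
def CongestAlgorithm.OutputsWithin (A : CongestAlgorithm C n) (X : TreeFamily N)
    (ω : V → Fin A.coins → Bool) (R : ℕ) (v : V) (o : NodeOutput C n) : Prop :=
  ∃ t ≤ R, A.output (A.state X ω t v) = some o ∧
    ∀ t' < t, A.output (A.state X ω t' v) = none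

/-- The probability of an event over the independent fair random bits of all vertices. -/
noncomputable def CongestAlgorithm.prob (A : CongestAlgorithm C n)
    (E : Set (V → Fin A.coins → Bool)) : ℝ :=
  (E.ncard : ℝ) / (Nat.card (V → Fin A.coins → Bool) : ℝ)

end Execution

section Routing

variable {C n κ : ℕ} {V : Type u} [Fintype V] {N : Network n κ V}

/-- The routing decision of a vertex: from its own routing table and the label of the destination
it computes the port through which the packet is forwarded, or `none` if the packet has arrived.
The decision rule does not depend on the network. -/
abbrev Forwarding (C n : ℕ) : Type := List (Word C n) → List (Word C n) → Option ℕ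

/-- `Routes N d p` says that a packet which at each vertex `x` is treated according to the decision
`d x` travels along the walk `p` and is declared to have arrived exactly at the end of `p`. -/
inductive Routes (N : Network n κ V) (d : V → Option ℕ) :
    {x y : V} → N.graph.Walk x y → Prop
  | arrived (x : V) (h : d x = none) : Routes N d (SimpleGraph.Walk.nil : N.graph.Walk x x)
  | forward {x y : V} (p : Fin (N.deg x)) (h : d x = some (p : ℕ))
      (q : N.graph.Walk (N.port x p : V) y) (hq : Routes N d q) :
      Routes N d (SimpleGraph.Walk.cons (N.port x p).2 q)

/-- The length of a walk with respect to the edge weights. -/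
def Network.length (N : Network n κ V) {x y : V} (p : N.graph.Walk x y) : ℕ :=
  (p.edges.map N.weight).sum

/-- The walk `p` uses only edges of the subgraph `T`. -/
def UsesOnly {G : SimpleGraph V} (T : G.Subgraph) {x y : V} (p : G.Walk x y) : Prop :=
  ∀ e ∈ p.edges, e ∈ T.edgeSet

/-- The outputs `out` of all vertices form, with the decision rule `f`, a routing scheme of stretch
`1` for every tree of the family: a packet sent from `x` to `y` in a tree arrives at `y`, on a walk
in the tree that is no longer than any other walk in the tree from `x` to `y`. -/
def TreeFamily.HasStretchOne (X : TreeFamily N) (f : Forwarding C n)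
    (out : V → NodeOutput C n) : Prop :=
  ∀ i, ∀ x ∈ (X.tree i).verts, ∀ y ∈ (X.tree i).verts,
    ∃ p : N.graph.Walk x y,
      Routes N (fun z => f ((out z).table (X.name i)) ((out y).label (X.name i))) p ∧
      UsesOnly (X.tree i) p ∧
      ∀ q : N.graph.Walk x y, UsesOnly (X.tree i) q → N.length p ≤ N.length q

/-- In every tree, the routing table of each vertex has `O(log n)` words and the label of each
vertex has `O(log ^ 2 n)` words. -/
def TreeFamily.HasSmallSize (X : TreeFamily N) (out : V → NodeOutput C n) : Prop :=
  ∀ i, ∀ x ∈ (X.tree i).verts,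
    ((out x).table (X.name i)).length ≤ C * bits n ∧
    ((out x).label (X.name i)).length ≤ C * bits n ^ 2

/-- The event that, within `R` rounds, all vertices have output their routing tables and labels for
all the trees, and these form routing schemes of stretch `1` and of the required size. -/
def CongestAlgorithm.Succeeds (A : CongestAlgorithm C n) (f : Forwarding C n) (X : TreeFamily N)
    (R : ℕ) : Set (V → Fin A.coins → Bool) :=
  {ω | ∃ out : V → NodeOutput C n, (∀ v, A.OutputsWithin X ω R v (out v)) ∧
    X.HasStretchOne f out ∧ X.HasSmallSize out}

end Routing

end TreeRouting

/-! Routing in one tree uses heavy paths. Call the edge to a child of maximal subtree size heavy and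
the other edges to children light. Subtree sizes at least double when a light edge is climbed, so
only logarithmically many light edges lie above a vertex (`RootedTree.length_lights`). The label of
`y` lists the light edges on the path from the root to `y`, each as the subtree size of its upper
end together with a port, and ends with the subtree size of `y`. Sizes strictly decrease along a
downward path, so they serve as coordinates on a heavy path. A vertex that knows its own list, its
subtree size, and the ports to its parent and heavy child can decide from the label whether to stop,
to go up, to take the heavy edge, or to take a listed light edge (`nextPort_self`, `nextPort_child`,
`nextPort_parent`).

These data must be computed quickly even if the trees are deep. Fix a power of two `R` with `n * s ≤
R ^ 2` and with the diameter at most `R`. For each tree a vertex draws a number below `R`; a vertex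
other than the root is sampled if this number is `0`. The sampled vertices and the root cut the tree
into fragments, whose depth is `O(R log n)` with high probability, and there are only `O(R log n)`
sampled pairs of a tree and a vertex. Waves that run down or up inside all fragments of all trees in
parallel compute fragment identifiers, sizes, and relative path descriptions. One token per sampled
pair, spread to all vertices by pipelined broadcast (`gossip_pipeline`), joins the fragments
together: `tokenSum_eq` recovers subtree sizes and `tokenPath_eq` recovers path descriptions.

Congestion is controlled by random delays: the wave from the root of a tree starts after as many
steps as the number drawn there says. That a vertex sends at time `t` for a given tree then forces
one particular random number to have one particular value (`TreeFamily.rnd_witness`). The numbers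
for different trees are independent and at most `R` trees contain the vertex, so with high
probability only `O(log n)` items coincide. Upward waves replay the schedule of the downward waves
backwards and inherit its load.

Neither the diameter nor `s` is known to the vertices, so `R` runs through the powers of two. Every
stage raises a flag if a message is too large or the time is too short. Without flags the result is
correct for whatever random numbers were drawn; with good random numbers no flag is raised. A
comparison of minimal identifiers (`Runs.leader`) either certifies a diameter of at most `2 * R + 1`
or places a flag within that distance of every vertex, so flooding the flags makes the decision
unanimous (`Runs.attempt`). Running times grow geometrically, so the last trial dominates.

The probabilistic input consists of two union bounds over prescribed values of independent uniform
numbers (`IsUniform.many`, `IsUniform.none`). -/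

namespace TreeRouting

universe u

/-! ### Local programs and their synchronous execution -/

section Programs

variable {C n κ : ℕ} {V : Type u} [Fintype V] {α β : Type}

/-- A local program: it returns a value, or it takes part in one round of communication, sending a
message through each port, and continues depending on the messages that arrive. -/
inductive Prog (C n : ℕ) (α : Type) : Type
  | ret (a : α) : Prog C n α
  | comm (m : ℕ → Message C n) (k : (ℕ → Message C n) → Prog C n α) : Prog C n α

/-- Sequential composition of local programs. -/
def Prog.bind : Prog C n α → (α → Prog C n β) → Prog C n β
  | .ret a, h => h a
  | .comm m k, h => .comm m fun x => (k x).bind h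

/-- The messages that arrive at `v` if each vertex `u` sends `m u p` through its port `p`. -/
def Network.inbox (N : Network n κ V) (m : V → ℕ → Message C n) (v : V) (p : ℕ) : Message C n :=
  if h : p < N.deg v then m (N.port v ⟨p, h⟩) (N.backPort v ⟨p, h⟩) else ⟨[], Nat.zero_le C⟩

/-- If every vertex `v` runs the program `f v`, then all of them return after exactly `T` rounds,
with results `g`. -/
def Runs (N : Network n κ V) : ℕ → (V → Prog C n α) → (V → α) → Prop
  | 0, f, g => ∀ v, f v = .ret (g v)
  | T + 1, f, g => ∃ (m : V → ℕ → Message C n) (k : V → (ℕ → Message C n) → Prog C n α),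
      (∀ v, f v = .comm (m v) (k v)) ∧ Runs N T (fun v => k v (N.inbox m v)) g

theorem Runs.ret (N : Network n κ V) (g : V → α) :
    Runs (C := C) N 0 (fun v => .ret (g v)) g := fun _ => rfl

theorem Runs.bind {N : Network n κ V} {T T' : ℕ} {f : V → Prog C n α} {g : V → α}
    {h : V → α → Prog C n β} {g' : V → β} (hf : Runs N T f g)
    (hh : Runs N T' (fun v => h v (g v)) g') :
    Runs N (T + T') (fun v => (f v).bind (h v)) g' := by
  induction T generalizing f with
  | zero =>
    have : (fun v => (f v).bind (h v)) = fun v => h v (g v) := by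
      funext v
      rw [hf v, Prog.bind]
    rw [this, Nat.zero_add]
    exact hh
  | succ T ih =>
    obtain ⟨m, k, hmk, hr⟩ := hf
    rw [Nat.succ_add]
    exact ⟨m, fun v x => (k v x).bind (h v), fun v => by simp only [hmk v, Prog.bind], ih hr⟩

/-- The algorithm in which every vertex runs a given local program. -/
def Prog.toAlgorithm (coins : ℕ) (prog : LocalInput → (Fin coins → Bool) → Prog C n (NodeOutput C n)) :
    CongestAlgorithm C n where
  coins := coins
  State := Prog C n (NodeOutput C n)
  init := prog
  send s p := match s with
    | .ret _ => ⟨[], Nat.zero_le C⟩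
    | .comm m _ => m p
  update s x := match s with
    | .ret a => .ret a
    | .comm _ k => k x
  output s := match s with
    | .ret a => some a
    | .comm _ _ => none

theorem Prog.outputsWithin {N : Network n κ V} (X : TreeFamily N) {coins : ℕ}
    {prog : LocalInput → (Fin coins → Bool) → Prog C n (NodeOutput C n)}
    {ω : V → Fin coins → Bool} {T : ℕ} {g : V → NodeOutput C n}
    (h : Runs N T (fun v => prog (X.localInput v) (ω v)) g) {R : ℕ} (hR : T ≤ R) (v : V) :
    (Prog.toAlgorithm coins prog).OutputsWithin X ω R v (g v) := by
  -- The state of a vertex is the rest of its program, so after `t` rounds the states form a system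
  -- that needs `T - t` more rounds.
  have key : ∀ t ≤ T, Runs N (T - t) ((Prog.toAlgorithm coins prog).state X ω t) g := by
    intro t
    induction t with
    | zero => intro _; exact h
    | succ t ih =>
      intro ht
      have := ih (by omega)
      obtain ⟨d, hd⟩ : ∃ d, T - t = d + 1 := ⟨T - t - 1, by omega⟩
      rw [hd] at this
      obtain ⟨m, k, hmk, hr⟩ := this
      have hd' : T - (t + 1) = d := by omega
      rw [hd']
      refine (congrArg (fun f => Runs N d f g) (funext fun v => ?_)).mpr hr
      have hin : N.inbox m v = fun p => if h : p < N.deg v then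
          (Prog.toAlgorithm coins prog).send ((Prog.toAlgorithm coins prog).state X ω t
            (N.port v ⟨p, h⟩)) (N.backPort v ⟨p, h⟩) else ⟨[], Nat.zero_le C⟩ := by
        funext p
        rw [Network.inbox]
        split_ifs with hp
        · rw [hmk]; rfl
        · rfl
      rw [hin]
      change (Prog.toAlgorithm coins prog).update _ _ = _
      rw [hmk v]
      rfl
  refine ⟨T, hR, ?_, ?_⟩
  · have := key T le_rfl
    rw [Nat.sub_self] at this
    rw [this v]; rfl
  · intro t ht
    have := key t ht.le
    obtain ⟨d, hd⟩ : ∃ d, T - t = d + 1 := ⟨T - t - 1, by omega⟩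
    rw [hd] at this
    obtain ⟨m, k, hmk, hr⟩ := this
    rw [hmk v]; rfl

end Programs

/-! ### Simulating rounds with large messages by rounds with single words -/

section Exchange

variable {C n κ : ℕ} {V : Type u} [Fintype V] {M S : Type}

/-- The message that consists of a single word. -/
def Message.single (w : Word C n) : Message C n :=
  if h : 1 ≤ C then ⟨[w], h⟩ else ⟨[], Nat.zero_le C⟩

/-- Broadcast the words `w j, …, w (j + P - 1)` to all neighbours, one per round, and collect
what arrives. -/
def Prog.words : (P j : ℕ) → (ℕ → Word C n) → Prog C n (ℕ → List (Word C n))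
  | 0, _, _ => .ret fun _ => []
  | P + 1, j, w => .comm (fun _ => Message.single (w j)) fun x =>
      (Prog.words P (j + 1) w).bind fun r => .ret fun p => (x p).1 ++ r p

theorem Runs.words (hC : 1 ≤ C) (N : Network n κ V) (w : V → ℕ → Word C n) (P j : ℕ) :
    Runs N P (fun v => Prog.words P j (w v)) fun v p =>
      if h : p < N.deg v then (List.range' j P).map (w (N.port v ⟨p, h⟩)) else [] := by
  induction P generalizing j with
  | zero => intro v; simp [Prog.words]
  | succ P ih =>
    refine ⟨_, _, fun v => rfl, ?_⟩
    refine Runs.bind (T' := 0) (ih (j + 1)) fun v => ?_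
    refine congrArg Prog.ret (funext fun p => ?_)
    by_cases h : p < N.deg v
    · simp [Network.inbox, h, Message.single, hC, List.range'_succ]
    · simp [Network.inbox, h]

/-- The elements of `allowed` can be told apart by `P` words. -/
def Transmissible (C n P : ℕ) (allowed : Set M) : Prop :=
  ∃ e : M → ℕ → Word C n, ∀ x ∈ allowed, ∀ y ∈ allowed, (∀ j < P, e x j = e y j) → x = y

open Classical in
/-- Broadcast an element of `allowed` in `P` rounds. -/
noncomputable def Prog.exchange [Inhabited M] (P : ℕ) (allowed : Set M) (m : M) :
    Prog C n (ℕ → M) :=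
  if h : Transmissible C n P allowed then
    (Prog.words P 0 (h.choose m)).bind fun r => .ret fun p =>
      if h' : ∃ x ∈ allowed, (List.range' 0 P).map (h.choose x) = r p then h'.choose else default
  else .ret fun _ => default

/-- Decoding is correct only for senders whose message is in `allowed`; nothing is claimed about the
others. A receiver cannot notice this, so the sender has to report it. -/
theorem Runs.exchange [Inhabited M] (hC : 1 ≤ C) (N : Network n κ V) {P : ℕ} {allowed : Set M}
    (ha : Transmissible C n P allowed) (m : V → M) :
    ∃ r : V → ℕ → M, Runs (C := C) N P (fun v => Prog.exchange P allowed (m v)) r ∧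
      ∀ v (p : Fin (N.deg v)), m (N.port v p) ∈ allowed → r v p = m (N.port v p) := by
  classical
  simp only [Prog.exchange, ha, ↓reduceDIte]
  refine ⟨_, Runs.bind (T' := 0) (Runs.words hC N (fun v => ha.choose (m v)) P 0)
    (Runs.ret N _), ?_⟩
  intro v p hp
  simp only [Fin.is_lt, ↓reduceDIte, Fin.eta]
  have hex : ∃ x ∈ allowed, (List.range' 0 P).map (ha.choose x) =
      (List.range' 0 P).map (ha.choose (m (N.port v p))) := ⟨_, hp, rfl⟩
  rw [dif_pos hex]
  refine ha.choose_spec _ hex.choose_spec.1 _ hp fun j hj => ?_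
  exact List.map_inj_left.1 hex.choose_spec.2 j (by simp [List.mem_range', hj])

open Classical in
/-- `T` rounds of communication with messages in `allowed`, starting at time `t`. A vertex in state
`s` broadcasts `msg t s` and then updates its state. The second component of the result is a flag
that is raised if a message was not in `allowed`. -/
noncomputable def Prog.phase [Inhabited M] (P : ℕ) (allowed : Set M) (d : ℕ) (msg : ℕ → S → M)
    (upd : ℕ → S → (Fin d → M) → S) : (T t : ℕ) → S → Bool → Prog C n (S × Bool)
  | 0, _, s, b => .ret (s, b)
  | T + 1, t, s, b => (Prog.exchange P allowed (msg t s)).bind fun x =>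
      Prog.phase P allowed d msg upd T (t + 1) (upd t s fun p => x p)
        (b || decide (msg t s ∉ allowed))

/-- `cfg t v` is the state of `v` at time `t` if messages of unbounded size are exchanged. -/
def Evolves (N : Network n κ V) (msg : V → ℕ → S → M)
    (upd : (v : V) → ℕ → S → (Fin (N.deg v) → M) → S) (cfg : ℕ → V → S) : Prop :=
  ∀ t v, cfg (t + 1) v = upd v t (cfg t v) fun p => msg (N.port v p) t (cfg t (N.port v p))

theorem exists_evolves (N : Network n κ V) (msg : V → ℕ → S → M)
    (upd : (v : V) → ℕ → S → (Fin (N.deg v) → M) → S) (s : V → S) :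
    ∃ cfg, cfg 0 = s ∧ Evolves N msg upd cfg :=
  ⟨fun t => t.rec s fun t c v => upd v t (c v) fun p => msg (N.port v p) t (c (N.port v p)), rfl,
    fun _ _ => rfl⟩

/-- The simulation is compared with the ideal run `cfg` in both directions. If no vertex ends with a
flag, the run was the ideal one. If all ideal messages are allowed, the run is the ideal one and no
new flag appears. The first direction gives correctness for all random bits, the second gives
success for good ones. -/
theorem Runs.phase [Inhabited M] (hC : 1 ≤ C) (N : Network n κ V) {P : ℕ} {allowed : Set M}
    (ha : Transmissible C n P allowed) {msg : V → ℕ → S → M}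
    {upd : (v : V) → ℕ → S → (Fin (N.deg v) → M) → S} {cfg : ℕ → V → S}
    (hcfg : Evolves N msg upd cfg) (T t : ℕ) (s : V → S) (b : V → Bool) :
    ∃ out : V → S × Bool,
      Runs (C := C) N (T * P)
        (fun v => Prog.phase P allowed (N.deg v) (msg v) (upd v) T t (s v) (b v)) out ∧
      (∀ v, b v = true → (out v).2 = true) ∧
      (s = cfg t → (∀ v, (out v).2 = false) →
        ∀ v, (out v).1 = cfg (t + T) v ∧ ∀ t', t ≤ t' → t' < t + T → msg v t' (cfg t' v) ∈ allowed) ∧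
      (s = cfg t → (∀ v t', t ≤ t' → t' < t + T → msg v t' (cfg t' v) ∈ allowed) →
        ∀ v, out v = (cfg (t + T) v, b v)) := by
  classical
  induction T generalizing t s b with
  | zero =>
    refine ⟨fun v => (s v, b v), ?_, fun v h => h, ?_, ?_⟩
    · simpa only [Prog.phase, Nat.zero_mul] using Runs.ret N _
    · rintro rfl h v
      exact ⟨rfl, fun t' h1 h2 => by omega⟩
    · rintro rfl h v
      rfl
  | succ T ih =>
    obtain ⟨r, hr, hrm⟩ := Runs.exchange hC N ha fun v => msg v t (s v)
    obtain ⟨out, ho, ho1, ho2, ho3⟩ := ih (t + 1) (fun v => upd v t (s v) fun p => r v p)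
      (fun v => b v || decide (msg v t (s v) ∉ allowed))
    have hnext : s = cfg t → (∀ v, msg v t (s v) ∈ allowed) →
        (fun v => upd v t (s v) fun p => r v p) = cfg (t + 1) := by
      rintro rfl hall
      funext v
      rw [hcfg t v]
      congr 1
      funext p
      exact hrm v p (hall _)
    have harith : t + 1 + T = t + (T + 1) := by omega
    refine ⟨out, ?_, fun v hv => ho1 v (by simp [hv]), ?_, ?_⟩
    · have : (T + 1) * P = P + T * P := by ring
      rw [this]
      exact Runs.bind hr ho
    · intro hs hf
      -- An oversized message raises a flag at once and flags are never lowered, so their absence at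
      -- the end covers the present round.
      have hall : ∀ v, msg v t (s v) ∈ allowed := by
        intro v
        by_contra hv
        have := ho1 v (by simp [hv])
        rw [hf v] at this
        cases this
      have h := ho2 (hnext hs hall) hf
      intro v
      refine ⟨by rw [(h v).1, harith], fun t' h1 h2 => ?_⟩
      rcases h1.eq_or_lt with rfl | h1
      · rw [← hs]; exact hall v
      · exact (h v).2 t' h1 (by omega)
    · intro hs hall
      have hall' : ∀ v, msg v t (s v) ∈ allowed := fun v => by
        rw [hs]; exact hall v t le_rfl (by omega)
      intro v
      rw [ho3 (hnext hs hall') (fun v t' h1 h2 => hall v t' (by omega) (by omega)) v, harith]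
      simp [hall' v]

end Exchange

/-! ### Counting the bits of messages -/

section Codes

variable {α β : Type}

/-- The elements of `S` can be told apart by `b` bits. -/
def Coded (S : Set α) (b : ℕ) : Prop :=
  ∃ f : α → ℕ, Set.InjOn f S ∧ ∀ x ∈ S, f x < 2 ^ b

theorem Coded.mono {S T : Set α} {b b' : ℕ} (h : Coded T b) (hS : S ⊆ T) (hb : b ≤ b') :
    Coded S b' := by
  obtain ⟨f, hf, hlt⟩ := h
  exact ⟨f, hf.mono hS, fun x hx => (hlt x (hS hx)).trans_le (Nat.pow_le_pow_right two_pos hb)⟩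

/-- The `P` words are the digits of the code in base `2 ^ (C * bits n)`. -/
theorem Coded.transmissible {C n P b : ℕ} {S : Set α} (h : Coded S b) (hb : b ≤ C * bits n * P) :
    Transmissible C n P S := by
  obtain ⟨f, hf, hlt⟩ := h.mono subset_rfl hb
  refine ⟨fun x j => ⟨f x / (2 ^ (C * bits n)) ^ j % 2 ^ (C * bits n), Nat.mod_lt _ (by positivity)⟩,
    fun x hx y hy hxy => hf hx hy ?_⟩
  have key : ∀ (B P x y : ℕ), x < B ^ P → y < B ^ P →
      (∀ j < P, x / B ^ j % B = y / B ^ j % B) → x = y := by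
    intro B P
    induction P with
    | zero => intro x y hx hy _; simp at hx hy; omega
    | succ P ih =>
      intro x y hx hy h
      have h0 := h 0 (by omega)
      simp only [pow_zero, Nat.div_one] at h0
      have h1 : x / B = y / B := by
        refine ih _ _ ?_ ?_ ?_
        · exact Nat.div_lt_of_lt_mul (by rwa [← pow_succ'])
        · exact Nat.div_lt_of_lt_mul (by rwa [← pow_succ'])
        · intro j hj
          have := h (j + 1) (by omega)
          rwa [pow_succ', ← Nat.div_div_eq_div_mul, ← Nat.div_div_eq_div_mul] at this
      rw [← Nat.div_add_mod x B, ← Nat.div_add_mod y B, h0, h1]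
  refine key (2 ^ (C * bits n)) P _ _ ?_ ?_ fun j hj => ?_
  · rw [← pow_mul]; exact hlt x hx
  · rw [← pow_mul]; exact hlt y hy
  · exact Fin.mk.inj_iff.1 (hxy j hj)

theorem Coded.range (b : ℕ) : Coded {x : ℕ | x < 2 ^ b} b :=
  ⟨id, Function.injective_id.injOn, fun _ hx => hx⟩

theorem Coded.bool : Coded (Set.univ : Set Bool) 1 :=
  ⟨Bool.toNat, fun x _ y _ h => by cases x <;> cases y <;> simp_all,
    fun x _ => by cases x <;> simp⟩

theorem Coded.prod {S : Set α} {T : Set β} {a b : ℕ} (hS : Coded S a) (hT : Coded T b) :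
    Coded (S ×ˢ T) (a + b) := by
  obtain ⟨f, hf, hfl⟩ := hS
  obtain ⟨g, hg, hgl⟩ := hT
  refine ⟨fun x => f x.1 + 2 ^ a * g x.2, ?_, ?_⟩
  · rintro ⟨x, y⟩ ⟨hx, hy⟩ ⟨x', y'⟩ ⟨hx', hy'⟩ h
    have h1 := congrArg (· % 2 ^ a) h
    have h2 := congrArg (· / 2 ^ a) h
    simp only [Nat.add_mul_mod_self_left, Nat.mod_eq_of_lt (hfl _ hx),
      Nat.mod_eq_of_lt (hfl _ hx')] at h1
    simp only [Nat.add_mul_div_left _ _ (Nat.two_pow_pos a), Nat.div_eq_of_lt (hfl _ hx),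
      Nat.div_eq_of_lt (hfl _ hx'), zero_add] at h2
    exact Prod.ext (hf hx hx' h1) (hg hy hy' h2)
  · rintro ⟨x, y⟩ ⟨hx, hy⟩
    have h1 := hfl _ hx
    have h2 := Nat.mul_le_mul_left (2 ^ a) (Nat.succ_le_of_lt (hgl _ hy))
    rw [pow_add]
    simp only [Nat.mul_succ] at *
    omega

theorem Coded.option {S : Set α} {a : ℕ} (hS : Coded S a) :
    Coded {x : Option α | ∀ y ∈ x, y ∈ S} (a + 1) := by
  obtain ⟨f, hf, hfl⟩ := hS
  refine ⟨fun x => x.elim 0 fun y => f y + 1, ?_, ?_⟩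
  · rintro (_ | x) hx (_ | y) hy h
    · rfl
    · simp at h
    · simp at h
    · simp only [Option.elim_some, add_left_inj] at h
      rw [hf (hx x rfl) (hy y rfl) h]
  · rintro (_ | x) hx
    · simp
    · have := hfl x (hx x rfl)
      simp only [Option.elim_some, pow_succ]
      omega

/-- Each entry is preceded by a continuation bit: the code of a nonempty list is odd, and that of
the empty list is `0`. This costs `a + 1` bits per entry, without a separate length field. -/
theorem Coded.list {S : Set α} {a : ℕ} (hS : Coded S a) (k : ℕ) :
    Coded {l : List α | l.length ≤ k ∧ ∀ y ∈ l, y ∈ S} (k * (a + 1)) := by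
  obtain ⟨f, hf, hfl⟩ := hS
  refine ⟨fun l => l.foldr (fun x c => 2 * (f x + 2 ^ a * c) + 1) 0, ?_, ?_⟩
  · intro l hl l' hl' h
    replace hl := hl.2
    replace hl' := hl'.2
    induction l generalizing l' with
    | nil => cases l' with
      | nil => rfl
      | cons y l' => simp at h
    | cons x l ih => cases l' with
      | nil => simp at h
      | cons y l' =>
        simp only [List.foldr_cons, add_left_inj, mul_eq_mul_left_iff, OfNat.ofNat_ne_zero,
          or_false] at h
        have hx := hl x (by simp)
        have hy := hl' y (by simp)
        have h1 := congrArg (· % 2 ^ a) h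
        have h2 := congrArg (· / 2 ^ a) h
        simp only [Nat.add_mul_mod_self_left, Nat.mod_eq_of_lt (hfl _ hx),
          Nat.mod_eq_of_lt (hfl _ hy)] at h1
        simp only [Nat.add_mul_div_left _ _ (Nat.two_pow_pos a), Nat.div_eq_of_lt (hfl _ hx),
          Nat.div_eq_of_lt (hfl _ hy), zero_add] at h2
        rw [hf hx hy h1, ih h2 (fun z hz => hl z (by simp [hz])) fun z hz => hl' z (by simp [hz])]
  · rintro l ⟨hk, hl⟩
    induction l generalizing k with
    | nil => simp
    | cons x l ih =>
      obtain ⟨k, rfl⟩ : ∃ k', k = k' + 1 := ⟨k - 1, by simp at hk; omega⟩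
      have h1 := hfl x (hl x (by simp))
      have h2 := Nat.mul_le_mul_left (2 ^ a)
        (Nat.succ_le_of_lt (ih k (by simpa using hk) fun z hz => hl z (by simp [hz])))
      have h3 : 2 ^ ((k + 1) * (a + 1)) = 2 * (2 ^ a * 2 ^ (k * (a + 1))) := by ring
      simp only [List.foldr_cons, h3]
      simp only [Nat.mul_succ] at *
      omega

/-- Partial functions that are defined at no more than `k` arguments. -/
def SparseMaps (S : Set (ℕ × α)) (k : ℕ) : Set (ℕ → Option α) :=
  {m | {a | m a ≠ none}.Finite ∧ {a | m a ≠ none}.ncard ≤ k ∧ ∀ a x, m a = some x → (a, x) ∈ S}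

/-- A sparse partial function is sent as the list of its argument-value pairs, in an arbitrary but
fixed order of its domain. -/
theorem Coded.sparseMaps {S : Set (ℕ × α)} {a : ℕ} (hS : Coded S a) (k : ℕ) :
    Coded (SparseMaps S k) (k * (a + 1)) := by
  classical
  obtain ⟨f, hf, hfl⟩ := hS.list k
  let g : (ℕ → Option α) → List (ℕ × α) := fun m =>
    if h : {a | m a ≠ none}.Finite then
      h.toFinset.toList.filterMap fun a => (m a).map fun x => (a, x)
    else []
  have hmem : ∀ m ∈ SparseMaps S k, ∀ a x, (a, x) ∈ g m ↔ m a = some x := by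
    intro m hm a x
    simp only [g, hm.1, ↓reduceDIte, List.mem_filterMap, Finset.mem_toList, Set.Finite.mem_toFinset,
      Set.mem_ofPred_eq, Option.map_eq_some_iff, Prod.mk.injEq]
    constructor
    · rintro ⟨b, -, y, hy, rfl, rfl⟩
      exact hy
    · intro h
      exact ⟨a, by simp [h], x, h, rfl, rfl⟩
  have hg : ∀ m ∈ SparseMaps S k, g m ∈ {l : List (ℕ × α) | l.length ≤ k ∧ ∀ y ∈ l, y ∈ S} := by
    intro m hm
    refine ⟨?_, ?_⟩
    · simp only [g, hm.1, ↓reduceDIte]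
      refine (List.length_filterMap_le _ _).trans ?_
      rw [Finset.length_toList, ← Set.ncard_eq_toFinset_card _ hm.1]
      exact hm.2.1
    · rintro ⟨a, x⟩ h
      exact hm.2.2 a x ((hmem m hm a x).1 h)
  refine ⟨fun m => f (g m), ?_, fun m hm => hfl _ (hg m hm)⟩
  intro m hm m' hm' h
  have h' := hf (hg m hm) (hg m' hm') h
  funext a
  apply Option.ext
  intro x
  rw [← hmem m hm a x, ← hmem m' hm' a x, h']

end Codes

/-! ### Hop distances in the network -/

section Distance

variable {n κ : ℕ} {V : Type u} [Fintype V] (N : Network n κ V)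

theorem Network.adj_port (v : V) (p : Fin (N.deg v)) : N.graph.Adj v (N.port v p) :=
  (N.port v p).2

theorem Network.exists_port {v w : V} (h : N.graph.Adj v w) :
    ∃ p : Fin (N.deg v), (N.port v p : V) = w :=
  ⟨(N.port v).symm ⟨w, h⟩, by simp⟩

theorem Network.dist_le_succ {v w : V} (h : N.graph.Adj v w) (u : V) :
    N.graph.dist v u ≤ N.graph.dist w u + 1 := by
  have h1 := N.connected.dist_triangle (u := v) (v := w) (w := u)
  have h2 := SimpleGraph.dist_eq_one_iff_adj.2 h
  omega

theorem Network.eq_or_exists_adj_of_dist_le {v u : V} {d : ℕ} (h : N.graph.dist v u ≤ d + 1) :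
    v = u ∨ ∃ w, N.graph.Adj v w ∧ N.graph.dist w u ≤ d := by
  obtain ⟨p, hp⟩ := (N.connected v u).exists_walk_length_eq_dist
  cases p with
  | nil => exact Or.inl rfl
  | cons hvw q =>
    refine Or.inr ⟨_, hvw, ?_⟩
    have := SimpleGraph.dist_le q
    simp only [SimpleGraph.Walk.length_cons] at hp
    omega

/-- A function that differs at `v` and `x` differs along an edge that is not far from `v`. -/
theorem Network.exists_crossing {β : Type*} (m : V → β) {v x : V} (h : m v ≠ m x) :
    ∃ u w, N.graph.Adj u w ∧ m u ≠ m w ∧ N.graph.dist v u ≤ N.graph.dist v x := by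
  obtain ⟨p, hp⟩ := (N.connected v x).exists_walk_length_eq_dist
  rw [← hp]
  clear hp
  induction p with
  | nil => exact absurd rfl h
  | @cons v w x hvw q ih =>
    by_cases hw : m v = m w
    · obtain ⟨u, w', h1, h2, h3⟩ := ih (hw ▸ h)
      refine ⟨u, w', h1, h2, ?_⟩
      have := N.dist_le_succ hvw u
      simp only [SimpleGraph.Walk.length_cons]
      omega
    · exact ⟨v, w, hvw, hw, by simp⟩

end Distance

/-! ### Pipelined broadcast of many tokens -/

section Gossip

variable {C n κ : ℕ} {V : Type u} [Fintype V] {τ : Type}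

open Classical in
/-- Pick a token that is known but has not been sent. -/
noncomputable def gossipMsg (_ : ℕ) (s : Finset τ × Finset τ) : Option τ :=
  if h : (s.1 \ s.2).Nonempty then some h.choose else none

open Classical in
/-- Learn the tokens that arrive, and record the token that is sent. -/
noncomputable def gossipUpd (d : ℕ) (t : ℕ) (s : Finset τ × Finset τ) (x : Fin d → Option τ) :
    Finset τ × Finset τ :=
  (s.1 ∪ Finset.univ.biUnion fun p => (x p).toFinset, s.2 ∪ (gossipMsg t s).toFinset)

open Classical in
/-- Every vertex has a set of tokens. In each of `T` rounds it broadcasts one of the tokens that it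
knows and that it has not yet broadcast. The flag is raised if tokens are left in the end. -/
noncomputable def Prog.gossip (P : ℕ) (U : Set τ) (d T : ℕ) (K : Finset τ) :
    Prog C n (Finset τ × Bool) :=
  (Prog.phase P {x : Option τ | ∀ y ∈ x, y ∈ U} d gossipMsg (gossipUpd d) T 0 (K, ∅) false).bind
    fun r => .ret (r.1.1, r.2 || decide (r.1.1 ≠ r.1.2))

section

variable {N : Network n κ V} {K : V → Finset τ} {cfg : ℕ → V → Finset τ × Finset τ}
  (hcfg : Evolves N (fun _ => gossipMsg) (fun v => gossipUpd (N.deg v)) cfg)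
  (h0 : cfg 0 = fun v => (K v, ∅))

theorem gossipMsg_mem {t : ℕ} {s : Finset τ × Finset τ} {x : τ} (h : x ∈ gossipMsg t s) :
    x ∈ s.1 ∧ x ∉ s.2 := by
  classical
  rw [gossipMsg] at h
  split_ifs at h with hne
  · cases h
    exact Finset.mem_sdiff.1 hne.choose_spec
  · cases h

include hcfg

theorem gossip_known_iff (t : ℕ) (v : V) (x : τ) : x ∈ (cfg (t + 1) v).1 ↔
    x ∈ (cfg t v).1 ∨ ∃ w, N.graph.Adj v w ∧ x ∈ gossipMsg t (cfg t w) := by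
  rw [hcfg t v]
  simp only [gossipUpd, Finset.mem_union, Finset.mem_biUnion, Finset.mem_univ, true_and,
    Option.mem_toFinset]
  refine or_congr Iff.rfl ⟨?_, ?_⟩
  · rintro ⟨p, hp⟩
    exact ⟨_, N.adj_port v p, hp⟩
  · rintro ⟨w, hw, hx⟩
    obtain ⟨p, rfl⟩ := N.exists_port hw
    exact ⟨p, hx⟩

theorem gossip_sent_iff (t : ℕ) (v : V) (x : τ) :
    x ∈ (cfg (t + 1) v).2 ↔ x ∈ (cfg t v).2 ∨ x ∈ gossipMsg t (cfg t v) := by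
  rw [hcfg t v]
  simp only [gossipUpd, Finset.mem_union, Option.mem_toFinset]

theorem gossip_sent_mono (t : ℕ) (v : V) : (cfg t v).2 ⊆ (cfg (t + 1) v).2 :=
  fun x hx => (gossip_sent_iff hcfg t v x).2 (Or.inl hx)

theorem gossip_progress (t : ℕ) (v : V) :
    (cfg t v).1 ⊆ (cfg t v).2 ∨ (cfg t v).2.card + 1 ≤ (cfg (t + 1) v).2.card := by
  classical
  rw [or_iff_not_imp_left, ← Finset.sdiff_eq_empty_iff_subset, ← Finset.not_nonempty_iff_eq_empty,
    not_not]
  intro hne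
  obtain ⟨x, hx⟩ : ∃ x, x ∈ gossipMsg t (cfg t v) := by
    rw [gossipMsg, dif_pos]
    exacts [⟨_, rfl⟩, by convert hne]
  refine Nat.succ_le_of_lt (Finset.card_lt_card (Finset.ssubset_iff_subset_ne.2
    ⟨gossip_sent_mono hcfg t v, fun h => (gossipMsg_mem hx).2 ?_⟩))
  rw [h]
  exact (gossip_sent_iff hcfg t v x).2 (Or.inr hx)

include h0

theorem gossip_known_sub (t : ℕ) (v : V) (x : τ) (hx : x ∈ (cfg t v).1) : ∃ u, x ∈ K u := by
  induction t generalizing v with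
  | zero => rw [h0] at hx; exact ⟨v, hx⟩
  | succ t ih =>
    rcases (gossip_known_iff hcfg t v x).1 hx with hx | ⟨w, -, hx⟩
    · exact ih v hx
    · exact ih w (gossipMsg_mem hx).1

theorem gossip_initial_sub (t : ℕ) (v : V) : K v ⊆ (cfg t v).1 := by
  induction t with
  | zero => rw [h0]
  | succ t ih => exact fun x hx => (gossip_known_iff hcfg t v x).2 (Or.inl (ih hx))

theorem gossip_sent_sub_known (t : ℕ) (v : V) : (cfg t v).2 ⊆ (cfg t v).1 := by
  induction t with
  | zero => rw [h0]; simp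
  | succ t ih =>
    intro x hx
    rw [gossip_known_iff hcfg]
    rcases (gossip_sent_iff hcfg t v x).1 hx with hx | hx
    · exact Or.inl (ih hx)
    · exact Or.inl (gossipMsg_mem hx).1

/-- A token is sent to all neighbours at once, so whatever a vertex has sent is known next door in
the same configuration. -/
theorem gossip_sent_sub_known_of_adj (t : ℕ) {v w : V} (hvw : N.graph.Adj v w) :
    (cfg t w).2 ⊆ (cfg t v).1 := by
  induction t with
  | zero => rw [h0]; simp
  | succ t ih =>
    intro x hx
    rw [gossip_known_iff hcfg]
    rcases (gossip_sent_iff hcfg t w x).1 hx with hx | hx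
    · exact Or.inl (ih hx)
    · exact Or.inr ⟨w, hvw, hx⟩

/-- The pipelining of concurrent broadcasts: by time `d + j` a vertex has sent `j` tokens, or all
tokens that originate within distance `d`. -/
theorem gossip_pipeline (d j : ℕ) (v : V) : j ≤ (cfg (d + j) v).2.card ∨
    ∀ u, N.graph.dist v u ≤ d → K u ⊆ (cfg (d + j) v).2 := by
  induction d generalizing j v with
  | zero =>
    induction j with
    | zero => exact Or.inl (Nat.zero_le _)
    | succ j ih =>
      have hmono := gossip_sent_mono hcfg (0 + j) v
      rcases ih with ih | ih
      · rcases gossip_progress hcfg (0 + j) v with h | h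
        · right
          intro u hu
          have : v = u := (N.connected v u).dist_eq_zero_iff.1 (by omega)
          subst this
          exact (gossip_initial_sub hcfg h0 _ v).trans (h.trans hmono)
        · exact Or.inl ((Nat.succ_le_succ ih).trans h)
      · exact Or.inr fun u hu => (ih u hu).trans hmono
  | succ d ihd =>
    induction j with
    | zero => exact Or.inl (Nat.zero_le _)
    | succ j ih =>
      have hmono := gossip_sent_mono hcfg (d + 1 + j) v
      rcases ih with ih | ih
      · rcases gossip_progress hcfg (d + 1 + j) v with hne | h
        · rw [or_iff_not_imp_left]
          intro hcard u hu
          rcases N.eq_or_exists_adj_of_dist_le hu with rfl | ⟨w, hw, hwu⟩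
          · exact (gossip_initial_sub hcfg h0 _ v).trans (hne.trans hmono)
          -- The neighbour `w` is nearer to `u`, so the hypothesis for `d` applies to it at the same
          -- time with `j + 1` in place of `j`. All that `w` has sent is known to `v`, and `v` has
          -- nothing left to send.
          · have e : d + 1 + j = d + (j + 1) := by omega
            have hsub := gossip_sent_sub_known_of_adj hcfg h0 (d + 1 + j) hw
            rcases ihd (j + 1) w with h | h
            · rw [← e] at h
              exact absurd (h.trans (Finset.card_le_card (hsub.trans (hne.trans hmono)))) hcard
            · rw [← e] at h
              exact (h u hwu).trans (hsub.trans (hne.trans hmono))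
        · exact Or.inl ((Nat.succ_le_succ ih).trans h)
      · exact Or.inr fun u hu => (ih u hu).trans hmono

end

/-- Termination can be checked locally: if no vertex has an unsent token, each known set contains
those of the neighbours, so by connectivity all of them equal the union of the initial sets. No
bound on the number of tokens or on the diameter enters here; such bounds only ensure that `T`
rounds suffice. -/
theorem Runs.gossip (hC : 1 ≤ C) (N : Network n κ V) {P : ℕ} {U : Set τ}
    (hU : Transmissible C n P {x : Option τ | ∀ y ∈ x, y ∈ U}) (T : ℕ) (K : V → Finset τ) :
    ∃ out : V → Finset τ × Bool,
      Runs (C := C) N (T * P) (fun v => Prog.gossip P U (N.deg v) T (K v)) out ∧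
      ((∀ v, (out v).2 = false) → ∀ v x, x ∈ (out v).1 ↔ ∃ u, x ∈ K u) ∧
      (∀ (A : Finset τ) (d : ℕ), (∀ u, K u ⊆ A) → (∀ x ∈ A, x ∈ U) →
        (∀ u v, N.graph.dist u v ≤ d) → d + A.card ≤ T → ∀ v, (out v).2 = false) := by
  classical
  obtain ⟨cfg, h0, hcfg⟩ := exists_evolves N (fun _ => gossipMsg)
    (fun v => gossipUpd (N.deg v)) fun v => (K v, (∅ : Finset τ))
  obtain ⟨out, ho, -, ho1, ho2⟩ := Runs.phase hC N hU hcfg T 0 (fun v => (K v, ∅)) fun _ => false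
  refine ⟨fun v => ((out v).1.1, (out v).2 || decide ((out v).1.1 ≠ (out v).1.2)), ?_, ?_, ?_⟩
  · exact Runs.bind (T' := 0) ho (Runs.ret N _)
  · intro hf
    simp only [ne_eq, Bool.or_eq_false_iff, decide_eq_false_iff_not, not_not] at hf
    have h1 := ho1 h0.symm fun v => (hf v).1
    have h2 : ∀ v, (cfg (0 + T) v).1 = (cfg (0 + T) v).2 := by
      intro v
      rw [← (h1 v).1]
      exact (hf v).2
    intro v x
    change x ∈ (out v).1.1 ↔ _
    rw [(h1 v).1]
    refine ⟨gossip_known_sub hcfg h0 _ v x, ?_⟩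
    rintro ⟨u, hu⟩
    have hu' := gossip_initial_sub hcfg h0 (0 + T) u hu
    obtain ⟨p⟩ := N.connected v u
    clear hu
    induction p with
    | nil => exact hu'
    | cons hvw q ih =>
      have := ih hu'
      rw [h2] at this
      exact gossip_sent_sub_known_of_adj hcfg h0 _ hvw this
  · intro A d hKA hAU hd hT
    have hsub : ∀ t v, (cfg t v).1 ⊆ A := fun t v x hx => by
      obtain ⟨u, hu⟩ := gossip_known_sub hcfg h0 t v x hx
      exact hKA u hu
    have h := ho2 h0.symm fun v t' _ _ y hy => hAU y (hsub t' v (gossipMsg_mem hy).1)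
    intro v
    simp only [h v, ne_eq, Bool.false_or, decide_eq_false_iff_not, not_not]
    refine Finset.Subset.antisymm ?_ (gossip_sent_sub_known hcfg h0 _ v)
    obtain ⟨j, rfl⟩ : ∃ j, T = d + j := ⟨T - d, by omega⟩
    rw [Nat.zero_add]
    -- Here `j` is at least the number of tokens, so having sent `j` of them also means having sent
    -- all.
    rcases gossip_pipeline hcfg h0 d j v with h' | h'
    · have hs := (gossip_sent_sub_known hcfg h0 (d + j) v).trans (hsub _ v)
      have := Finset.eq_of_subset_of_card_le hs (by omega)
      rw [this]
      exact hsub _ v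
    · intro x hx
      obtain ⟨u, hu⟩ := gossip_known_sub hcfg h0 _ v x hx
      exact h' u (hd v u) hu

end Gossip

/-! ### Flooding flags and testing the diameter -/

section Flooding

variable {C n κ : ℕ} {V : Type u} [Fintype V]

open Classical in
/-- Flood a flag for `T` rounds. -/
noncomputable def Prog.flood (P d T : ℕ) (b : Bool) : Prog C n Bool :=
  (Prog.phase P Set.univ d (fun _ s => s) (fun _ s x => s || decide (∃ p : Fin d, x p = true))
    T 0 b false).bind fun r => .ret r.1

open Classical in
theorem Runs.flood (hC : 1 ≤ C) (N : Network n κ V) {P : ℕ}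
    (hU : Transmissible C n P (Set.univ : Set Bool)) (T : ℕ) (b : V → Bool) :
    Runs (C := C) N (T * P) (fun v => Prog.flood P (N.deg v) T (b v))
      fun v => decide (∃ u, N.graph.dist v u ≤ T ∧ b u = true) := by
  obtain ⟨cfg, h0, hcfg⟩ := exists_evolves N (fun _ _ (s : Bool) => s)
    (fun v _ s x => s || decide (∃ p : Fin (N.deg v), x p = true)) b
  obtain ⟨out, ho, -, -, ho2⟩ := Runs.phase hC N hU hcfg T 0 b fun _ => false
  have h := ho2 h0.symm fun v t' _ _ => Set.mem_univ _
  have key : ∀ t v, cfg t v = decide (∃ u, N.graph.dist v u ≤ t ∧ b u = true) := by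
    intro t
    induction t with
    | zero =>
      intro v
      rw [h0, eq_comm, Bool.eq_iff_iff, decide_eq_true_iff]
      constructor
      · rintro ⟨u, hu, hb⟩
        have : v = u := (N.connected v u).dist_eq_zero_iff.1 (by omega)
        rwa [this]
      · exact fun hb => ⟨v, by simp, hb⟩
    | succ t ih =>
      intro v
      rw [hcfg t v, Bool.eq_iff_iff]
      simp only [ih, Bool.or_eq_true, decide_eq_true_eq]
      constructor
      · rintro (⟨u, hu, hb⟩ | ⟨p, u, hu, hb⟩)
        · exact ⟨u, by omega, hb⟩
        · have := N.dist_le_succ (N.adj_port v p) u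
          exact ⟨u, by omega, hb⟩
      · rintro ⟨u, hu, hb⟩
        rcases N.eq_or_exists_adj_of_dist_le hu with rfl | ⟨w, hw, hwu⟩
        · exact Or.inl ⟨v, by simp, hb⟩
        · obtain ⟨p, rfl⟩ := N.exists_port hw
          exact Or.inr ⟨p, u, hwu, hb⟩
  refine Runs.bind (T' := 0) ho ?_
  intro v
  simp only [h v, key, Nat.zero_add]

open Classical in
/-- Flood the smallest identifier for `R` rounds, and compare the result with that of the
neighbours. -/
noncomputable def Prog.leader (P : ℕ) (U : Set ℕ) (d R : ℕ) (m : ℕ) : Prog C n Bool :=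
  (Prog.phase P U d (fun _ s => s)
    (fun _ s x => (insert s (Finset.univ.image x)).min' (Finset.insert_nonempty _ _)) R 0 m
    false).bind fun r => (Prog.exchange P U r.1).bind fun x =>
      .ret (decide (∃ p : Fin d, x p ≠ r.1))

/-- After `R` rounds a vertex holds the smallest identifier in its ball of radius `R`. If some
vertex sees no disagreement between neighbours within distance `2 * R + 1`, the values there are
constant, and the vertex with this identifier has the whole graph within distance `R`. Otherwise
every vertex has a raised flag nearby. Thus flooding for `2 * R + 1` rounds is reliable, either
because it reaches everybody or because everybody hears of some flag anyway. -/
theorem Runs.leader (hC : 1 ≤ C) (N : Network n κ V) {P : ℕ} {U : Set ℕ}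
    (hU : Transmissible C n P U) (hid : ∀ v, N.ident v ∈ U) (R : ℕ) :
    ∃ out : V → Bool,
      Runs (C := C) N (R * P + P) (fun v => Prog.leader P U (N.deg v) R (N.ident v)) out ∧
      ((∀ v w, N.graph.dist v w ≤ 2 * R + 1) ∨
        ∀ v, ∃ u, N.graph.dist v u ≤ 2 * R + 1 ∧ out u = true) ∧
      ((∀ v w, N.graph.dist v w ≤ R) → ∀ v, out v = false) := by
  classical
  obtain ⟨cfg, h0, hcfg⟩ := exists_evolves N (fun _ _ (s : ℕ) => s)
    (fun v _ s (x : Fin (N.deg v) → ℕ) =>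
      (insert s (Finset.univ.image x)).min' (Finset.insert_nonempty _ _)) N.ident
  have key : ∀ t v, (∃ u, N.graph.dist v u ≤ t ∧ cfg t v = N.ident u) ∧
      ∀ u, N.graph.dist v u ≤ t → cfg t v ≤ N.ident u := by
    intro t
    induction t with
    | zero =>
      intro v
      rw [h0]
      refine ⟨⟨v, by simp, rfl⟩, fun u hu => ?_⟩
      have : v = u := (N.connected v u).dist_eq_zero_iff.1 (by omega)
      rw [this]
    | succ t ih =>
      intro v
      rw [hcfg t v]
      constructor
      · have := Finset.min'_mem (insert (cfg t v) (Finset.univ.image fun p =>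
          cfg t (N.port v p))) (Finset.insert_nonempty _ _)
        rw [Finset.mem_insert, Finset.mem_image] at this
        rcases this with h | ⟨p, -, h⟩
        · obtain ⟨u, hu, hc⟩ := (ih v).1
          exact ⟨u, by omega, h.trans hc⟩
        · obtain ⟨u, hu, hc⟩ := (ih (N.port v p)).1
          have := N.dist_le_succ (N.adj_port v p) u
          exact ⟨u, by omega, h.symm.trans hc⟩
      · intro u hu
        rcases N.eq_or_exists_adj_of_dist_le hu with rfl | ⟨w, hw, hwu⟩
        · exact (Finset.min'_le _ _ (Finset.mem_insert_self _ _)).trans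
            ((ih v).2 v (by simp))
        · obtain ⟨p, rfl⟩ := N.exists_port hw
          exact (Finset.min'_le _ _ (Finset.mem_insert_of_mem
            (Finset.mem_image_of_mem _ (Finset.mem_univ p)))).trans ((ih _).2 u hwu)
  have hmem : ∀ t v, cfg t v ∈ U := by
    intro t v
    obtain ⟨u, -, hu⟩ := (key t v).1
    rw [hu]
    exact hid u
  obtain ⟨out, ho, -, -, ho2⟩ := Runs.phase hC N hU hcfg R 0 N.ident fun _ => false
  have h := ho2 h0.symm fun v t' _ _ => hmem t' v
  obtain ⟨r, hr, hr'⟩ := Runs.exchange hC N hU fun v => (out v).1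
  have hrv : ∀ v (p : Fin (N.deg v)), r v p = cfg R (N.port v p) := by
    intro v p
    rw [hr' v p (by rw [h]; exact hmem _ _), h, Nat.zero_add]
  have hov : ∀ v, (out v).1 = cfg R v := fun v => by rw [h, Nat.zero_add]
  have hb : ∀ u w, N.graph.Adj u w → cfg R u ≠ cfg R w →
      (decide (∃ p : Fin (N.deg u), r u p ≠ (out u).1)) = true := by
    intro u w huw hne
    obtain ⟨p, rfl⟩ := N.exists_port huw
    simp only [decide_eq_true_eq]
    exact ⟨p, by rw [hrv, hov]; exact hne.symm⟩
  refine ⟨fun v => decide (∃ p : Fin (N.deg v), r v p ≠ (out v).1), ?_, ?_, ?_⟩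
  · exact Runs.bind ho (Runs.bind (T' := 0) hr (Runs.ret N _))
  · rw [or_iff_not_imp_right]
    intro hno
    push Not at hno
    obtain ⟨v, hv⟩ := hno
    have hconst : ∀ x, N.graph.dist v x ≤ 2 * R + 1 → cfg R v = cfg R x := by
      intro x hx
      by_contra hne
      obtain ⟨u, w, huw, hm, hd⟩ := N.exists_crossing (cfg R) hne
      exact hv u (hd.trans hx) (hb u w huw hm)
    obtain ⟨r₀, hr₀, hc⟩ := (key R v).1
    -- The ball of radius `R` around `r₀` is closed under taking neighbours: a vertex at distance at
    -- most `R + 1` from `r₀` lies within `2 * R + 1` of `v`, so it holds the identifier of `r₀`,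
    -- which came from distance at most `R`.
    have hall : ∀ d x, N.graph.dist r₀ x ≤ d → N.graph.dist r₀ x ≤ R := by
      intro d
      induction d with
      | zero => intro x hx; omega
      | succ d ih =>
        intro x hx
        rw [SimpleGraph.dist_comm] at hx
        have hx1 : N.graph.dist r₀ x ≤ R + 1 := by
          rcases N.eq_or_exists_adj_of_dist_le hx with rfl | ⟨w, hw, hwr⟩
          · simp
          · rw [SimpleGraph.dist_comm] at hwr
            have h1 := ih w hwr
            have h2 := N.dist_le_succ hw r₀
            rw [SimpleGraph.dist_comm (u := w), SimpleGraph.dist_comm (u := x)] at h2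
            omega
        have htri := N.connected.dist_triangle (u := v) (v := r₀) (w := x)
        obtain ⟨y, hy, hcy⟩ := (key R x).1
        rw [← hconst x (by omega), hc] at hcy
        rw [N.ident_injective hcy, SimpleGraph.dist_comm]
        exact hy
    intro x y
    have h1 := hall _ x le_rfl
    have h2 := hall _ y le_rfl
    have htri := N.connected.dist_triangle (u := x) (v := r₀) (w := y)
    rw [SimpleGraph.dist_comm (u := x) (v := r₀)] at htri
    omega
  · intro hd v
    simp only [decide_eq_false_iff_not, not_exists, not_not]
    intro p
    rw [hrv, hov]
    obtain ⟨a, ha, hac⟩ := (key R v).1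
    obtain ⟨b, hb', hbc⟩ := (key R (N.port v p)).1
    exact le_antisymm (hac ▸ (key R _).2 a (hd _ _)) (hbc ▸ (key R _).2 b (hd _ _))

end Flooding

/-! ### Rooted trees: ancestors, recursion from the root, subtree sizes -/

/-- A rooted tree, given by the parent of each vertex and the distance to the root. -/
structure RootedTree (V : Type u) where
  verts : Set V
  root : V
  par : V → V
  dep : V → ℕ
  root_mem : root ∈ verts
  par_root : par root = root
  dep_root : dep root = 0
  par_mem : ∀ v ∈ verts, par v ∈ verts
  dep_par : ∀ v ∈ verts, v ≠ root → dep v = dep (par v) + 1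

namespace RootedTree

variable {V : Type u} (T : RootedTree V)

/-- `c` is a child of `v`. -/
def IsChild (c v : V) : Prop := c ∈ T.verts ∧ c ≠ T.root ∧ T.par c = v

/-- `v` is an ancestor of `x`, possibly `x` itself. -/
def Anc (v x : V) : Prop := ∃ j, T.par^[j] x = v

variable {T} {u v w x y c c' : V}

theorem iterate_mem (hx : x ∈ T.verts) (j : ℕ) : T.par^[j] x ∈ T.verts := by
  induction j with
  | zero => exact hx
  | succ j ih => rw [Function.iterate_succ_apply']; exact T.par_mem _ ih

theorem dep_iterate (hx : x ∈ T.verts) {j : ℕ} (hj : j ≤ T.dep x) :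
    T.dep (T.par^[j] x) + j = T.dep x := by
  induction j with
  | zero => rfl
  | succ j ih =>
    have := ih (by omega)
    have h2 := T.dep_par _ (iterate_mem hx j) (fun h => by
      rw [h, T.dep_root] at this; omega)
    rw [Function.iterate_succ_apply']
    omega

theorem eq_root_of_dep (hx : x ∈ T.verts) (h : T.dep x = 0) : x = T.root := by
  by_contra hne
  have := T.dep_par x hx hne
  omega

theorem iterate_eq_root (hx : x ∈ T.verts) {j : ℕ} (hj : T.dep x ≤ j) : T.par^[j] x = T.root := by
  have h0 : T.par^[T.dep x] x = T.root :=
    eq_root_of_dep (iterate_mem hx _) (by have := dep_iterate hx le_rfl; omega)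
  obtain ⟨k, rfl⟩ := Nat.exists_eq_add_of_le' hj
  rw [Function.iterate_add_apply, h0, Function.iterate_fixed T.par_root]

theorem Anc.refl (v : V) : T.Anc v v := ⟨0, rfl⟩

theorem Anc.trans (h : T.Anc u v) (h' : T.Anc v w) : T.Anc u w := by
  obtain ⟨i, rfl⟩ := h
  obtain ⟨j, rfl⟩ := h'
  exact ⟨i + j, Function.iterate_add_apply _ _ _ _⟩

theorem anc_par (v : V) : T.Anc (T.par v) v := ⟨1, rfl⟩

theorem anc_root (hx : x ∈ T.verts) : T.Anc T.root x := ⟨_, iterate_eq_root hx le_rfl⟩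

theorem Anc.mem (h : T.Anc v x) (hx : x ∈ T.verts) : v ∈ T.verts := by
  obtain ⟨j, rfl⟩ := h
  exact iterate_mem hx j

theorem Anc.eq_or (h : T.Anc v x) : v = x ∨ T.Anc v (T.par x) := by
  obtain ⟨j, rfl⟩ := h
  cases j with
  | zero => exact Or.inl rfl
  | succ j => exact Or.inr ⟨j, rfl⟩

theorem Anc.dep_le (h : T.Anc v x) (hx : x ∈ T.verts) : T.dep v ≤ T.dep x := by
  obtain ⟨j, rfl⟩ := h
  rcases le_total j (T.dep x) with hj | hj
  · have := dep_iterate hx hj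
    omega
  · rw [iterate_eq_root hx hj, T.dep_root]
    exact Nat.zero_le _

theorem Anc.eq_of_dep (h : T.Anc v x) (hx : x ∈ T.verts) (hd : T.dep x ≤ T.dep v) : v = x := by
  obtain ⟨j, rfl⟩ := h
  rcases le_total j (T.dep x) with hj | hj
  · have := dep_iterate hx hj
    obtain rfl : j = 0 := by omega
    rfl
  · rw [iterate_eq_root hx hj] at hd ⊢
    rw [T.dep_root] at hd
    exact (eq_root_of_dep hx (by omega)).symm

theorem Anc.total (hu : T.Anc u x) (hv : T.Anc v x) : T.Anc u v ∨ T.Anc v u := by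
  obtain ⟨i, rfl⟩ := hu
  obtain ⟨j, rfl⟩ := hv
  rcases le_total i j with h | h
  · right
    exact ⟨j - i, by rw [← Function.iterate_add_apply, Nat.sub_add_cancel h]⟩
  · left
    exact ⟨i - j, by rw [← Function.iterate_add_apply, Nat.sub_add_cancel h]⟩

theorem IsChild.parent_mem (h : T.IsChild c v) : v ∈ T.verts := h.2.2 ▸ T.par_mem c h.1

theorem IsChild.dep (h : T.IsChild c v) : T.dep c = T.dep v + 1 := by
  rw [← h.2.2]; exact T.dep_par c h.1 h.2.1

theorem IsChild.anc (h : T.IsChild c v) : T.Anc v c := h.2.2 ▸ anc_par c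

theorem IsChild.not_anc (h : T.IsChild c v) (hv : v ∈ T.verts) : ¬T.Anc c v := fun h' => by
  have := h'.dep_le hv
  have := h.dep
  omega

theorem Anc.exists_child (h : T.Anc v x) (hne : v ≠ x) (hx : x ∈ T.verts) :
    ∃ c, T.IsChild c v ∧ T.Anc c x := by
  obtain ⟨j, rfl⟩ := h
  induction j generalizing x with
  | zero => exact absurd rfl hne
  | succ j ih =>
    have hxr : x ≠ T.root := by
      rintro rfl
      exact hne (Function.iterate_fixed T.par_root _)
    rw [Function.iterate_succ_apply] at hne ⊢
    by_cases h : T.par^[j] (T.par x) = T.par x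
    · rw [h]
      exact ⟨x, ⟨hx, hxr, rfl⟩, Anc.refl x⟩
    · obtain ⟨c, hc, hcx⟩ := ih (T.par_mem x hx) h
      exact ⟨c, hc, hcx.trans (anc_par x)⟩

theorem IsChild.unique (h : T.IsChild c v) (h' : T.IsChild c' v) (hc : T.Anc c x)
    (hc' : T.Anc c' x) : c = c' := by
  have h1 := h.dep
  have h2 := h'.dep
  rcases hc.total hc' with h3 | h3
  · exact h3.eq_of_dep h'.1 (by omega)
  · exact (h3.eq_of_dep h.1 (by omega)).symm

/-- Climbing from `v` until the first ancestor `e` of `y` finds the place where the paths from the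
root to `v` and to `y` part; `c` is the next vertex towards `v`. This is the configuration in which
a packet has to go up. -/
theorem exists_branching (hv : v ∈ T.verts) (hy : y ∈ T.verts) (h : ¬T.Anc v y) :
    ∃ e c, T.IsChild c e ∧ T.Anc c v ∧ T.Anc e y ∧ ¬T.Anc c y := by
  obtain ⟨d, hd⟩ : ∃ d, d = T.dep v := ⟨_, rfl⟩
  induction d generalizing v with
  | zero => exact absurd (anc_root hy) (by rwa [← eq_root_of_dep hv hd.symm])
  | succ d ih =>
    have hvr : v ≠ T.root := by rintro rfl; exact h (anc_root hy)
    by_cases hp : T.Anc (T.par v) y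
    · exact ⟨T.par v, v, ⟨hv, hvr, rfl⟩, Anc.refl v, hp, h⟩
    · obtain ⟨e, c, h1, h2, h3⟩ := ih (T.par_mem v hv) hp (by
        have := T.dep_par v hv hvr; omega)
      exact ⟨e, c, h1, h2.trans (anc_par v), h3⟩

section Fold

variable {β : Type*}

variable (T) in
/-- Recursion from the root to the leaves. -/
def fold (F : V → Option β → β) (v : V) : β :=
  go (T.dep v) v
where
  go : ℕ → V → β
  | 0, v => F v none
  | d + 1, v => F v (some (go d (T.par v)))

theorem fold_root (F : V → Option β → β) : T.fold F T.root = F T.root none := by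
  rw [fold, T.dep_root, fold.go]

theorem fold_of_ne (F : V → Option β → β) (hv : v ∈ T.verts) (h : v ≠ T.root) :
    T.fold F v = F v (some (T.fold F (T.par v))) := by
  rw [fold, T.dep_par v hv h, fold.go, fold]

end Fold

section Size

variable [Fintype V]

open Classical in
variable (T) in
/-- The vertices of the subtree of `v`. -/
noncomputable def sub (v : V) : Finset V := {x | x ∈ T.verts ∧ T.Anc v x}

open Classical in
variable (T) in
/-- The children of `v`. -/
noncomputable def children (v : V) : Finset V := {c | T.IsChild c v}

variable (T) in
/-- The size of the subtree of `v`. -/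
noncomputable def sz (v : V) : ℕ := (T.sub v).card

theorem mem_sub : x ∈ T.sub v ↔ x ∈ T.verts ∧ T.Anc v x := by simp [sub]

theorem mem_children : c ∈ T.children v ↔ T.IsChild c v := by simp [children]

theorem sum_sub {M : Type*} [AddCommMonoid M] (f : V → M) (hv : v ∈ T.verts) :
    ∑ x ∈ T.sub v, f x = f v + ∑ c ∈ T.children v, ∑ x ∈ T.sub c, f x := by
  classical
  have h : T.sub v = insert v ((T.children v).biUnion T.sub) := by
    ext x
    simp only [mem_sub, Finset.mem_insert, Finset.mem_biUnion, mem_children]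
    constructor
    · rintro ⟨hx, h⟩
      by_cases hne : v = x
      · exact Or.inl hne.symm
      · obtain ⟨c, hc, hcx⟩ := h.exists_child hne hx
        exact Or.inr ⟨c, hc, hx, hcx⟩
    · rintro (rfl | ⟨c, hc, hx, hcx⟩)
      · exact ⟨hv, Anc.refl _⟩
      · exact ⟨hx, hc.anc.trans hcx⟩
  rw [h, Finset.sum_insert, Finset.sum_biUnion]
  · intro c hc c' hc' hne
    rw [Function.onFun, Finset.disjoint_left]
    intro x hx hx'
    rw [mem_sub] at hx hx'
    exact hne ((mem_children.1 hc).unique (mem_children.1 hc') hx.2 hx'.2)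
  · simp only [Finset.mem_biUnion, mem_children, mem_sub, not_exists, not_and]
    exact fun c hc _ => hc.not_anc hv

theorem sz_eq (hv : v ∈ T.verts) : T.sz v = 1 + ∑ c ∈ T.children v, T.sz c := by
  simp only [sz, Finset.card_eq_sum_ones]
  exact sum_sub (fun _ => 1) hv

theorem sz_pos (hv : v ∈ T.verts) : 0 < T.sz v := by rw [sz_eq hv]; omega

theorem sz_le (v : V) : T.sz v ≤ Fintype.card V := Finset.card_le_univ _

theorem Anc.sz_le (h : T.Anc v x) : T.sz x ≤ T.sz v := by
  refine Finset.card_le_card fun z hz => ?_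
  rw [mem_sub] at hz ⊢
  exact ⟨hz.1, h.trans hz.2⟩

theorem IsChild.sz_lt (h : T.IsChild c v) (hv : v ∈ T.verts) : T.sz c < T.sz v := by
  rw [sz_eq hv]
  have := Finset.single_le_sum (f := T.sz) (fun _ _ => Nat.zero_le _) (mem_children.2 h)
  omega

end Size

/-! ### Heavy-path routing in a single tree -/

section Routing

variable [Fintype V]

variable (T) in
open Classical in
/-- The edges of the path from the root to `v` that do not lead to the heavy child `hv` of their upper
end. An edge is described by the subtree size of its upper end and the port `pt` at this end. -/
noncomputable def lights (hv : V → V) (pt : V → ℕ) : V → List (ℕ × ℕ) :=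
  T.fold fun v o => o.elim [] fun l =>
    l ++ if v = hv (T.par v) then [] else [(T.sz (T.par v), pt v)]

variable (T) in
/-- `hv` maps each vertex that is not a leaf to its heavy child. -/
def IsHeavy (hv : V → V) : Prop :=
  ∀ v c, T.IsChild c v → T.IsChild (hv v) v ∧ T.sz c ≤ T.sz (hv v)

variable {hv : V → V} {pt : V → ℕ}

theorem lights_root : T.lights hv pt T.root = [] := by
  rw [lights, fold_root]; rfl

open Classical in
theorem IsChild.lights (h : T.IsChild c v) : T.lights hv pt c =
    T.lights hv pt v ++ if c = hv v then [] else [(T.sz v, pt c)] := by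
  rw [RootedTree.lights, fold_of_ne _ h.1 h.2.1, Option.elim_some, h.2.2]

/-- Downwards the quantity `2 ^ length * size` never increases: a light edge doubles the first
factor and at least halves the second. -/
theorem length_lights (hh : T.IsHeavy hv) (hx : x ∈ T.verts) :
    2 ^ (T.lights hv pt x).length * T.sz x ≤ Fintype.card V := by
  classical
  obtain ⟨d, hd⟩ : ∃ d, d = T.dep x := ⟨_, rfl⟩
  induction d generalizing x with
  | zero =>
    rw [eq_root_of_dep hx hd.symm, lights_root]
    simpa using sz_le _
  | succ d ih =>
    have hr : x ≠ T.root := by rintro rfl; rw [T.dep_root] at hd; omega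
    have hc : T.IsChild x (T.par x) := ⟨hx, hr, rfl⟩
    refine le_trans ?_ (ih (T.par_mem x hx) (by have := hc.dep; omega))
    rw [hc.lights]
    split_ifs with h
    · rw [List.append_nil]
      exact Nat.mul_le_mul_left _ (hc.sz_lt (T.par_mem x hx)).le
    · rw [List.length_append, List.length_singleton, pow_succ, mul_assoc]
      refine Nat.mul_le_mul_left _ ?_
      obtain ⟨h1, h2⟩ := hh _ _ hc
      -- A light child and the heavy child are distinct, and the heavy one is no smaller, so the
      -- parent has more than twice the size of the light child.
      have hs : ∑ c ∈ ({x, hv (T.par x)} : Finset V), T.sz c ≤ ∑ c ∈ T.children (T.par x), T.sz c := by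
        refine Finset.sum_le_sum_of_subset fun z hz => ?_
        rw [Finset.mem_insert, Finset.mem_singleton] at hz
        rcases hz with rfl | rfl
        · exact mem_children.2 hc
        · exact mem_children.2 h1
      rw [Finset.sum_pair h] at hs
      rw [sz_eq (T.par_mem x hx)]
      omega

variable (T hv pt) in
/-- The description of the path from the root to `y`. -/
noncomputable def pathLabel (y : V) : List (ℕ × ℕ) := T.lights hv pt y ++ [(T.sz y, 0)]

/-- The first light edge below `v` on the way to `y` starts inside the subtree of `v`. The bound on
its size entry lets a vertex above `v` recognise that this edge lies further down. -/
theorem Anc.lights (h : T.Anc v y) (hy : y ∈ T.verts) : ∃ t,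
    T.lights hv pt y = T.lights hv pt v ++ t ∧ ∀ z ∈ t.head?, z.1 ≤ T.sz v := by
  classical
  obtain ⟨d, hd⟩ : ∃ d, d + T.dep v = T.dep y := ⟨_, Nat.sub_add_cancel (h.dep_le hy)⟩
  induction d generalizing v with
  | zero =>
    obtain rfl := h.eq_of_dep hy (by omega)
    exact ⟨[], by simp, by simp⟩
  | succ d ih =>
    obtain ⟨c, hc, hcy⟩ := h.exists_child (by rintro rfl; omega) hy
    obtain ⟨t, ht, hs⟩ := ih hcy (by have := hc.dep; omega)
    rw [hc.lights, List.append_assoc] at ht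
    refine ⟨_, ht, ?_⟩
    split_ifs
    · exact fun z hz => (hs z hz).trans (hc.sz_lt hc.parent_mem).le
    · simp

/-- The final entry `(T.sz y, 0)` of a label guarantees that something follows the part shared with
`v`, even if no light edge does. -/
theorem Anc.pathLabel (h : T.Anc v y) (hy : y ∈ T.verts) : ∃ s q l,
    T.pathLabel hv pt y = T.lights hv pt v ++ (s, q) :: l ∧ s ≤ T.sz v := by
  obtain ⟨t, ht, hs⟩ := h.lights (hv := hv) (pt := pt) hy
  rw [RootedTree.pathLabel, ht, List.append_assoc]
  cases t with
  | nil => exact ⟨_, _, _, rfl, h.sz_le⟩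
  | cons z t => exact ⟨_, _, _, rfl, hs z rfl⟩

open Classical in
/-- The routing decision at a vertex, encoded as `0` for arrival and as `p + 1` for port `p`, from the
light edges above the vertex, the size of its subtree, the encoded ports to its parent and to its heavy
child, and the label of the destination. -/
noncomputable def nextPort (l : List (ℕ × ℕ)) (s up down : ℕ) (L : List (ℕ × ℕ)) : ℕ :=
  if l <+: L then
    match L.drop l.length with
    | [] => up
    | (s', q) :: _ => if s' < s then down else if s' = s then q else up
  else up

theorem nextPort_append (l : List (ℕ × ℕ)) (s up down s' q : ℕ) (l' : List (ℕ × ℕ)) :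
    nextPort l s up down (l ++ (s', q) :: l') =
      if s' < s then down else if s' = s then q else up := by
  simp [nextPort]

theorem nextPort_self (v : V) (up down : ℕ) :
    nextPort (T.lights hv pt v) (T.sz v) up down (T.pathLabel hv pt v) = 0 := by
  rw [pathLabel, nextPort_append]
  simp

open Classical in
-- If `c` is the heavy child, the next entry of the label has size at most that of `c`, hence less
-- than that of `v`. If `c` is light, the next entry is the edge to `c` itself, recognised by its
-- size being that of `v`.
theorem nextPort_child (hc : T.IsChild c v) (hcy : T.Anc c y) (hy : y ∈ T.verts) (up down : ℕ) :
    nextPort (T.lights hv pt v) (T.sz v) up down (T.pathLabel hv pt y) =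
      if c = hv v then down else pt c := by
  obtain ⟨s, q, l, hl, hs⟩ := hcy.pathLabel (hv := hv) (pt := pt) hy
  rw [hl, hc.lights]
  have := hc.sz_lt hc.parent_mem
  split_ifs with h
  · rw [List.append_nil, nextPort_append, if_pos (by omega)]
  · rw [List.append_assoc, List.singleton_append, nextPort_append]
    simp

/-- Where the paths to `v` and to `y` part at `e`, at least one of them leaves `e` by a light edge
or ends there, so the two descriptions differ at that point. The value `0` must not be a port
because it marks the case that `y` is `e` itself. -/
theorem nextPort_parent (hpt : ∀ c c' v, T.IsChild c v → T.IsChild c' v → pt c = pt c' → c = c')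
    (hpt0 : ∀ c, pt c ≠ 0) (hv' : v ∈ T.verts) (hy : y ∈ T.verts) (h : ¬T.Anc v y) (up down : ℕ) :
    nextPort (T.lights hv pt v) (T.sz v) up down (T.pathLabel hv pt y) = up := by
  classical
  obtain ⟨e, c, hc, hcv, hey, hcy⟩ := exists_branching hv' hy h
  have hszc := hc.sz_lt hc.parent_mem
  have hszv := hcv.sz_le
  obtain ⟨t, ht, hs⟩ := hcv.lights (hv := hv) (pt := pt) hv'
  rw [hc.lights, List.append_assoc] at ht
  -- the part of the label of `y` below `e` starts with something else than the path towards `c`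
  have hyl : ∃ q l, ((T.pathLabel hv pt y = T.lights hv pt e ++ (T.sz e, q) :: l ∧
      q ≠ pt c) ∨ (c ≠ hv e ∧ ∃ s < T.sz e, T.pathLabel hv pt y = T.lights hv pt e ++ (s, q) :: l)) := by
    by_cases hne : e = y
    · subst hne
      exact ⟨0, [], Or.inl ⟨rfl, (hpt0 c).symm⟩⟩
    · obtain ⟨c', hc', hc'y⟩ := hey.exists_child hne hy
      have hcc : c' ≠ c := by rintro rfl; exact hcy hc'y
      obtain ⟨s, q, l, hl, hs⟩ := hc'y.pathLabel (hv := hv) (pt := pt) hy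
      rw [hc'.lights] at hl
      split_ifs at hl with hh
      · rw [List.append_nil] at hl
        exact ⟨q, l, Or.inr ⟨fun h => hcc (hh.trans h.symm), s,
          hs.trans_lt (hc'.sz_lt hc.parent_mem), hl⟩⟩
      · rw [List.append_assoc] at hl
        exact ⟨_, _, Or.inl ⟨hl, fun h => hcc (hpt _ _ _ hc' hc h)⟩⟩
  rw [ht]
  -- If `c` is heavy, the next entry of the label has the size of `e`, too large for anything below
  -- `c`: either the prefix test fails or the final comparison sends the packet up. If `c` is light,
  -- the description of `v` contains an edge that the label lacks, so the prefix test fails.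
  by_cases hch : c = hv e
  · rw [if_pos hch, List.nil_append] at ht ⊢
    obtain ⟨q, l, ⟨hl, -⟩ | ⟨h', -⟩⟩ := hyl
    · rw [hl]
      cases t with
      | nil => rw [List.append_nil, nextPort_append, if_neg (by omega), if_neg (by omega)]
      | cons z t =>
        rw [nextPort, if_neg]
        rw [List.prefix_append_right_inj, List.cons_prefix_cons]
        rintro ⟨rfl, -⟩
        have := hs _ rfl
        simp only at this
        omega
    · exact absurd hch h'
  · rw [if_neg hch, List.singleton_append, nextPort, if_neg]
    obtain ⟨q, l, ⟨hl, hq⟩ | ⟨-, s, hs, hl⟩⟩ := hyl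
    · rw [hl, List.prefix_append_right_inj, List.cons_prefix_cons]
      exact fun h => hq (congrArg Prod.snd h.1).symm
    · rw [hl, List.prefix_append_right_inj, List.cons_prefix_cons]
      intro h
      have := congrArg Prod.fst h.1
      simp only at this
      omega

end Routing

end RootedTree

/-! ### From trees as subgraphs to rooted trees -/

section Parents

/-- A neighbour nearer to `r` is the penultimate vertex of a shortest path from `r` to `v`, and a
tree has only one path. -/
theorem _root_.SimpleGraph.IsTree.eq_of_adj_of_dist_lt {V : Type*} {G : SimpleGraph V}
    (hG : G.IsTree) {r v u u' : V} (hu : G.Adj v u) (hu' : G.Adj v u')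
    (hd : G.dist r u < G.dist r v) (hd' : G.dist r u' < G.dist r v) : u = u' := by
  have key : ∀ u, G.Adj v u → G.dist r u < G.dist r v →
      ∃ p : G.Walk r v, p.IsPath ∧ p.penultimate = u := by
    intro u hu hd
    obtain ⟨p, hp⟩ := hG.connected.exists_walk_length_eq_dist r u
    refine ⟨p.concat hu.symm, ?_, p.penultimate_concat _⟩
    apply SimpleGraph.Walk.isPath_of_length_eq_dist
    rw [SimpleGraph.Walk.length_concat, hp]
    rcases hG.dist_eq_dist_add_one_of_adj r hu with h | h <;> omega
  obtain ⟨p, hp, rfl⟩ := key u hu hd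
  obtain ⟨q, hq, rfl⟩ := key u' hu' hd'
  rw [(hG.existsUnique_path r v).unique hp hq]

variable {V : Type u} {G : SimpleGraph V}

/-- Parents are defined by distances in `spanningCoe`, where the vertices off the tree are isolated,
while the tree property concerns `coe`. The distances agree because a walk along edges of the
subgraph never leaves its vertex set. -/
theorem _root_.SimpleGraph.Subgraph.dist_spanningCoe (H : G.Subgraph) (hH : H.coe.Connected)
    (a b : H.verts) : H.spanningCoe.dist a b = H.coe.dist a b := by
  apply le_antisymm
  · obtain ⟨p, hp⟩ := hH.exists_walk_length_eq_dist a b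
    rw [← hp]
    have := SimpleGraph.dist_le (p.map H.coeEmbeddingSpanningCoe.toHom)
    rwa [SimpleGraph.Walk.length_map] at this
  · have hr : H.spanningCoe.Reachable a b := (hH a b).map H.coeEmbeddingSpanningCoe.toHom
    obtain ⟨p, hp⟩ := hr.exists_walk_length_eq_dist
    rw [← hp]
    have key : ∀ (x y : V) (q : H.spanningCoe.Walk x y) (hx : x ∈ H.verts) (hy : y ∈ H.verts),
        ∃ q' : H.coe.Walk ⟨x, hx⟩ ⟨y, hy⟩, q'.length = q.length := by
      intro x y q
      induction q with
      | nil => exact fun hx hy => ⟨.nil, rfl⟩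
      | @cons x z y hxz q ih =>
        intro hx hy
        obtain ⟨q', hq'⟩ := ih (H.edge_vert (SimpleGraph.Subgraph.Adj.symm hxz)) hy
        exact ⟨.cons (show H.coe.Adj ⟨x, hx⟩ ⟨z, _⟩ from hxz) q', by simp [hq']⟩
    obtain ⟨q', hq'⟩ := key _ _ p a.2 b.2
    rw [← hq']
    exact SimpleGraph.dist_le q'

end Parents

section Trees

variable {n κ : ℕ} {V : Type u} [Fintype V] {N : Network n κ V} (X : TreeFamily N) (i : Fin n)

variable {X i} in
theorem TreeFamily.isParent_iff {v u : V} : X.IsParent i v u ↔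
    ∃ (hv : v ∈ (X.tree i).verts) (hu : u ∈ (X.tree i).verts),
      (X.tree i).coe.Adj ⟨v, hv⟩ ⟨u, hu⟩ ∧
      (X.tree i).coe.dist ⟨_, X.root_mem i⟩ ⟨u, hu⟩ <
        (X.tree i).coe.dist ⟨_, X.root_mem i⟩ ⟨v, hv⟩ := by
  have hd := (X.tree i).dist_spanningCoe (X.isTree i).connected ⟨_, X.root_mem i⟩
  constructor
  · rintro ⟨h1, h2⟩
    have hv := (X.tree i).edge_vert h1
    have hu := h1.symm.fst_mem
    exact ⟨hv, hu, h1, by rw [← hd ⟨u, hu⟩, ← hd ⟨v, hv⟩]; exact h2⟩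
  · rintro ⟨hv, hu, h1, h2⟩
    rw [← hd ⟨u, hu⟩, ← hd ⟨v, hv⟩] at h2
    exact ⟨h1, h2⟩

variable {X i} in
theorem TreeFamily.IsParent.unique {v u u' : V} (h : X.IsParent i v u) (h' : X.IsParent i v u') :
    u = u' := by
  obtain ⟨hv, hu, h1, h2⟩ := TreeFamily.isParent_iff.1 h
  obtain ⟨_, hu', h1', h2'⟩ := TreeFamily.isParent_iff.1 h'
  exact congrArg Subtype.val ((X.isTree i).eq_of_adj_of_dist_lt h1 h1' h2 h2')

variable {X i} in
theorem TreeFamily.not_isParent_root {u : V} : ¬X.IsParent i (X.root i) u := fun h => by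
  have := h.2
  simp at this

variable {X i} in
theorem TreeFamily.exists_isParent {v : V} (hv : v ∈ (X.tree i).verts) (hr : v ≠ X.root i) :
    ∃ u, X.IsParent i v u := by
  have hc := (X.isTree i).connected
  have hd : (X.tree i).coe.dist ⟨v, hv⟩ ⟨_, X.root_mem i⟩ ≠ 0 := by
    rw [Ne, hc.dist_eq_zero_iff]
    exact fun h => hr (congrArg Subtype.val h)
  obtain ⟨p, hp⟩ := hc.exists_walk_length_eq_dist ⟨v, hv⟩ ⟨_, X.root_mem i⟩
  cases p with
  | nil => rw [← hp] at hd; exact absurd rfl hd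
  | @cons _ w _ h q =>
    refine ⟨w, TreeFamily.isParent_iff.2 ⟨hv, w.2, h, ?_⟩⟩
    rw [SimpleGraph.dist_comm, SimpleGraph.dist_comm (v := (⟨v, hv⟩ : (X.tree i).verts)), ← hp,
      SimpleGraph.Walk.length_cons]
    exact Nat.lt_succ_of_le (SimpleGraph.dist_le q)

open Classical in
/-- The `i`-th tree as a rooted tree. -/
noncomputable def TreeFamily.rooted : RootedTree V where
  verts := (X.tree i).verts
  root := X.root i
  par v := if h : ∃ u, X.IsParent i v u then h.choose else v
  dep v := (X.tree i).spanningCoe.dist (X.root i) v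
  root_mem := X.root_mem i
  par_root := dif_neg fun ⟨_, h⟩ => TreeFamily.not_isParent_root h
  dep_root := by simp
  par_mem v hv := by
    split_ifs with h
    · exact (TreeFamily.isParent_iff.1 h.choose_spec).2.1
    · exact hv
  dep_par v hv hr := by
    rw [dif_pos (TreeFamily.exists_isParent hv hr)]
    have h := (TreeFamily.exists_isParent hv hr).choose_spec
    have h2 := h.2
    obtain ⟨hv, hu, h1, h3⟩ := TreeFamily.isParent_iff.1 h
    have hd := (X.tree i).dist_spanningCoe (X.isTree i).connected ⟨_, X.root_mem i⟩
    have h4 := (X.isTree i).dist_eq_dist_add_one_of_adj ⟨_, X.root_mem i⟩ h1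
    rw [← hd, ← hd] at h4
    simp only at h4
    omega

variable {X i}

theorem TreeFamily.isChild_iff {c v : V} : (X.rooted i).IsChild c v ↔ X.IsParent i c v := by
  classical
  constructor
  · rintro ⟨h1, h2, rfl⟩
    have h := TreeFamily.exists_isParent h1 h2
    simp only [TreeFamily.rooted, h, ↓reduceDIte]
    exact h.choose_spec
  · intro h
    refine ⟨(TreeFamily.isParent_iff.1 h).1, ?_, ?_⟩
    · rintro rfl
      exact TreeFamily.not_isParent_root h
    · have hex : ∃ u, X.IsParent i c u := ⟨v, h⟩
      simp only [TreeFamily.rooted, hex, ↓reduceDIte]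
      exact hex.choose_spec.unique h

theorem TreeFamily.adj_iff {v u : V} : (X.tree i).Adj v u ↔
    (X.rooted i).IsChild v u ∨ (X.rooted i).IsChild u v := by
  rw [TreeFamily.isChild_iff, TreeFamily.isChild_iff]
  constructor
  · intro h
    have hv := (X.tree i).edge_vert h
    have hu := h.symm.fst_mem
    have h1 : (X.tree i).coe.Adj ⟨v, hv⟩ ⟨u, hu⟩ := h
    rcases (X.isTree i).dist_eq_dist_add_one_of_adj ⟨_, X.root_mem i⟩ h1 with h2 | h2
    · exact Or.inl (TreeFamily.isParent_iff.2 ⟨hv, hu, h1, by omega⟩)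
    · exact Or.inr (TreeFamily.isParent_iff.2 ⟨hu, hv, h1.symm, by omega⟩)
  · rintro (h | h)
    · exact h.1
    · exact h.1.symm

theorem RootedTree.IsChild.adj {c v : V} (h : (X.rooted i).IsChild c v) : N.graph.Adj c v :=
  (X.tree i).adj_sub (TreeFamily.adj_iff.2 (Or.inl h))

end Trees

/-! ### Up-then-down routes are shortest -/

section Routes

variable {n κ : ℕ} {V : Type u} [Fintype V] {N : Network n κ V} {X : TreeFamily N} {i : Fin n}

/-- Packets that move up until they reach an ancestor of the destination `y`, and then down towards
`y`, take shortest walks in the tree. -/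
theorem TreeFamily.exists_shortest_route {d : V → Option ℕ} {y : V}
    (hy : y ∈ (X.tree i).verts) (hself : d y = none)
    (hup : ∀ v ∈ (X.tree i).verts, ¬(X.rooted i).Anc v y →
      ∃ p : Fin (N.deg v), d v = some (p : ℕ) ∧ (N.port v p : V) = (X.rooted i).par v)
    (hdown : ∀ v c, (X.rooted i).IsChild c v → (X.rooted i).Anc c y →
      ∃ p : Fin (N.deg v), d v = some (p : ℕ) ∧ (N.port v p : V) = c)
    {x : V} (hx : x ∈ (X.tree i).verts) :
    ∃ p : N.graph.Walk x y, Routes N d p ∧ UsesOnly (X.tree i) p ∧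
      ∀ q : N.graph.Walk x y, UsesOnly (X.tree i) q → N.length p ≤ N.length q := by
  classical
  set T := X.rooted i with hT
  -- the weighted depth
  let wd : V → ℤ := T.fold fun v o => o.elim 0 fun a => a + N.weight s(v, T.par v)
  have hwd : ∀ c v, T.IsChild c v → wd c = wd v + N.weight s(c, v) := by
    rintro c v ⟨h1, h2, rfl⟩
    exact RootedTree.fold_of_ne _ h1 h2
  -- the lowest ancestor that is also an ancestor of `y`
  let A : V → V := T.fold fun v o => if T.Anc v y then v else o.getD v
  have hA1 : ∀ v ∈ T.verts, T.Anc v y → A v = v := by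
    intro v hv h
    by_cases hr : v = T.root
    · subst hr
      rw [show A T.root = _ from RootedTree.fold_root _, if_pos h]
    · rw [show A v = _ from RootedTree.fold_of_ne _ hv hr, if_pos h]
  have hA2 : ∀ c v, T.IsChild c v → ¬T.Anc c y → A c = A v := by
    rintro c v ⟨h1, h2, rfl⟩ h
    rw [show A c = _ from RootedTree.fold_of_ne _ h1 h2, if_neg h, Option.getD_some]
  -- the length of the route
  let W : V → ℤ := fun v => wd v + wd y - 2 * wd (A v)
  have hW1 : ∀ c v, T.IsChild c v → T.Anc c y → W v = N.weight s(c, v) + W c := by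
    intro c v hc h
    simp only [W, hA1 c hc.1 h, hA1 v hc.parent_mem (hc.anc.trans h), hwd c v hc]
    ring
  have hW2 : ∀ c v, T.IsChild c v → ¬T.Anc c y → W c = N.weight s(c, v) + W v := by
    intro c v hc h
    simp only [W, hA2 c v hc h, hwd c v hc]
    ring
  have hWy : W y = 0 := by
    simp only [W, hA1 y hy (RootedTree.Anc.refl y)]
    ring
  -- The function `W` is a potential: along an edge of the tree it changes by no more than the
  -- weight. As it vanishes at `y`, it bounds every walk in the tree to `y` from below.
  have hmin : ∀ (x z : V) (q : N.graph.Walk x z), UsesOnly (X.tree i) q →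
      W x ≤ N.length q + W z := by
    clear_value W
    intro x z q hq
    induction q with
    | nil => simp [Network.length]
    | @cons a b _ h q ih =>
      have h1 := ih fun e he => hq e (by simp [he])
      have h2 : (X.tree i).Adj a b := hq s(a, b) (by simp)
      have h3 : N.length (.cons h q) = N.weight s(a, b) + N.length q := by simp [Network.length]
      have h4 : W a ≤ N.weight s(a, b) + W b := by
        rcases TreeFamily.adj_iff.1 h2 with hc | hc
        · by_cases ha : T.Anc a y
          · have := hW1 a b hc ha
            omega
          · exact (hW2 a b hc ha).le
        · rw [Sym2.eq_swap]
          by_cases hb : T.Anc b y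
          · exact (hW1 b a hc hb).le
          · have := hW2 b a hc hb
            omega
      rw [h3]
      push_cast
      omega
  have hstep : ∀ (v : V) (p : Fin (N.deg v)), d v = some (p : ℕ) →
      (X.tree i).Adj v (N.port v p) → W v = N.weight s(v, (N.port v p : V)) + W (N.port v p) →
      (∃ q : N.graph.Walk (N.port v p : V) y, Routes N d q ∧ UsesOnly (X.tree i) q ∧
        (N.length q : ℤ) = W (N.port v p)) →
      ∃ q : N.graph.Walk v y, Routes N d q ∧ UsesOnly (X.tree i) q ∧ (N.length q : ℤ) = W v := by
    rintro v p hp ha hW ⟨q, h1, h2, h3⟩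
    refine ⟨.cons (N.adj_port v p) q, Routes.forward p hp q h1, ?_, ?_⟩
    · intro e he
      rw [SimpleGraph.Walk.edges_cons, List.mem_cons] at he
      rcases he with rfl | he
      · exact ha
      · exact h2 e he
    · rw [hW, ← h3]
      simp [Network.length]
  -- Each step of the route lowers `W` by exactly the weight of its edge. The descent from an
  -- ancestor of `y` comes before the ascent because the ascent ends in it.
  have hdesc : ∀ k v, v ∈ T.verts → T.Anc v y → k + T.dep v = T.dep y →
      ∃ q : N.graph.Walk v y, Routes N d q ∧ UsesOnly (X.tree i) q ∧ (N.length q : ℤ) = W v := by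
    intro k
    induction k with
    | zero =>
      intro v hv ha hk
      obtain rfl := ha.eq_of_dep hy (by omega)
      exact ⟨.nil, .arrived v hself, by simp [UsesOnly], by simp [Network.length, hWy]⟩
    | succ k ih =>
      intro v hv ha hk
      obtain ⟨c, hc, hcy⟩ := ha.exists_child (by rintro rfl; omega) hy
      obtain ⟨p, hp, rfl⟩ := hdown v c hc hcy
      refine hstep v p hp (TreeFamily.adj_iff.2 (Or.inr hc)) ?_
        (ih _ hc.1 hcy (by have := hc.dep; omega))
      rw [Sym2.eq_swap]
      exact hW1 _ _ hc hcy
  have hasc : ∀ k v, v ∈ T.verts → T.dep v ≤ k →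
      ∃ q : N.graph.Walk v y, Routes N d q ∧ UsesOnly (X.tree i) q ∧ (N.length q : ℤ) = W v := by
    intro k
    induction k with
    | zero =>
      intro v hv hk
      rw [RootedTree.eq_root_of_dep hv (by omega)]
      exact hdesc _ _ T.root_mem (RootedTree.anc_root hy) (by rw [T.dep_root, Nat.add_zero])
    | succ k ih =>
      intro v hv hk
      by_cases ha : T.Anc v y
      · exact hdesc _ v hv ha (Nat.sub_add_cancel (ha.dep_le hy))
      · obtain ⟨p, hp, hpar⟩ := hup v hv ha
        have hc : T.IsChild v (N.port v p) :=
          ⟨hv, fun h => ha (h ▸ RootedTree.anc_root hy), hpar.symm⟩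
        exact hstep v p hp (TreeFamily.adj_iff.2 (Or.inl hc)) (hW2 _ _ hc ha)
          (ih _ hc.parent_mem (by have := hc.dep; omega))
  obtain ⟨p, h1, h2, h3⟩ := hasc _ x hx le_rfl
  refine ⟨p, h1, h2, fun q hq => ?_⟩
  have := hmin x y q hq
  omega

end Routes

/-! ### Reading the tree structure off the local inputs -/

section LocalView

variable {n κ : ℕ} {V : Type u} [Fintype V] {N : Network n κ V} {X : TreeFamily N} {i : Fin n}

open Classical in
/-- The port that leads to the parent in the tree with name `a`. -/
noncomputable def LocalInput.parentPort (I : LocalInput) (a : ℕ) : Option (Fin I.deg) :=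
  if h : (I.parent a).Nonempty then some h.choose else none

theorem TreeFamily.name_mem_trees {v : V} :
    X.name i ∈ (X.localInput v).trees ↔ v ∈ (X.tree i).verts := by
  constructor
  · rintro ⟨j, hj, hv⟩
    rwa [← X.name_injective hj]
  · exact fun h => ⟨i, rfl, h⟩

theorem TreeFamily.mem_parent {v : V} {p : Fin (N.deg v)} :
    p ∈ (X.localInput v).parent (X.name i) ↔ (X.rooted i).IsChild v (N.port v p) := by
  rw [TreeFamily.isChild_iff]
  constructor
  · rintro ⟨j, hj, hv⟩
    rwa [← X.name_injective hj]
  · exact fun h => ⟨i, rfl, h⟩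

theorem TreeFamily.mem_children {v : V} {p : Fin (N.deg v)} :
    p ∈ (X.localInput v).children (X.name i) ↔ (X.rooted i).IsChild (N.port v p) v := by
  rw [TreeFamily.isChild_iff]
  constructor
  · rintro ⟨j, hj, hv⟩
    rwa [← X.name_injective hj]
  · exact fun h => ⟨i, rfl, h⟩

theorem TreeFamily.parentPort_root :
    (X.localInput (X.root i)).parentPort (X.name i) = none := by
  rw [LocalInput.parentPort, dif_neg]
  rintro ⟨p, hp⟩
  exact (TreeFamily.mem_parent.1 hp).2.1 rfl

theorem TreeFamily.exists_parentPort {c v : V} (h : (X.rooted i).IsChild c v) :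
    ∃ p : Fin (N.deg c), (X.localInput c).parentPort (X.name i) = some p ∧
      (N.port c p : V) = v := by
  obtain ⟨p, hp⟩ := N.exists_port h.adj
  have hne : ((X.localInput c).parent (X.name i)).Nonempty :=
    ⟨p, TreeFamily.mem_parent.2 (hp ▸ h)⟩
  refine ⟨hne.choose, by rw [LocalInput.parentPort, dif_pos hne]; rfl, ?_⟩
  rw [← (TreeFamily.mem_parent.1 hne.choose_spec).2.2, h.2.2]

open Classical in
-- A vertex can only sum over its ports; this turns such sums into sums over the children in the
-- tree.
theorem TreeFamily.sum_children {M : Type*} [AddCommMonoid M] (v : V)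
    (f : Fin (X.localInput v).deg → M) (g : V → M)
    (hfg : ∀ p : Fin (N.deg v), (X.rooted i).IsChild (N.port v p) v → f p = g (N.port v p)) :
    ∑ p : Fin (X.localInput v).deg with p ∈ (X.localInput v).children (X.name i), f p =
      ∑ c ∈ (X.rooted i).children v, g c := by
  refine Finset.sum_bij (fun p _ => (N.port v p : V)) ?_ ?_ ?_ ?_
  · exact fun p hp => RootedTree.mem_children.2
      (TreeFamily.mem_children.1 (Finset.mem_filter.1 hp).2)
  · exact fun p _ q _ h => (N.port v).injective (Subtype.ext h)
  · intro c hc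
    have hc' := RootedTree.mem_children.1 hc
    obtain ⟨p, rfl⟩ := N.exists_port hc'.adj.symm
    exact ⟨p, Finset.mem_filter.2 ⟨Finset.mem_univ _, TreeFamily.mem_children.2 hc'⟩, rfl⟩
  · exact fun p hp => hfg p (TreeFamily.mem_children.1 (Finset.mem_filter.1 hp).2)

/-- A message that consists of one item for each tree that satisfies `Q` is sparse if few trees
satisfy `Q`. -/
theorem TreeFamily.mem_sparseMaps {β : Type} {U : Set (ℕ × β)} {B : ℕ} {v : V} (Q : Fin n → Prop)
    {m : ℕ → Option β} (h0 : ∀ a ∉ (X.localInput v).trees, m a = none)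
    (hQ : ∀ i, v ∈ (X.tree i).verts → m (X.name i) ≠ none → Q i)
    (hB : {i | v ∈ (X.tree i).verts ∧ Q i}.ncard ≤ B)
    (hU : ∀ i, v ∈ (X.tree i).verts → ∀ x, m (X.name i) = some x → (X.name i, x) ∈ U) :
    m ∈ SparseMaps U B := by
  have hsub : {a | m a ≠ none} ⊆ X.name '' {i | v ∈ (X.tree i).verts ∧ Q i} := by
    intro a ha
    by_cases h : a ∈ (X.localInput v).trees
    · obtain ⟨i, rfl, hv⟩ := h
      exact ⟨i, ⟨hv, hQ i hv ha⟩, rfl⟩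
    · exact absurd (h0 a h) ha
  have hfin := (Set.toFinite {i | v ∈ (X.tree i).verts ∧ Q i}).image X.name
  refine ⟨hfin.subset hsub, ?_, ?_⟩
  · exact (Set.ncard_le_ncard hsub hfin).trans ((Set.ncard_image_le (Set.toFinite _)).trans hB)
  · intro a x hax
    obtain ⟨i, ⟨hv, -⟩, rfl⟩ := hsub (show m a ≠ none by simp [hax])
    exact hU i hv x hax

end LocalView

/-! ### Downward waves -/

section Down

variable {β : Type}

open Classical in
/-- The time at which a vertex sends its item for the tree `a` to its children: this is `st a` if the
vertex is the root of a fragment, and otherwise it sends just after it has heard from its parent. -/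
noncomputable def downSlot (top : ℕ → Prop) (st : ℕ → ℕ) (s : ℕ → Option (ℕ × β)) (a : ℕ) :
    Option ℕ :=
  if top a then some (st a) else (s a).map (·.1 + 1)

open Classical in
/-- The items that a vertex sends at time `t` in a downward wave. -/
noncomputable def downMsg (I : LocalInput) (top : ℕ → Prop) (st : ℕ → ℕ) (out : ℕ → Option β → β)
    (t : ℕ) (s : ℕ → Option (ℕ × β)) (a : ℕ) : Option β :=
  if a ∈ I.trees ∧ downSlot top st s a = some t then
    some (out a (if top a then none else (s a).map Prod.snd))
  else none

/-- Record the time and the item that arrives from the parent. -/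
noncomputable def downUpd (I : LocalInput) (t : ℕ) (s : ℕ → Option (ℕ × β))
    (x : Fin I.deg → ℕ → Option β) (a : ℕ) : Option (ℕ × β) :=
  (s a).or ((I.parentPort a).bind fun p => (x p a).map fun y => (t, y))

open Classical in
/-- Downward waves in all fragments of all trees. The flag is raised if messages are too large, or if
a wave takes too long. -/
noncomputable def Prog.down {C n : ℕ} (P : ℕ) (U : Set (ℕ × β)) (B T : ℕ) (I : LocalInput)
    (top : ℕ → Prop) (st : ℕ → ℕ) (out : ℕ → Option β → β) :
    Prog C n ((ℕ → Option (ℕ × β)) × Bool) :=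
  (Prog.phase P (SparseMaps U B) I.deg (downMsg I top st out) (downUpd I) T 0 (fun _ => none)
    false).bind fun r =>
      .ret (r.1, r.2 || decide (∃ a ∈ I.trees, ∀ t < T, downSlot top st r.1 a ≠ some t))

variable {C n κ : ℕ} {V : Type u} [Fintype V] {N : Network n κ V} {X : TreeFamily N}

open Classical in
variable (X) in
/-- The times at which the vertices of the `i`-th tree send in a downward wave. -/
noncomputable def TreeFamily.slot (top : V → ℕ → Prop) (st : V → ℕ → ℕ) (i : Fin n) : V → ℕ :=
  (X.rooted i).fold fun v o =>
    if top v (X.name i) then st v (X.name i) else o.elim 0 (· + 1)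

open Classical in
variable (X) in
/-- The items that the vertices of the `i`-th tree send in a downward wave. -/
noncomputable def TreeFamily.item (top : V → ℕ → Prop) (out : V → ℕ → Option β → β) (i : Fin n) :
    V → β :=
  (X.rooted i).fold fun v o => out v (X.name i) (if top v (X.name i) then none else o)

variable {top : V → ℕ → Prop} {st : V → ℕ → ℕ} {out : V → ℕ → Option β → β} {i : Fin n}

theorem TreeFamily.slot_top {v : V} (hv : v ∈ (X.tree i).verts) (h : top v (X.name i)) :
    X.slot top st i v = st v (X.name i) := by
  by_cases hr : v = (X.rooted i).root
  · subst hr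
    rw [TreeFamily.slot, RootedTree.fold_root, if_pos h]
  · rw [TreeFamily.slot, RootedTree.fold_of_ne _ hv hr, if_pos h]

theorem TreeFamily.slot_child {c v : V} (hc : (X.rooted i).IsChild c v) (h : ¬top c (X.name i)) :
    X.slot top st i c = X.slot top st i v + 1 := by
  rw [TreeFamily.slot, RootedTree.fold_of_ne _ hc.1 hc.2.1, if_neg h, hc.2.2, Option.elim_some]

theorem TreeFamily.item_top {v : V} (hv : v ∈ (X.tree i).verts) (h : top v (X.name i)) :
    X.item top out i v = out v (X.name i) none := by
  by_cases hr : v = (X.rooted i).root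
  · subst hr
    rw [TreeFamily.item, RootedTree.fold_root, if_pos h]
  · rw [TreeFamily.item, RootedTree.fold_of_ne _ hv hr, if_pos h]

theorem TreeFamily.item_child {c v : V} (hc : (X.rooted i).IsChild c v) (h : ¬top c (X.name i)) :
    X.item top out i c = out c (X.name i) (some (X.item top out i v)) := by
  rw [TreeFamily.item, RootedTree.fold_of_ne _ hc.1 hc.2.1, if_neg h, hc.2.2]

variable (X) in
/-- In no tree a wave takes `T` rounds. -/
def TreeFamily.SlotsLt (sl : Fin n → V → ℕ) (T : ℕ) : Prop :=
  ∀ i, ∀ v ∈ (X.tree i).verts, sl i v < T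

variable (X) in
/-- A vertex never sends more than `B` items at the same time. -/
def TreeFamily.LoadLe (sl : Fin n → V → ℕ) (B : ℕ) : Prop :=
  ∀ v t, {i | v ∈ (X.tree i).verts ∧ sl i v = t}.ncard ≤ B

/-- At each time the claim about messages follows from the claim about states, and the latter
advances by one round using the former. Roots are tops, so a vertex that is not a top always has a
parent to wait for. -/
theorem down_cfg (hroot : ∀ i, top (X.root i) (X.name i)) {cfg : ℕ → V → ℕ → Option (ℕ × β)}
    (h0 : cfg 0 = fun _ _ => none)
    (hcfg : Evolves N (fun v => downMsg (X.localInput v) (top v) (st v) (out v))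
      (fun v => downUpd (X.localInput v)) cfg) (t : ℕ) :
    (∀ i, cfg t (X.root i) (X.name i) = none) ∧ (∀ i c v, (X.rooted i).IsChild c v →
      cfg t c (X.name i) = if X.slot top st i v < t then
        some (X.slot top st i v, X.item top out i v) else none) ∧
    (∀ i, ∀ v ∈ (X.tree i).verts,
      downMsg (X.localInput v) (top v) (st v) (out v) t (cfg t v) (X.name i) =
      if X.slot top st i v = t then some (X.item top out i v) else none) := by
  have hmsg : ∀ t, (∀ i c v, (X.rooted i).IsChild c v →
      cfg t c (X.name i) = if X.slot top st i v < t then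
        some (X.slot top st i v, X.item top out i v) else none) →
    (∀ i, ∀ v ∈ (X.tree i).verts,
      downMsg (X.localInput v) (top v) (st v) (out v) t (cfg t v) (X.name i) =
      if X.slot top st i v = t then some (X.item top out i v) else none) := by
    intro t h i v hv
    rw [downMsg, downSlot]
    simp only [TreeFamily.name_mem_trees.2 hv, true_and]
    by_cases htop : top v (X.name i)
    · rw [if_pos htop, if_pos htop, TreeFamily.slot_top hv htop, TreeFamily.item_top hv htop]
      simp
    · have hr : v ≠ (X.rooted i).root := by
        rintro rfl
        exact htop (hroot i)
      have hc : (X.rooted i).IsChild v ((X.rooted i).par v) := ⟨hv, hr, rfl⟩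
      rw [if_neg htop, if_neg htop, TreeFamily.slot_child hc htop, TreeFamily.item_child hc htop,
        h i v _ hc]
      by_cases hs : X.slot top st i ((X.rooted i).par v) < t
      · simp [hs]
      · rw [if_neg hs]
        simp only [Option.map_none, reduceCtorEq, ↓reduceIte]
        rw [if_neg (by omega)]
  induction t with
  | zero =>
    refine ⟨fun i => by rw [h0], ?_, ?_⟩
    · intro i c v _
      rw [h0]
      simp
    · refine hmsg 0 ?_
      intro i c v _
      rw [h0]
      simp
  | succ t ih =>
    obtain ⟨ih1, ih2, ih3⟩ := ih
    have h2 : ∀ i c v, (X.rooted i).IsChild c v →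
      cfg (t + 1) c (X.name i) = if X.slot top st i v < t + 1 then
        some (X.slot top st i v, X.item top out i v) else none := by
      intro i c v hc
      obtain ⟨p, hp, rfl⟩ := TreeFamily.exists_parentPort hc
      have hstep : cfg (t + 1) c (X.name i) = (cfg t c (X.name i)).or
          ((downMsg (X.localInput (N.port c p)) (top (N.port c p)) (st (N.port c p))
            (out (N.port c p)) t (cfg t (N.port c p)) (X.name i)).map fun y => (t, y)) := by
        rw [hcfg t c]
        simp only [downUpd, hp]
        rfl
      rw [hstep, ih2 i c _ hc, ih3 i _ hc.parent_mem]
      rcases lt_trichotomy (X.slot top st i (N.port c p)) t with h | h | h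
      · simp [h, h.trans (Nat.lt_succ_self t)]
      · simp [h]
      · rw [if_neg (by omega), if_neg (by omega), if_neg (by omega)]
        simp
    refine ⟨?_, h2, hmsg _ h2⟩
    intro i
    rw [hcfg t]
    simp only [downUpd, TreeFamily.parentPort_root, ih1 i]
    simp

/-- The final flag test asks whether every vertex knows its sending time for each of its trees and
finds it below `T`, which is what it takes for all waves to have finished. -/
theorem Runs.down (hC : 1 ≤ C) (hroot : ∀ i, top (X.root i) (X.name i)) {P B : ℕ}
    {U : Set (ℕ × β)} (hU : Transmissible C n P (SparseMaps U B)) (T : ℕ) :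
    ∃ r : V → (ℕ → Option (ℕ × β)) × Bool,
      Runs (C := C) N (T * P)
        (fun v => Prog.down P U B T (X.localInput v) (top v) (st v) (out v)) r ∧
      ((∀ v, (r v).2 = false) → X.SlotsLt (X.slot top st) T ∧
        (∀ i, (r (X.root i)).1 (X.name i) = none) ∧
        (∀ i c v, (X.rooted i).IsChild c v →
          (r c).1 (X.name i) = some (X.slot top st i v, X.item top out i v))) ∧
      (X.SlotsLt (X.slot top st) T → X.LoadLe (X.slot top st) B →
        (∀ i, ∀ v ∈ (X.tree i).verts, (X.name i, X.item top out i v) ∈ U) →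
        ∀ v, (r v).2 = false) := by
  classical
  obtain ⟨cfg, h0, hcfg⟩ := exists_evolves N
    (fun v => downMsg (X.localInput v) (top v) (st v) (out v))
    (fun v => downUpd (X.localInput v)) fun _ _ => none
  obtain ⟨r, hr, -, hr1, hr2⟩ := Runs.phase hC N hU hcfg T 0 (fun _ _ => none) fun _ => false
  have hk := down_cfg hroot h0 hcfg
  -- the time at which a vertex sends, as far as it is known at time `T`
  have hslot : ∀ i, ∀ v ∈ (X.tree i).verts, ∀ t < T,
      downSlot (top v) (st v) (cfg T v) (X.name i) = some t ↔ X.slot top st i v = t := by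
    intro i v hv t ht
    rw [downSlot]
    by_cases htop : top v (X.name i)
    · rw [if_pos htop, TreeFamily.slot_top hv htop, Option.some_inj]
    · have hr : v ≠ (X.rooted i).root := by
        rintro rfl
        exact htop (hroot i)
      have hc : (X.rooted i).IsChild v ((X.rooted i).par v) := ⟨hv, hr, rfl⟩
      rw [if_neg htop, TreeFamily.slot_child hc htop, (hk T).2.1 i v _ hc]
      by_cases hs : X.slot top st i ((X.rooted i).par v) < T
      · simp [hs]
      · rw [if_neg hs, Option.map_none]
        simp only [reduceCtorEq, false_iff]
        omega
  refine ⟨_, Runs.bind (T' := 0) hr (Runs.ret N _), ?_, ?_⟩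
  · intro hf
    simp only [Bool.or_eq_false_iff, decide_eq_false_iff_not, not_exists, not_and, not_forall,
      not_not] at hf
    have h1 := hr1 h0.symm fun v => (hf v).1
    simp only [Nat.zero_add] at h1
    have hlt : X.SlotsLt (X.slot top st) T := by
      intro i v hv
      obtain ⟨t, ht, hts⟩ := (hf v).2 _ (TreeFamily.name_mem_trees.2 hv)
      rw [(h1 v).1, hslot i v hv t ht] at hts
      omega
    refine ⟨hlt, fun i => ?_, fun i c v hc => ?_⟩
    · simp only [(h1 _).1, (hk T).1 i]
    · simp only [(h1 _).1, (hk T).2.1 i c v hc, hlt i v hc.parent_mem, if_true]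
  · intro hlt hload hitem v
    have h1 := hr2 h0.symm (by
      intro v t _ _
      refine TreeFamily.mem_sparseMaps (X := X) (v := v) (fun i => X.slot top st i v = t) ?_ ?_
        (hload v t) ?_
      · intro a ha
        rw [downMsg, if_neg fun h => ha h.1]
      · intro i hv hne
        rw [(hk t).2.2 i v hv] at hne
        by_contra h
        exact hne (if_neg h)
      · intro i hv x hx
        rw [(hk t).2.2 i v hv] at hx
        split_ifs at hx with h
        cases hx
        exact hitem i v hv)
    simp only [h1 v, Nat.zero_add, Bool.false_or, decide_eq_false_iff_not, not_exists, not_and,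
      not_forall, not_not]
    rintro a ⟨i, rfl, hv⟩
    exact ⟨_, hlt i v hv, (hslot i v hv _ (hlt i v hv)).2 rfl⟩

end Down

/-! ### Upward waves -/

section Up

open Classical in
/-- The sum of the weight of a vertex and of the values received from its children. -/
noncomputable def upVal (I : LocalInput) (w : ℕ → ℕ) (s : ℕ → ℕ → Option ℕ) (a : ℕ) : ℕ :=
  w a + ∑ p : Fin I.deg with p ∈ I.children a, (s a p).getD 0

open Classical in
/-- The items that a vertex sends at time `t` in an upward wave. -/
noncomputable def upMsg (I : LocalInput) (top : ℕ → Prop) (sl w : ℕ → ℕ) (T t : ℕ)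
    (s : ℕ → ℕ → Option ℕ) (a : ℕ) : Option ℕ :=
  if a ∈ I.trees ∧ ¬top a ∧ sl a + t + 1 = T then some (upVal I w s a) else none

/-- Record the items that arrive. -/
def upUpd (d : ℕ) (_ : ℕ) (s : ℕ → ℕ → Option ℕ) (x : Fin d → ℕ → Option ℕ) (a p : ℕ) :
    Option ℕ :=
  (s a p).or (if h : p < d then x ⟨p, h⟩ a else none)

/-- Upward waves in all fragments of all trees, which run the downward waves backwards. -/
noncomputable def Prog.up {C n : ℕ} (P : ℕ) (U : Set (ℕ × ℕ)) (B T : ℕ) (I : LocalInput)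
    (top : ℕ → Prop) (sl w : ℕ → ℕ) : Prog C n ((ℕ → ℕ → Option ℕ) × Bool) :=
  Prog.phase P (SparseMaps U B) I.deg (upMsg I top sl w T) (upUpd I.deg) T 0 (fun _ _ => none)
    false

variable {C n κ : ℕ} {V : Type u} [Fintype V] {N : Network n κ V} {X : TreeFamily N}
  {top : V → ℕ → Prop} {sl : V → ℕ → ℕ} {w : V → ℕ → ℕ} {σ val : Fin n → V → ℕ} {T : ℕ}

open Classical in
-- Time is reversed: a vertex with slot `σ` sends at time `T - 1 - σ`. Its children in the same
-- fragment have slot `σ + 1`, so they have sent exactly one round earlier and the sum is complete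
-- when it is needed.
theorem up_cfg (hsl : ∀ i, ∀ v ∈ (X.tree i).verts, sl v (X.name i) = σ i v)
    (hσ : X.SlotsLt σ T)
    (hσc : ∀ i c v, (X.rooted i).IsChild c v → ¬top c (X.name i) → σ i c = σ i v + 1)
    (hval : ∀ i, ∀ v ∈ (X.tree i).verts, val i v = w v (X.name i) +
      ∑ c ∈ (X.rooted i).children v, if top c (X.name i) then 0 else val i c)
    {cfg : ℕ → V → ℕ → ℕ → Option ℕ} (h0 : cfg 0 = fun _ _ _ => none)
    (hcfg : Evolves N (fun v => upMsg (X.localInput v) (top v) (sl v) (w v) T)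
      (fun v => upUpd (N.deg v)) cfg) (t : ℕ) :
    (∀ i v (p : Fin (N.deg v)), (X.rooted i).IsChild (N.port v p) v →
      cfg t v (X.name i) p = if ¬top (N.port v p) (X.name i) ∧ T ≤ σ i (N.port v p) + t then
        some (val i (N.port v p)) else none) ∧
    (∀ i, ∀ v ∈ (X.tree i).verts,
      upMsg (X.localInput v) (top v) (sl v) (w v) T t (cfg t v) (X.name i) =
        if ¬top v (X.name i) ∧ σ i v + t + 1 = T then some (val i v) else none) := by
  have hmsg : ∀ t, (∀ i v (p : Fin (N.deg v)), (X.rooted i).IsChild (N.port v p) v →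
      cfg t v (X.name i) p = if ¬top (N.port v p) (X.name i) ∧ T ≤ σ i (N.port v p) + t then
        some (val i (N.port v p)) else none) →
    (∀ i, ∀ v ∈ (X.tree i).verts,
      upMsg (X.localInput v) (top v) (sl v) (w v) T t (cfg t v) (X.name i) =
        if ¬top v (X.name i) ∧ σ i v + t + 1 = T then some (val i v) else none) := by
    intro t h i v hv
    rw [upMsg]
    simp only [TreeFamily.name_mem_trees.2 hv, true_and, hsl i v hv]
    refine ite_congr rfl (fun ht => ?_) fun _ => rfl
    rw [upVal, hval i v hv]
    refine congrArg (fun z => some (w v (X.name i) + z)) ?_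
    refine TreeFamily.sum_children v _ _ fun p hp => ?_
    rw [h i v p hp]
    by_cases htop : top (N.port v p) (X.name i)
    · simp [htop]
    · have := hσc i _ v hp htop
      rw [if_pos ⟨htop, by omega⟩, if_neg htop, Option.getD_some]
  induction t with
  | zero =>
    have hz : ∀ i v (p : Fin (N.deg v)), (X.rooted i).IsChild (N.port v p) v →
      cfg 0 v (X.name i) p = if ¬top (N.port v p) (X.name i) ∧ T ≤ σ i (N.port v p) + 0 then
        some (val i (N.port v p)) else none := by
      intro i v p hp
      have := hσ i _ hp.1
      rw [h0, if_neg (by omega)]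
    exact ⟨hz, hmsg 0 hz⟩
  | succ t ih =>
    obtain ⟨ih1, ih2⟩ := ih
    have hs : ∀ i v (p : Fin (N.deg v)), (X.rooted i).IsChild (N.port v p) v →
      cfg (t + 1) v (X.name i) p =
        if ¬top (N.port v p) (X.name i) ∧ T ≤ σ i (N.port v p) + (t + 1) then
        some (val i (N.port v p)) else none := by
      intro i v p hp
      rw [hcfg t v]
      simp only [upUpd, Fin.is_lt, ↓reduceDIte, Fin.eta]
      rw [ih1 i v p hp, ih2 i _ hp.1]
      by_cases htop : top (N.port v p) (X.name i)
      · simp [htop]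
      · simp only [htop, not_false_eq_true, true_and]
        rcases lt_trichotomy T (σ i (N.port v p) + t + 1) with h | h | h
        · rw [if_pos (by omega), if_neg (by omega), if_pos (by omega)]
          rfl
        · rw [if_neg (by omega), if_pos h.symm, if_pos (by omega)]
          rfl
        · rw [if_neg (by omega), if_neg (by omega), if_neg (by omega)]
          rfl
    exact ⟨hs, hmsg _ hs⟩

open Classical in
-- The times `sl` and weights `w` are results of earlier stages and may be meaningless if those
-- failed. So the run exists unconditionally, and the intended schedule and values are supplied
-- afterwards. The load is that of the downward schedule, since a round here corresponds to a single
-- slot.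
theorem Runs.up (hC : 1 ≤ C) {P B : ℕ} {U : Set (ℕ × ℕ)}
    (hU : Transmissible C n P (SparseMaps U B)) (T : ℕ) :
    ∃ r : V → (ℕ → ℕ → Option ℕ) × Bool,
      Runs (C := C) N (T * P)
        (fun v => Prog.up P U B T (X.localInput v) (top v) (sl v) (w v)) r ∧
      ∀ σ val : Fin n → V → ℕ, (∀ i, ∀ v ∈ (X.tree i).verts, sl v (X.name i) = σ i v) →
        X.SlotsLt σ T →
        (∀ i c v, (X.rooted i).IsChild c v → ¬top c (X.name i) → σ i c = σ i v + 1) →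
        (∀ i, ∀ v ∈ (X.tree i).verts, val i v = w v (X.name i) +
          ∑ c ∈ (X.rooted i).children v, if top c (X.name i) then 0 else val i c) →
        ((∀ v, (r v).2 = false) → ∀ i v (p : Fin (N.deg v)),
          (X.rooted i).IsChild (N.port v p) v →
          (r v).1 (X.name i) p = if top (N.port v p) (X.name i) then none
            else some (val i (N.port v p))) ∧
        (X.LoadLe σ B → (∀ i, ∀ v ∈ (X.tree i).verts, (X.name i, val i v) ∈ U) →
          ∀ v, (r v).2 = false) := by
  obtain ⟨cfg, h0, hcfg⟩ := exists_evolves N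
    (fun v => upMsg (X.localInput v) (top v) (sl v) (w v) T) (fun v => upUpd (N.deg v))
    fun _ _ _ => none
  obtain ⟨r, hr, -, hr1, hr2⟩ := Runs.phase hC N hU hcfg T 0 (fun _ _ _ => none) fun _ => false
  refine ⟨r, hr, fun σ val hsl hσ hσc hval => ?_⟩
  have hk := up_cfg hsl hσ hσc hval h0 hcfg
  constructor
  · intro hf i v p hp
    rw [(hr1 h0.symm hf v).1, Nat.zero_add, (hk T).1 i v p hp]
    by_cases htop : top (N.port v p) (X.name i) <;> simp [htop]
  · intro hload hitem v
    rw [hr2 h0.symm ?_ v]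
    intro v t _ ht
    refine TreeFamily.mem_sparseMaps (X := X) (v := v) (fun i => σ i v = T - (t + 1)) ?_ ?_
      (hload v _) ?_
    · intro a ha
      rw [upMsg, if_neg fun h => ha h.1]
    · intro i hv hne
      rw [(hk t).2 i v hv] at hne
      by_contra h
      refine hne (if_neg fun h' => h ?_)
      omega
    · intro i hv x hx
      rw [(hk t).2 i v hv] at hx
      split_ifs at hx with h
      cases hx
      exact hitem i v hv

end Up

/-! ### Local evaluation of the broadcast tokens -/

section Tokens

open Classical in
/-- The sum of the values of all tokens `(a, y, _, m)` such that `x` can be reached from `y` through the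
links `z ↦ z'` that are given by the tokens `(a, z, z', _)`. -/
noncomputable def tokenSum (K : Finset (ℕ × ℕ × ℕ × ℕ)) (a x : ℕ) : ℕ :=
  ∑ q ∈ K with q.1 = a ∧ Relation.ReflTransGen (fun z z' => ∃ m, (a, z, z', m) ∈ K) q.2.1 x, q.2.2.2

open Classical in
/-- Follow at most `m` links `z ↦ z'` that are given by tokens `(a, z, z', l)`, starting at `x`, and
concatenate the lists `l`, the last one first. -/
noncomputable def tokenPath {γ : Type} (K : Finset (ℕ × ℕ × ℕ × List γ)) (a : ℕ) : ℕ → ℕ → List γ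
  | 0, _ => []
  | m + 1, x =>
    if h : ∃ q : ℕ × List γ, (a, x, q.1, q.2) ∈ K then
      tokenPath K a m h.choose.1 ++ h.choose.2
    else []

end Tokens

/-! ### Cutting a tree into fragments -/

namespace RootedTree

variable {V : Type u} {T : RootedTree V}

section Fragments

open Classical in
variable (T) in
/-- The root of the fragment of `v`, which is the lowest ancestor that satisfies `top`. -/
noncomputable def frag (top : V → Prop) : V → V :=
  T.fold fun v o => if top v then v else o.getD v

variable {top : V → Prop} {v w x c : V}

theorem frag_top (hv : v ∈ T.verts) (h : top v) : T.frag top v = v := by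
  by_cases hr : v = T.root
  · subst hr
    rw [frag, fold_root, if_pos h]
  · rw [frag, fold_of_ne _ hv hr, if_pos h]

theorem IsChild.frag (hc : T.IsChild c v) (h : ¬top c) : T.frag top c = T.frag top v := by
  rw [RootedTree.frag, fold_of_ne _ hc.1 hc.2.1, if_neg h, hc.2.2, Option.getD_some]

/-- Induction from the root to the leaves. -/
theorem induction_down {Q : V → Prop} (hroot : Q T.root)
    (hchild : ∀ c v, T.IsChild c v → Q v → Q c) (v : V) (hv : v ∈ T.verts) : Q v := by
  obtain ⟨d, hd⟩ : ∃ d, d = T.dep v := ⟨_, rfl⟩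
  induction d generalizing v with
  | zero => rwa [eq_root_of_dep hv hd.symm]
  | succ d ih =>
    have hr : v ≠ T.root := by rintro rfl; rw [T.dep_root] at hd; omega
    have hc : T.IsChild v (T.par v) := ⟨hv, hr, rfl⟩
    exact hchild _ _ hc (ih _ hc.parent_mem (by have := hc.dep; omega))

theorem frag_spec (htop : top T.root) (v : V) (hv : v ∈ T.verts) :
    top (T.frag top v) ∧ T.Anc (T.frag top v) v := by
  refine induction_down (Q := fun v => top (T.frag top v) ∧ T.Anc (T.frag top v) v) ?_ ?_ v hv
  · rw [frag_top T.root_mem htop]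
    exact ⟨htop, Anc.refl _⟩
  · intro c v hc ih
    by_cases h : top c
    · rw [frag_top hc.1 h]
      exact ⟨h, Anc.refl _⟩
    · rw [hc.frag h]
      exact ⟨ih.1, ih.2.trans hc.anc⟩

/-- The fragment root of `x` is the lowest top ancestor of `x`, so every other top ancestor lies
above it. -/
theorem Anc.frag (hw : T.Anc w x) (hx : x ∈ T.verts) (h : top w) : T.Anc w (T.frag top x) := by
  revert hw
  refine induction_down (Q := fun x => T.Anc w x → T.Anc w (T.frag top x)) ?_ ?_ x hx
  · intro hw
    obtain rfl := hw.eq_of_dep T.root_mem (by rw [T.dep_root]; exact Nat.zero_le _)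
    rw [frag_top T.root_mem h]
    exact hw
  · intro c v hc ih hw
    by_cases h' : top c
    · rwa [frag_top hc.1 h']
    · rw [hc.frag h']
      rcases hw.eq_or with rfl | hw
      · exact absurd h h'
      · exact ih (hc.2.2 ▸ hw)

variable {ident : V → ℕ} {a : ℕ}

/-- The tokens of the tree with name `a`, for the roots of the fragments other than the root of the
tree. -/
def TokensOf {γ : Type} (T : RootedTree V) (top : V → Prop) (ident : V → ℕ) (a : ℕ) (val : V → γ)
    (K : Finset (ℕ × ℕ × ℕ × γ)) : Prop :=
  ∀ x y g, (a, x, y, g) ∈ K ↔ ∃ w ∈ T.verts, top w ∧ w ≠ T.root ∧ ident w = x ∧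
    ident (T.frag top (T.par w)) = y ∧ val w = g

/-- Each link leads from a fragment root to the root of the fragment above, which is strictly less
deep, so as many steps as the depth suffice. The search stops at the root of the tree, which has no
token. -/
theorem tokenPath_eq {γ : Type} (htop : top T.root) (hid : Function.Injective ident)
    {K : Finset (ℕ × ℕ × ℕ × List γ)} {val path : V → List γ}
    (hK : TokensOf T top ident a val K) (hroot : path T.root = [])
    (hpath : ∀ w ∈ T.verts, top w → w ≠ T.root →
      path w = path (T.frag top (T.par w)) ++ val w)
    (m : ℕ) (hw : w ∈ T.verts) (hwt : top w) (hm : T.dep w ≤ m) :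
    tokenPath K a m (ident w) = path w := by
  induction m generalizing w with
  | zero =>
    rw [eq_root_of_dep hw (by omega), hroot, tokenPath]
  | succ m ih =>
    rw [tokenPath]
    by_cases hr : w = T.root
    · rw [dif_neg, hr, hroot]
      rintro ⟨q, hq⟩
      obtain ⟨u, -, -, hur, h, -⟩ := (hK _ _ _).1 hq
      exact hur ((hid h).trans hr)
    · have hex : ∃ q : ℕ × List γ, (a, ident w, q.1, q.2) ∈ K :=
        ⟨(_, _), (hK _ _ _).2 ⟨w, hw, hwt, hr, rfl, rfl, rfl⟩⟩
      rw [dif_pos hex]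
      obtain ⟨u, -, -, -, h, h1, h2⟩ := (hK _ _ _).1 hex.choose_spec
      obtain rfl := hid h
      have hp := T.par_mem u hw
      have hf := frag_spec (top := top) htop _ hp
      have hc : T.IsChild u (T.par u) := ⟨hw, hr, rfl⟩
      rw [← h1, ← h2, ih (hf.2.mem hp) hf.1 (by
        have := hf.2.dep_le hp
        have := hc.dep
        omega), hpath u hw hwt hr]

variable [Fintype V]

/-- A step down adds one to the depth and removes at least one vertex from the subtree. This makes
`n` steps enough for following tokens. -/
theorem dep_add_sz_le (v : V) (hv : v ∈ T.verts) : T.dep v + T.sz v ≤ Fintype.card V := by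
  refine induction_down (Q := fun v => T.dep v + T.sz v ≤ Fintype.card V) ?_ ?_ v hv
  · rw [T.dep_root, Nat.zero_add]
    exact sz_le _
  · intro c v hc ih
    have := hc.dep
    have := hc.sz_lt hc.parent_mem
    omega

open Classical in
variable (T) in
/-- The size of the part of the subtree of `v` that lies in the fragment of `v`. -/
noncomputable def fragSz (top : V → Prop) (v : V) : ℕ :=
  ((T.sub v).filter fun x => T.frag top x = T.frag top v).card

open Classical in
-- A child that is a top starts a new fragment, so nothing below it belongs to the fragment of `v`;
-- any other child shares the fragment. Thus sizes within fragments obey a recursion that an upward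
-- wave can evaluate.
theorem fragSz_eq (htop : top T.root) (hv : v ∈ T.verts) : T.fragSz top v =
    1 + ∑ c ∈ T.children v, if top c then 0 else T.fragSz top c := by
  rw [fragSz, Finset.card_filter, sum_sub _ hv, if_pos rfl]
  congr 1
  refine Finset.sum_congr rfl fun c hc => ?_
  rw [mem_children] at hc
  split_ifs with h
  · refine Finset.sum_eq_zero fun x hx => if_neg fun he => ?_
    rw [mem_sub] at hx
    have := hx.2.frag hx.1 h
    rw [he] at this
    exact hc.not_anc hv (this.trans (frag_spec htop v hv).2)
  · rw [fragSz, Finset.card_filter, hc.frag h]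

theorem fragSz_le (v : V) : T.fragSz top v ≤ Fintype.card V := Finset.card_le_univ _

open Classical in
-- The subtree of a top `w` is the disjoint union of the fragments whose roots lie in it, and these
-- roots are exactly the ones whose chain of links passes through `w`.
theorem tokenSum_eq (htop : top T.root) (hid : Function.Injective ident)
    {K : Finset (ℕ × ℕ × ℕ × ℕ)} (hK : TokensOf T top ident a (T.fragSz top) K)
    (hwt : top w) (hwr : w ≠ T.root) :
    tokenSum K a (ident w) = T.sz w := by
  have hchain : ∀ w' ∈ T.verts, top w' → w' ≠ T.root →
      (Relation.ReflTransGen (fun z z' => ∃ m, (a, z, z', m) ∈ K) (ident w') (ident w) ↔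
        T.Anc w w') := by
    intro w' hw' ht' hr'
    constructor
    · intro h
      obtain ⟨z, hz⟩ : ∃ z, z = ident w' := ⟨_, rfl⟩
      rw [← hz] at h
      induction h using Relation.ReflTransGen.head_induction_on generalizing w' with
      | refl => rw [hid hz]; exact Anc.refl _
      | @head z z' hzz _ ih =>
        obtain ⟨m, hm⟩ := hzz
        obtain ⟨u, hu, hut, hur, rfl, rfl, -⟩ := (hK _ _ _).1 hm
        obtain rfl := hid hz
        have hp := T.par_mem u hu
        have hf := frag_spec (top := top) htop _ hp
        refine Anc.trans ?_ (hf.2.trans (anc_par u))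
        by_cases hfr : T.frag top (T.par u) = T.root
        · -- then the chain ends at the root, which carries no token
          rename_i hc
          rcases Relation.ReflTransGen.cases_head hc with h | ⟨z, ⟨m, hm⟩, -⟩
          · rw [hid h]; exact Anc.refl _
          · obtain ⟨u', -, -, hur', h, -⟩ := (hK _ _ _).1 hm
            exact absurd ((hid h).trans hfr) hur'
        · exact ih _ (hf.2.mem hp) hf.1 hfr rfl
    · intro h
      obtain ⟨d, hd⟩ : ∃ d, T.dep w' ≤ d := ⟨_, le_rfl⟩
      induction d generalizing w' with
      | zero =>
        exact absurd (eq_root_of_dep hw' (by omega)) hr'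
      | succ d ih =>
        rcases h.eq_or with rfl | h
        · exact .refl
        · have hp := T.par_mem w' hw'
          have hf := frag_spec (top := top) htop _ hp
          have h1 := h.frag hp hwt
          have hc : T.IsChild w' (T.par w') := ⟨hw', hr', rfl⟩
          refine Relation.ReflTransGen.head
            ⟨_, (hK _ _ _).2 ⟨w', hw', ht', hr', rfl, rfl, rfl⟩⟩ (ih _ (hf.2.mem hp) hf.1 ?_ h1 ?_)
          · intro he
            rw [he] at h1
            exact hwr (h1.eq_of_dep T.root_mem (by rw [T.dep_root]; exact Nat.zero_le _))
          · have := hf.2.dep_le hp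
            have := hc.dep
            omega
  have hne : ∀ w', T.Anc w w' → w' ≠ T.root := by
    rintro w' h rfl
    exact hwr (h.eq_of_dep T.root_mem (by rw [T.dep_root]; exact Nat.zero_le _))
  -- The fibres of `T.frag top` partition the subtree of `w`.
  have hsz : T.sz w = ∑ w' ∈ (T.sub w).filter top, T.fragSz top w' := by
    rw [sz, Finset.card_eq_sum_card_fiberwise (f := T.frag top) (t := (T.sub w).filter top)]
    · refine Finset.sum_congr rfl fun w' hw' => ?_
      rw [Finset.mem_filter, mem_sub] at hw'
      rw [fragSz]
      congr 1
      ext x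
      simp only [Finset.mem_filter, mem_sub, frag_top hw'.1.1 hw'.2]
      constructor
      · rintro ⟨⟨hx, -⟩, rfl⟩
        exact ⟨⟨hx, (frag_spec htop x hx).2⟩, rfl⟩
      · rintro ⟨⟨hx, h⟩, he⟩
        exact ⟨⟨hx, hw'.1.2.trans h⟩, he⟩
    · intro x hx
      rw [Finset.mem_coe, mem_sub] at hx
      rw [Finset.mem_coe, Finset.mem_filter, mem_sub]
      have hf := frag_spec htop x hx.1
      exact ⟨⟨hf.2.mem hx.1, hx.2.frag hx.1 hwt⟩, hf.1⟩
  rw [hsz, tokenSum, eq_comm]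
  refine Finset.sum_bij
    (fun w' _ => (a, ident w', ident (T.frag top (T.par w')), T.fragSz top w')) ?_ ?_ ?_ ?_
  · intro w' hw'
    rw [Finset.mem_filter, mem_sub] at hw'
    have hr := hne _ hw'.1.2
    exact Finset.mem_filter.2 ⟨(hK _ _ _).2 ⟨w', hw'.1.1, hw'.2, hr, rfl, rfl, rfl⟩, rfl,
      (hchain w' hw'.1.1 hw'.2 hr).2 hw'.1.2⟩
  · intro w₁ _ w₂ _ h
    simp only [Prod.mk.injEq] at h
    exact hid h.2.1
  · rintro ⟨a', x, y, m⟩ hq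
    rw [Finset.mem_filter] at hq
    obtain ⟨hq, rfl, hch⟩ := hq
    obtain ⟨u, hu, hut, hur, rfl, rfl, rfl⟩ := (hK _ _ _).1 hq
    exact ⟨u, Finset.mem_filter.2 ⟨mem_sub.2 ⟨hu, (hchain u hu hut hur).1 hch⟩, hut⟩, rfl⟩
  · intro _ _
    rfl

end Fragments

/-! ### Path descriptions relative to a fragment -/

section FragmentLights

variable [Fintype V] {top : V → Prop} {hv : V → V} {pt : V → ℕ} {v w c : V}

open Classical in
variable (T) in
/-- The part of the path description of `v` below the root of the fragment of `v`. -/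
noncomputable def fragLights (top : V → Prop) (hv : V → V) (pt : V → ℕ) : V → List (ℕ × ℕ) :=
  T.fold fun v o => if top v then [] else o.elim [] fun l =>
    l ++ if v = hv (T.par v) then [] else [(T.sz (T.par v), pt v)]

theorem fragLights_top (hv' : v ∈ T.verts) (h : top v) : T.fragLights top hv pt v = [] := by
  by_cases hr : v = T.root
  · subst hr
    rw [fragLights, fold_root, if_pos h]
  · rw [fragLights, fold_of_ne _ hv' hr, if_pos h]

open Classical in
theorem IsChild.fragLights (hc : T.IsChild c v) (h : ¬top c) : T.fragLights top hv pt c =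
    T.fragLights top hv pt v ++ if c = hv v then [] else [(T.sz v, pt c)] := by
  rw [RootedTree.fragLights, fold_of_ne _ hc.1 hc.2.1, if_neg h, hc.2.2, Option.elim_some]

theorem lights_frag (htop : top T.root) (v : V) (hv' : v ∈ T.verts) :
    T.lights hv pt v = T.lights hv pt (T.frag top v) ++ T.fragLights top hv pt v := by
  refine induction_down (Q := fun v => T.lights hv pt v =
    T.lights hv pt (T.frag top v) ++ T.fragLights top hv pt v) ?_ ?_ v hv'
  · rw [frag_top T.root_mem htop, fragLights_top T.root_mem htop, List.append_nil]
  · intro c v hc ih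
    by_cases h : top c
    · rw [frag_top hc.1 h, fragLights_top hc.1 h, List.append_nil]
    · rw [hc.frag h, hc.fragLights h, hc.lights, ih, List.append_assoc]

open Classical in
-- The split refers to the fragment of the parent, so it holds whether or not `c` is a top. For a
-- top, the second part is what its token has to carry.
theorem lights_top (htop : top T.root) (hc : T.IsChild c v) : T.lights hv pt c =
    T.lights hv pt (T.frag top v) ++ (T.fragLights top hv pt v ++
      if c = hv v then [] else [(T.sz v, pt c)]) := by
  rw [hc.lights, lights_frag htop v hc.parent_mem, List.append_assoc]

end FragmentLights

end RootedTree

/-! ### Tables and labels as sequences of words -/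

section Encoding

/-- The list of the entries of a list of pairs. -/
def flatten : List (ℕ × ℕ) → List ℕ
  | [] => []
  | (a, b) :: l => a :: b :: flatten l

/-- The inverse of `flatten`. -/
def unflatten : List ℕ → List (ℕ × ℕ)
  | a :: b :: l => (a, b) :: unflatten l
  | _ => []

theorem unflatten_flatten (l : List (ℕ × ℕ)) : unflatten (flatten l) = l := by
  induction l with
  | nil => rfl
  | cons x l ih => rw [flatten, unflatten, ih]

theorem length_flatten (l : List (ℕ × ℕ)) : (flatten l).length = 2 * l.length := by
  induction l with
  | nil => rfl
  | cons x l ih => simp only [flatten, List.length_cons, ih]; ring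

theorem mem_flatten {l : List (ℕ × ℕ)} {x : ℕ} (h : x ∈ flatten l) :
    ∃ y ∈ l, x = y.1 ∨ x = y.2 := by
  induction l with
  | nil => cases h
  | cons z l ih =>
    simp only [flatten, List.mem_cons] at h
    rcases h with rfl | rfl | h
    · exact ⟨z, by simp⟩
    · exact ⟨z, by simp⟩
    · obtain ⟨y, hy, h⟩ := ih h
      exact ⟨y, by simp [hy], h⟩

/-- Represent numbers by words. -/
def toWords (C n : ℕ) (l : List ℕ) : List (Word C n) := l.map (Fin.ofNat _)

theorem map_val_toWords {C n : ℕ} {l : List ℕ} (h : ∀ x ∈ l, x < 2 ^ (C * bits n)) :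
    (toWords C n l).map Fin.val = l := by
  rw [toWords, List.map_map]
  conv_rhs => rw [← List.map_id l]
  refine List.map_congr_left fun x hx => ?_
  simp [Nat.mod_eq_of_lt (h x hx)]

theorem lt_two_pow_bits (n : ℕ) : n < 2 ^ bits n := Nat.lt_pow_succ_log_self one_lt_two n

theorem bits_pos (n : ℕ) : 1 ≤ bits n := Nat.succ_le_succ (Nat.zero_le _)

/-- The rule by which packets are forwarded. -/
noncomputable def forwarding (C n : ℕ) : Forwarding C n := fun table label =>
  match table.map Fin.val with
  | s :: up :: down :: l =>
    let r := RootedTree.nextPort (unflatten l) s up down (unflatten (label.map Fin.val))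
    if r = 0 then none else some (r - 1)
  | _ => none

/-- The routing table with the given entries. -/
def encodeTable (C n : ℕ) (s up down : ℕ) (l : List (ℕ × ℕ)) : List (Word C n) :=
  toWords C n (s :: up :: down :: flatten l)

/-- The label with the given entries. -/
def encodeLabel (C n : ℕ) (L : List (ℕ × ℕ)) : List (Word C n) := toWords C n (flatten L)

end Encoding

/-! ### Correctness and size of the resulting routing scheme -/

section Output

variable {C n κ : ℕ} {V : Type u} [Fintype V] {N : Network n κ V}

theorem Network.deg_le (N : Network n κ V) (v : V) : N.deg v ≤ n := by
  classical
  have h1 : Fintype.card (N.graph.neighborSet v) = N.deg v := by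
    rw [← Fintype.card_congr (N.port v), Fintype.card_fin]
  rw [← h1]
  exact (Fintype.card_subtype_le _).trans_eq N.card_eq

variable {X : TreeFamily N}

theorem TreeFamily.length_lights {i : Fin n} {hv : V → V} {pt : V → ℕ} {v : V}
    (hheavy : (X.rooted i).IsHeavy hv) (h : v ∈ (X.tree i).verts) :
    ((X.rooted i).lights hv pt v).length + 1 ≤ bits n := by
  have h1 := RootedTree.length_lights (pt := pt) hheavy h
  have h2 := RootedTree.sz_pos (T := X.rooted i) h
  have h3 := (Nat.le_mul_of_pos_right _ h2).trans (h1.trans_eq N.card_eq)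
  exact Nat.succ_le_succ (Nat.le_log_of_pow_le one_lt_two h3)

theorem TreeFamily.mem_lights {i : Fin n} {hv : V → V} {pt : V → ℕ} {B : ℕ}
    (hB : ∀ c ∈ (X.tree i).verts, c ≠ X.root i → pt c ≤ B) (v : V) (hv' : v ∈ (X.tree i).verts) :
    ∀ z ∈ (X.rooted i).lights hv pt v, z.1 ≤ n ∧ z.2 ≤ B := by
  refine RootedTree.induction_down (T := X.rooted i)
    (Q := fun v => ∀ z ∈ (X.rooted i).lights hv pt v, z.1 ≤ n ∧ z.2 ≤ B) ?_ ?_ v hv'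
  · simp [RootedTree.lights_root]
  · intro c v hc ih z hz
    rw [hc.lights, List.mem_append] at hz
    rcases hz with hz | hz
    · exact ih z hz
    · split_ifs at hz
      · cases hz
      · rw [List.mem_singleton] at hz
        subst hz
        exact ⟨(RootedTree.sz_le _).trans_eq N.card_eq, hB c hc.1 hc.2.1⟩

/-- Tables and labels of the intended form yield routing schemes of stretch `1`. -/
theorem TreeFamily.isRoutingScheme (hC : 5 ≤ C) {hv : Fin n → V → V} {pt : Fin n → V → ℕ}
    {up H : V → ℕ → ℕ} {out : V → NodeOutput C n}
    (hheavy : ∀ i, (X.rooted i).IsHeavy (hv i))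
    (hpt : ∀ i c v, (X.rooted i).IsChild c v →
      ∃ q : Fin (N.deg v), pt i c = q + 1 ∧ (N.port v q : V) = c)
    (hpt0 : ∀ i c, pt i c ≠ 0)
    (hup : ∀ i c v, (X.rooted i).IsChild c v →
      ∃ q : Fin (N.deg c), up c (X.name i) = q + 1 ∧ (N.port c q : V) = v)
    (hroot : ∀ i, up (X.root i) (X.name i) = 0)
    (hH : ∀ i v, v ∈ (X.tree i).verts → H v (X.name i) ≤ n)
    (hHc : ∀ i c v, (X.rooted i).IsChild c v → c = hv i v → H v (X.name i) = pt i c)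
    (htable : ∀ i, ∀ v ∈ (X.tree i).verts, (out v).table (X.name i) =
      encodeTable C n ((X.rooted i).sz v) (up v (X.name i)) (H v (X.name i))
        ((X.rooted i).lights (hv i) (pt i) v))
    (hlabel : ∀ i, ∀ v ∈ (X.tree i).verts, (out v).label (X.name i) =
      encodeLabel C n ((X.rooted i).pathLabel (hv i) (pt i) v)) :
    X.HasStretchOne (forwarding C n) out ∧ X.HasSmallSize out := by
  have hlt : ∀ x ≤ n, x < 2 ^ (C * bits n) := fun x hx => (hx.trans_lt (lt_two_pow_bits n)).trans_le
    (Nat.pow_le_pow_right two_pos (Nat.le_mul_of_pos_left _ (by omega)))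
  have hptn : ∀ i, ∀ c ∈ (X.tree i).verts, c ≠ X.root i → pt i c ≤ n := by
    intro i c hc hr
    obtain ⟨q, hq, -⟩ := hpt i c ((X.rooted i).par c) ⟨hc, hr, rfl⟩
    have := N.deg_le ((X.rooted i).par c)
    omega
  have hupn : ∀ i, ∀ c ∈ (X.tree i).verts, up c (X.name i) ≤ n := by
    intro i c hc
    by_cases hr : c = X.root i
    · rw [hr, hroot]; exact Nat.zero_le _
    · obtain ⟨q, hq, -⟩ := hup i c ((X.rooted i).par c) ⟨hc, hr, rfl⟩
      have := N.deg_le c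
      omega
  have hlights : ∀ i, ∀ v ∈ (X.tree i).verts, ∀ x ∈ flatten ((X.rooted i).lights (hv i) (pt i) v),
      x < 2 ^ (C * bits n) := by
    intro i v hv' x hx
    obtain ⟨y, hy, h⟩ := mem_flatten hx
    have := TreeFamily.mem_lights (hptn i) v hv' y hy
    rcases h with rfl | rfl
    · exact hlt _ this.1
    · exact hlt _ this.2
  have hsz : ∀ i v, (X.rooted i).sz v ≤ n := fun i v => (RootedTree.sz_le v).trans_eq N.card_eq
  -- All entries are at most `n`, so encoding into words loses nothing and the decision is that of
  -- `nextPort`.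
  have hdec : ∀ i, ∀ v ∈ (X.tree i).verts, ∀ y ∈ (X.tree i).verts, ∀ r,
      RootedTree.nextPort ((X.rooted i).lights (hv i) (pt i) v) ((X.rooted i).sz v)
        (up v (X.name i)) (H v (X.name i)) ((X.rooted i).pathLabel (hv i) (pt i) y) = r →
      forwarding C n ((out v).table (X.name i)) ((out y).label (X.name i)) =
        if r = 0 then none else some (r - 1) := by
    rintro i v hv' y hy r rfl
    rw [htable i v hv', hlabel i y hy, forwarding, encodeTable, encodeLabel, map_val_toWords,
      map_val_toWords, unflatten_flatten]
    · simp only [unflatten_flatten]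
    · intro x hx
      obtain ⟨z, hz, h⟩ := mem_flatten hx
      rw [RootedTree.pathLabel, List.mem_append, List.mem_singleton] at hz
      rcases hz with hz | rfl
      · have := TreeFamily.mem_lights (hptn i) y hy z hz
        rcases h with rfl | rfl
        · exact hlt _ this.1
        · exact hlt _ this.2
      · rcases h with rfl | rfl
        · exact hlt _ (hsz i y)
        · exact hlt _ (Nat.zero_le _)
    · intro x hx
      simp only [List.mem_cons] at hx
      rcases hx with rfl | rfl | rfl | hx
      · exact hlt _ (hsz i v)
      · exact hlt _ (hupn i v hv')
      · exact hlt _ (hH i v hv')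
      · exact hlights i v hv' x hx
  have hinj : ∀ i c c' v, (X.rooted i).IsChild c v → (X.rooted i).IsChild c' v →
      pt i c = pt i c' → c = c' := by
    intro i c c' v hc hc' h
    obtain ⟨q, hq, rfl⟩ := hpt i c v hc
    obtain ⟨q', hq', rfl⟩ := hpt i c' v hc'
    have : q = q' := Fin.ext (by omega)
    rw [this]
  refine ⟨?_, ?_⟩
  · intro i x hx y hy
    refine TreeFamily.exists_shortest_route hy ?_ ?_ ?_ hx
    · rw [hdec i y hy y hy _ (RootedTree.nextPort_self _ _ _), if_pos rfl]
    · intro v hv' ha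
      have hr : v ≠ X.root i := by
        rintro rfl
        exact ha (RootedTree.anc_root (T := X.rooted i) hy)
      obtain ⟨q, hq, hq'⟩ := hup i v ((X.rooted i).par v) ⟨hv', hr, rfl⟩
      refine ⟨q, ?_, hq'⟩
      rw [hdec i v hv' y hy _
        (RootedTree.nextPort_parent (hinj i) (hpt0 i) hv' hy ha _ _), hq]
      simp
    · intro v c hc hcy
      obtain ⟨q, hq, hq'⟩ := hpt i c v hc
      refine ⟨q, ?_, hq'⟩
      rw [hdec i v hc.parent_mem y hy _ (RootedTree.nextPort_child hc hcy hy _ _)]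
      by_cases h : c = hv i v
      · rw [if_pos h, hHc i c v hc h, hq]
        simp
      · rw [if_neg h, hq]
        simp
  · intro i v hv'
    have hl := TreeFamily.length_lights (pt := pt i) (hheavy i) hv'
    have hb := bits_pos n
    rw [htable i v hv', hlabel i v hv', encodeTable, encodeLabel]
    simp only [toWords, List.length_map, List.length_cons, length_flatten, RootedTree.pathLabel,
      List.length_append, List.length_nil]
    constructor
    · nlinarith
    · have : bits n ≤ bits n ^ 2 := Nat.le_self_pow (by norm_num) _
      nlinarith

end Output

/-! ### Local computations between the communication stages -/

section LocalComputation

variable (I : LocalInput) (rnd : ℕ → ℕ)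

/-- A vertex is the root of a fragment of the tree `a` if it is the root of the tree, or if it is
sampled. -/
def LocalInput.IsTop (a : ℕ) : Prop := I.parentPort a = none ∨ rnd a = 0

/-- The delay of the wave that starts at the root of a fragment. -/
noncomputable def LocalInput.start (a : ℕ) : ℕ := (I.parentPort a).elim (rnd a) fun _ => 0

/-- The encoded port to the parent. -/
noncomputable def LocalInput.upPort (a : ℕ) : ℕ := (I.parentPort a).elim 0 fun p => p + 1

/-- The encoded port from the parent. -/
noncomputable def LocalInput.ownPort (back : ℕ → ℕ) (a : ℕ) : ℕ := (I.parentPort a).elim 1 fun p => back p + 1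

open Classical in
/-- The values of `f` at the trees in which the vertex is sampled. -/
noncomputable def LocalInput.tokens {γ : Type} (f : ℕ → γ) : Finset γ :=
  if h : (f '' {a ∈ I.trees | I.parentPort a ≠ none ∧ rnd a = 0}).Finite then h.toFinset else ∅

/-- The item received from the parent in a downward wave. -/
def parentItem {β : Type} (s : ℕ → Option (ℕ × β)) (a : ℕ) : Option β := (s a).map Prod.snd

/-- The time at which a vertex sends in a downward wave. -/
noncomputable def LocalInput.sendTime (s : ℕ → Option (ℕ × ℕ)) (a : ℕ) : ℕ :=
  (downSlot (I.IsTop rnd) (I.start rnd) s a).getD 0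

open Classical in
/-- The identifier of the root of the fragment. -/
noncomputable def LocalInput.fragId (s : ℕ → Option (ℕ × ℕ)) (a : ℕ) : ℕ :=
  if I.IsTop rnd a then I.ident else (parentItem s a).getD 0

/-- The neighbour behind port `p` is sampled in the tree `a`. -/
def LocalInput.IsCut (K : Finset (ℕ × ℕ × ℕ × ℕ)) (a : ℕ) (p : Fin I.deg) : Prop :=
  ∃ y m, (a, I.nbrIdent p, y, m) ∈ K

open Classical in
/-- One more than the sum of the subtree sizes of the children that are sampled. -/
noncomputable def LocalInput.cutWeight (K : Finset (ℕ × ℕ × ℕ × ℕ)) (a : ℕ) : ℕ :=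
  1 + ∑ p : Fin I.deg with p ∈ I.children a,
    if I.IsCut K a p then tokenSum K a (I.nbrIdent p) else 0

open Classical in
/-- The subtree size of the child behind port `p`. -/
noncomputable def LocalInput.childSize (K : Finset (ℕ × ℕ × ℕ × ℕ)) (s : ℕ → ℕ → Option ℕ) (a : ℕ)
    (p : Fin I.deg) : ℕ :=
  if I.IsCut K a p then tokenSum K a (I.nbrIdent p) else (s a p).getD 0

open Classical in
/-- The subtree size. -/
noncomputable def LocalInput.size (K : Finset (ℕ × ℕ × ℕ × ℕ)) (s : ℕ → ℕ → Option ℕ) (a : ℕ) : ℕ :=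
  1 + ∑ p : Fin I.deg with p ∈ I.children a, I.childSize K s a p

open Classical in
/-- The encoded port to the heavy child. -/
noncomputable def LocalInput.heavyPort (K : Finset (ℕ × ℕ × ℕ × ℕ)) (s : ℕ → ℕ → Option ℕ)
    (a : ℕ) : ℕ :=
  if h : ∃ p ∈ I.children a, ∀ q ∈ I.children a, I.childSize K s a q ≤ I.childSize K s a p then
    h.choose + 1
  else 0

/-- Extend the path description of the parent, whose subtree size and heavy port are given, by the
edge from port `own`. -/
def extendPath (own : ℕ) (x : ℕ × ℕ × List (ℕ × ℕ)) : List (ℕ × ℕ) :=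
  x.2.2 ++ if own = x.2.1 then [] else [(x.1, own)]

/-- The item that is sent in the second downward wave. -/
noncomputable def LocalInput.pathItem (back : ℕ → ℕ) (K : Finset (ℕ × ℕ × ℕ × ℕ))
    (s : ℕ → ℕ → Option ℕ) (a : ℕ) (o : Option (ℕ × ℕ × List (ℕ × ℕ))) : ℕ × ℕ × List (ℕ × ℕ) :=
  (I.size K s a, I.heavyPort K s a, o.elim [] (extendPath (I.ownPort back a)))

/-- The path description relative to the fragment of the parent. -/
noncomputable def LocalInput.relPath (back : ℕ → ℕ) (s : ℕ → Option (ℕ × ℕ × ℕ × List (ℕ × ℕ))) (a : ℕ) :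
    List (ℕ × ℕ) :=
  (parentItem s a).elim [] (extendPath (I.ownPort back a))

open Classical in
/-- The path description. -/
noncomputable def LocalInput.path (back : ℕ → ℕ) (n : ℕ) (s₁ : ℕ → Option (ℕ × ℕ))
    (s₂ : ℕ → Option (ℕ × ℕ × ℕ × List (ℕ × ℕ))) (K : Finset (ℕ × ℕ × ℕ × List (ℕ × ℕ))) (a : ℕ) :
    List (ℕ × ℕ) :=
  tokenPath K a n (I.fragId rnd s₁ a) ++ if I.IsTop rnd a then [] else I.relPath back s₂ a

end LocalComputation

/-! ### What the local computations yield -/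

section Correctness

variable {n κ : ℕ} {V : Type u} [Fintype V] {N : Network n κ V} {X : TreeFamily N} {i : Fin n}
  {rnd back : V → ℕ → ℕ} {v c : V}

variable (X rnd) in
/-- `v` is the root of a fragment of the tree `a`. -/
def TreeFamily.top (v : V) (a : ℕ) : Prop := (X.localInput v).IsTop (rnd v) a

variable (X rnd) in
/-- The times at which the vertices send in the downward waves. -/
noncomputable def TreeFamily.sendTimes : Fin n → V → ℕ :=
  X.slot (X.top rnd) fun v => (X.localInput v).start (rnd v)

/-- `v` is the root of a fragment of the `i`-th tree. -/
def TreeFamily.topIn (X : TreeFamily N) (rnd : V → ℕ → ℕ) (i : Fin n) (v : V) : Prop := X.top rnd v (X.name i)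

variable (X i) in
/-- The encoded ports that lead from the parents. -/
noncomputable def TreeFamily.childPort (back : V → ℕ → ℕ) (v : V) : ℕ :=
  (X.localInput v).ownPort (back v) (X.name i)

theorem TreeFamily.top_root : X.top rnd (X.root i) (X.name i) :=
  Or.inl TreeFamily.parentPort_root

theorem TreeFamily.parentPort_ne_none (hv : v ∈ (X.tree i).verts) :
    (X.localInput v).parentPort (X.name i) ≠ none ↔ v ≠ X.root i := by
  constructor
  · rintro h rfl
    exact h TreeFamily.parentPort_root
  · intro h
    obtain ⟨p, hp, -⟩ := TreeFamily.exists_parentPort (X := X) (i := i)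
      (c := v) (v := (X.rooted i).par v) ⟨hv, h, rfl⟩
    exact fun h => by cases hp.symm.trans h

theorem TreeFamily.top_iff (hv : v ∈ (X.tree i).verts) (hr : v ≠ X.root i) :
    X.top rnd v (X.name i) ↔ rnd v (X.name i) = 0 :=
  or_iff_right ((TreeFamily.parentPort_ne_none hv).2 hr)

theorem TreeFamily.upPort_child (hc : (X.rooted i).IsChild c v) :
    ∃ q : Fin (N.deg c), (X.localInput c).upPort (X.name i) = q + 1 ∧ (N.port c q : V) = v := by
  obtain ⟨p, hp, hpv⟩ := TreeFamily.exists_parentPort hc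
  exact ⟨p, by rw [LocalInput.upPort, hp]; rfl, hpv⟩

theorem TreeFamily.upPort_root : (X.localInput (X.root i)).upPort (X.name i) = 0 := by
  rw [LocalInput.upPort, TreeFamily.parentPort_root]
  rfl

theorem TreeFamily.childPort_child
    (hback : ∀ v (p : Fin (N.deg v)), back v p = N.backPort v p) (hc : (X.rooted i).IsChild c v) :
    ∃ q : Fin (N.deg v), X.childPort i back c = q + 1 ∧ (N.port v q : V) = c := by
  obtain ⟨p, hp, rfl⟩ := TreeFamily.exists_parentPort hc
  refine ⟨N.backPort c p, ?_, ?_⟩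
  · rw [TreeFamily.childPort, LocalInput.ownPort, hp, ← hback]
    rfl
  · rw [Network.backPort, Equiv.apply_symm_apply]

/-- At the root the default value is `1`, so `0` stays reserved for arrival at every vertex. -/
theorem TreeFamily.childPort_ne_zero : X.childPort i back v ≠ 0 := by
  rw [TreeFamily.childPort, LocalInput.ownPort]
  cases (X.localInput v).parentPort (X.name i) <;> simp

theorem TreeFamily.mem_tokens {γ : Type} {f : ℕ → γ} {x : γ} :
    x ∈ (X.localInput v).tokens (rnd v) f ↔ ∃ i, v ∈ (X.tree i).verts ∧ v ≠ X.root i ∧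
      rnd v (X.name i) = 0 ∧ f (X.name i) = x := by
  have hfin : (f '' {a ∈ (X.localInput v).trees | (X.localInput v).parentPort a ≠ none ∧
      rnd v a = 0}).Finite := by
    refine Set.Finite.image f ((Set.finite_range X.name).subset ?_)
    rintro a ⟨⟨i, rfl, -⟩, -⟩
    exact ⟨i, rfl⟩
  rw [LocalInput.tokens, dif_pos hfin, Set.Finite.mem_toFinset]
  constructor
  · rintro ⟨a, ⟨⟨i, rfl, hv⟩, h1, h2⟩, rfl⟩
    exact ⟨i, hv, (TreeFamily.parentPort_ne_none hv).1 h1, h2, rfl⟩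
  · rintro ⟨i, hv, h1, h2, rfl⟩
    exact ⟨X.name i, ⟨⟨i, rfl, hv⟩, (TreeFamily.parentPort_ne_none hv).2 h1, h2⟩, rfl⟩

/-- One gossip serves all trees together. Every token starts with the name of its tree, and names
are distinct, so the tokens of a single tree can be separated. -/
theorem TreeFamily.tokensOf {γ : Type} {f : V → ℕ → ℕ × ℕ × ℕ × γ} {val : Fin n → V → γ}
    (hf : ∀ i c v, (X.rooted i).IsChild c v → f c (X.name i) =
      (X.name i, N.ident c, N.ident ((X.rooted i).frag (X.topIn rnd i) v), val i c))
    {K : Finset (ℕ × ℕ × ℕ × γ)}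
    (hK : ∀ x, x ∈ K ↔ ∃ u, x ∈ (X.localInput u).tokens (rnd u) (f u)) (i : Fin n) :
    RootedTree.TokensOf (X.rooted i) (X.topIn rnd i) N.ident (X.name i) (val i) K := by
  intro x y g
  rw [hK]
  simp only [TreeFamily.mem_tokens]
  constructor
  · rintro ⟨u, j, hu, hr, h0, hx⟩
    rw [hf j u ((X.rooted j).par u) ⟨hu, hr, rfl⟩, Prod.mk.injEq, Prod.mk.injEq,
      Prod.mk.injEq] at hx
    obtain ⟨h1, h2, h3, h4⟩ := hx
    obtain rfl := X.name_injective h1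
    exact ⟨u, hu, (TreeFamily.top_iff hu hr).2 h0, hr, h2, h3, h4⟩
  · rintro ⟨u, hu, ht, hr, rfl, rfl, rfl⟩
    exact ⟨u, i, hu, hr, (TreeFamily.top_iff hu hr).1 ht, hf i u _ ⟨hu, hr, rfl⟩⟩

/-- A top knows its starting time; any other vertex sends one step after the recorded arrival from
its parent. This makes the schedule available for the reversed waves. -/
theorem TreeFamily.sendTime_eq {s : ℕ → Option (ℕ × ℕ)} (hv : v ∈ (X.tree i).verts)
    (hs : ∀ u, (X.rooted i).IsChild v u → ∃ x, s (X.name i) = some (X.sendTimes rnd i u, x)) :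
    (X.localInput v).sendTime (rnd v) s (X.name i) = X.sendTimes rnd i v := by
  rw [LocalInput.sendTime, downSlot, TreeFamily.sendTimes]
  by_cases ht : X.top rnd v (X.name i)
  · rw [TreeFamily.slot_top hv ht, if_pos (show (X.localInput v).IsTop (rnd v) (X.name i) from ht)]
    rfl
  · have hr : v ≠ (X.rooted i).root := by
      rintro rfl
      exact ht TreeFamily.top_root
    have hc : (X.rooted i).IsChild v ((X.rooted i).par v) := ⟨hv, hr, rfl⟩
    obtain ⟨x, hx⟩ := hs _ hc
    rw [if_neg (show ¬(X.localInput v).IsTop (rnd v) (X.name i) from ht), hx,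
      TreeFamily.slot_child hc ht]
    rfl

theorem TreeFamily.item_ident (hv : v ∈ (X.tree i).verts) :
    X.item (X.top rnd) (fun v _ o => o.getD (N.ident v)) i v =
      N.ident ((X.rooted i).frag (X.topIn rnd i) v) := by
  refine RootedTree.induction_down (T := X.rooted i) (Q := fun v =>
    X.item (X.top rnd) (fun v _ o => o.getD (N.ident v)) i v =
      N.ident ((X.rooted i).frag (X.topIn rnd i) v)) ?_ ?_ v hv
  · have ht : X.topIn rnd i (X.rooted i).root := TreeFamily.top_root
    rw [TreeFamily.item_top (v := (X.rooted i).root) (X.root_mem i) ht,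
      RootedTree.frag_top (X.root_mem i) ht]
    rfl
  · intro c v hc ih
    by_cases ht : X.top rnd c (X.name i)
    · rw [TreeFamily.item_top hc.1 ht, RootedTree.frag_top hc.1 ht]
      rfl
    · rw [TreeFamily.item_child hc ht, hc.frag ht, ← ih]
      rfl

theorem TreeFamily.fragId_eq {s : ℕ → Option (ℕ × ℕ)} (hv : v ∈ (X.tree i).verts)
    (hs : ∀ u, (X.rooted i).IsChild v u → parentItem s (X.name i) =
      some (N.ident ((X.rooted i).frag (X.topIn rnd i) u))) :
    (X.localInput v).fragId (rnd v) s (X.name i) =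
      N.ident ((X.rooted i).frag (X.topIn rnd i) v) := by
  rw [LocalInput.fragId]
  by_cases ht : X.top rnd v (X.name i)
  · rw [if_pos (show (X.localInput v).IsTop (rnd v) (X.name i) from ht),
      RootedTree.frag_top hv (show X.topIn rnd i v from ht)]
    rfl
  · have hr : v ≠ (X.rooted i).root := by
      rintro rfl
      exact ht TreeFamily.top_root
    have hc : (X.rooted i).IsChild v ((X.rooted i).par v) := ⟨hv, hr, rfl⟩
    rw [if_neg (show ¬(X.localInput v).IsTop (rnd v) (X.name i) from ht), hs _ hc, hc.frag ht]
    rfl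

open Classical in
theorem TreeFamily.upVal_eq {w : ℕ → ℕ} {s : ℕ → ℕ → Option ℕ} {val : V → ℕ}
    (hs : ∀ p : Fin (N.deg v), (X.rooted i).IsChild (N.port v p) v → s (X.name i) p =
      if X.top rnd (N.port v p) (X.name i) then none else some (val (N.port v p))) :
    upVal (X.localInput v) w s (X.name i) = w (X.name i) +
      ∑ c ∈ (X.rooted i).children v, if X.top rnd c (X.name i) then 0 else val c := by
  rw [upVal]
  congr 1
  refine TreeFamily.sum_children v _ _ fun p hp => ?_
  rw [hs p hp]
  split_ifs <;> rfl

section Sizes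

variable {K : Finset (ℕ × ℕ × ℕ × ℕ)}
  (hK : RootedTree.TokensOf (X.rooted i) (X.topIn rnd i) N.ident (X.name i)
    ((X.rooted i).fragSz (X.topIn rnd i)) K)

include hK

/-- A parent learns which of its children are sampled by looking for their identifiers among the
broadcast tokens. -/
theorem TreeFamily.isCut_iff {p : Fin (N.deg v)} (hp : (X.rooted i).IsChild (N.port v p) v) :
    (X.localInput v).IsCut K (X.name i) p ↔ X.top rnd (N.port v p) (X.name i) := by
  constructor
  · rintro ⟨y, m, h⟩
    obtain ⟨w, -, h1, -, h2, -⟩ := (hK _ _ _).1 h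
    rwa [← N.ident_injective h2]
  · exact fun h => ⟨_, _, (hK _ _ _).2 ⟨_, hp.1, h, hp.2.1, rfl, rfl, rfl⟩⟩

theorem TreeFamily.tokenSum_nbrIdent {p : Fin (N.deg v)}
    (hp : (X.rooted i).IsChild (N.port v p) v) (h : X.top rnd (N.port v p) (X.name i)) :
    tokenSum K (X.name i) ((X.localInput v).nbrIdent p) = (X.rooted i).sz (N.port v p) :=
  RootedTree.tokenSum_eq TreeFamily.top_root N.ident_injective hK h hp.2.1

open Classical in
theorem TreeFamily.cutWeight_eq (v : V) : (X.localInput v).cutWeight K (X.name i) =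
    1 + ∑ c ∈ (X.rooted i).children v,
      if X.top rnd c (X.name i) then (X.rooted i).sz c else 0 := by
  rw [LocalInput.cutWeight]
  congr 1
  refine TreeFamily.sum_children v _ _ fun p hp => ?_
  refine ite_congr (propext (TreeFamily.isCut_iff hK hp)) (fun h => ?_) fun _ => rfl
  exact TreeFamily.tokenSum_nbrIdent hK hp h

open Classical in
-- Once the subtree sizes of sampled children are known from the tokens, they count as weight of the
-- parent. Full subtree sizes then obey the same kind of recursion within fragments as fragment
-- sizes, and a second upward wave computes them.
theorem TreeFamily.sz_eq_cutWeight (hv : v ∈ (X.tree i).verts) : (X.rooted i).sz v =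
    (X.localInput v).cutWeight K (X.name i) + ∑ c ∈ (X.rooted i).children v,
      if X.top rnd c (X.name i) then 0 else (X.rooted i).sz c := by
  rw [TreeFamily.cutWeight_eq hK, RootedTree.sz_eq hv, add_assoc, ← Finset.sum_add_distrib]
  congr 1
  refine Finset.sum_congr rfl fun c _ => ?_
  split_ifs <;> simp

variable {s : ℕ → ℕ → Option ℕ}
  (hs : ∀ p : Fin (N.deg v), (X.rooted i).IsChild (N.port v p) v →
    ¬X.top rnd (N.port v p) (X.name i) → s (X.name i) p = some ((X.rooted i).sz (N.port v p)))

include hs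

theorem TreeFamily.childSize_eq {p : Fin (N.deg v)} (hp : (X.rooted i).IsChild (N.port v p) v) :
    (X.localInput v).childSize K s (X.name i) p = (X.rooted i).sz (N.port v p) := by
  by_cases h : X.top rnd (N.port v p) (X.name i)
  · exact (if_pos ((TreeFamily.isCut_iff hK hp).2 h)).trans (TreeFamily.tokenSum_nbrIdent hK hp h)
  · exact (if_neg fun h' => h ((TreeFamily.isCut_iff hK hp).1 h')).trans
      (congrArg (fun o => o.getD 0) (hs p hp h))

theorem TreeFamily.size_eq (hv : v ∈ (X.tree i).verts) :
    (X.localInput v).size K s (X.name i) = (X.rooted i).sz v := by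
  rw [LocalInput.size, RootedTree.sz_eq hv]
  congr 1
  exact TreeFamily.sum_children v _ _ fun p hp => TreeFamily.childSize_eq hK hs hp

theorem TreeFamily.heavyPort_spec :
    ((X.localInput v).heavyPort K s (X.name i) = 0 ∧ ∀ c, ¬(X.rooted i).IsChild c v) ∨
    ∃ p : Fin (N.deg v), (X.localInput v).heavyPort K s (X.name i) = p + 1 ∧
      (X.rooted i).IsChild (N.port v p) v ∧
      ∀ c, (X.rooted i).IsChild c v → (X.rooted i).sz c ≤ (X.rooted i).sz (N.port v p) := by
  classical
  by_cases hne : ∃ c, (X.rooted i).IsChild c v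
  · right
    have hex : ∃ p ∈ (X.localInput v).children (X.name i),
        ∀ q ∈ (X.localInput v).children (X.name i),
          (X.localInput v).childSize K s (X.name i) q ≤
            (X.localInput v).childSize K s (X.name i) p := by
      obtain ⟨c, hc⟩ := hne
      obtain ⟨p, rfl⟩ := N.exists_port hc.adj.symm
      exact Set.exists_max_image _ _ (Set.toFinite _) ⟨p, TreeFamily.mem_children.2 hc⟩
    obtain ⟨h1, h2⟩ := hex.choose_spec
    refine ⟨hex.choose, by rw [LocalInput.heavyPort, dif_pos hex], TreeFamily.mem_children.1 h1, ?_⟩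
    intro c hc
    obtain ⟨p, rfl⟩ := N.exists_port hc.adj.symm
    rw [← TreeFamily.childSize_eq hK hs hc,
      ← TreeFamily.childSize_eq hK hs (TreeFamily.mem_children.1 h1)]
    exact h2 p (TreeFamily.mem_children.2 hc)
  · left
    push Not at hne
    refine ⟨?_, hne⟩
    rw [LocalInput.heavyPort, dif_neg]
    rintro ⟨p, hp, -⟩
    exact hne _ (TreeFamily.mem_children.1 hp)

end Sizes

open Classical in
variable (X i) in
/-- The vertex behind the encoded port `H v`. -/
noncomputable def TreeFamily.behind (H : V → ℕ → ℕ) (v : V) : V :=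
  if h : ∃ p : Fin (N.deg v), H v (X.name i) = p + 1 then N.port v h.choose else v

theorem TreeFamily.behind_eq {H : V → ℕ → ℕ} {p : Fin (N.deg v)} (h : H v (X.name i) = p + 1) :
    X.behind i H v = N.port v p := by
  have hex : ∃ p : Fin (N.deg v), H v (X.name i) = p + 1 := ⟨p, h⟩
  rw [TreeFamily.behind, dif_pos hex]
  have : hex.choose = p := Fin.ext (by have := hex.choose_spec; omega)
  rw [this]

end Correctness

/-! ### All messages fit into `bits n ^ 2` rounds -/

section Capacity

variable {C n κ B : ℕ}

/-- The numbers that fit into a constant number of words. -/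
def small (κ n : ℕ) : Set ℕ := {x | x < 2 ^ ((κ + 1) * bits n)}

/-- The path descriptions that occur in messages. -/
def smallPaths (κ n : ℕ) : Set (List (ℕ × ℕ)) :=
  {l | l.length ≤ bits n ∧ ∀ y ∈ l, y ∈ small κ n ×ˢ small κ n}

theorem mem_small_of_le {x : ℕ} (h : x ≤ n) : x ∈ small κ n :=
  (h.trans_lt (lt_two_pow_bits n)).trans_le
    (Nat.pow_le_pow_right two_pos (Nat.le_mul_of_pos_left _ (Nat.succ_pos κ)))

theorem mem_small_of_lt {x : ℕ} (h : x < n ^ κ) : x ∈ small κ n := by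
  refine h.trans_le ((Nat.pow_le_pow_left (lt_two_pow_bits n).le κ).trans ?_)
  rw [← pow_mul, mul_comm]
  exact Nat.pow_le_pow_right two_pos (Nat.mul_le_mul_right _ (Nat.le_succ κ))

theorem coded_small : Coded (small κ n) ((κ + 1) * bits n) := Coded.range _

theorem coded_smallPaths : Coded (smallPaths κ n)
    (bits n * ((κ + 1) * bits n + (κ + 1) * bits n + 1)) :=
  (coded_small.prod coded_small).list _

variable (hC : B * (5 * κ + 7) ≤ C * bits n)

include hC

theorem transmissible_small (hB : 1 ≤ B) : Transmissible C n (bits n ^ 2) (small κ n) := by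
  have := bits_pos n
  refine coded_small.transmissible ?_
  calc (κ + 1) * bits n ≤ (B * (5 * κ + 7)) * bits n ^ 2 := by
        refine Nat.mul_le_mul ?_ (Nat.le_self_pow two_ne_zero _)
        nlinarith
    _ ≤ _ := Nat.mul_le_mul_right _ hC

theorem transmissible_bool (hB : 1 ≤ B) : Transmissible C n (bits n ^ 2) (Set.univ : Set Bool) := by
  have := bits_pos n
  refine Coded.bool.transmissible ?_
  calc 1 ≤ (B * (5 * κ + 7)) * bits n ^ 2 := by
        have : 1 ≤ bits n ^ 2 := Nat.one_le_pow _ _ this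
        nlinarith [Nat.mul_le_mul hB (show 1 ≤ 5 * κ + 7 by omega)]
    _ ≤ _ := Nat.mul_le_mul_right _ hC

theorem transmissible_numbers :
    Transmissible C n (bits n ^ 2) (SparseMaps (small κ n ×ˢ small κ n) B) := by
  have := bits_pos n
  refine ((coded_small.prod coded_small).sparseMaps B).transmissible ?_
  calc B * ((κ + 1) * bits n + (κ + 1) * bits n + 1)
      ≤ B * ((5 * κ + 7) * bits n ^ 2) := by
        refine Nat.mul_le_mul_left _ ?_
        have h2 := Nat.le_self_pow two_ne_zero (bits n)
        nlinarith [Nat.mul_le_mul_left κ h2]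
    _ = B * (5 * κ + 7) * bits n ^ 2 := by ring
    _ ≤ _ := Nat.mul_le_mul_right _ hC

/-- This case determines the constant. With `b = bits n`, an item takes `3 * (κ + 1) * b` bits for
its numbers, `2 * (κ + 1) * b ^ 2 + b` for its path and one more for its place in the list, in total
at most `(5 * κ + 7) * b ^ 2`. -/
theorem transmissible_items : Transmissible C n (bits n ^ 2)
    (SparseMaps (small κ n ×ˢ small κ n ×ˢ small κ n ×ˢ smallPaths κ n) B) := by
  have := bits_pos n
  refine ((coded_small.prod (coded_small.prod (coded_small.prod coded_smallPaths))).sparseMaps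
    B).transmissible ?_
  refine le_trans ?_ (Nat.mul_le_mul_right _ hC)
  rw [mul_assoc]
  refine Nat.mul_le_mul_left _ ?_
  have h2 := Nat.le_self_pow two_ne_zero (bits n)
  nlinarith [Nat.mul_le_mul_left κ h2]

theorem transmissible_sizeTokens (hB : 1 ≤ B) : Transmissible C n (bits n ^ 2)
    {x : Option (ℕ × ℕ × ℕ × ℕ) |
      ∀ y ∈ x, y ∈ small κ n ×ˢ small κ n ×ˢ small κ n ×ˢ small κ n} := by
  have := bits_pos n
  refine (coded_small.prod (coded_small.prod (coded_small.prod
    coded_small))).option.transmissible ?_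
  refine le_trans ?_ (Nat.mul_le_mul_right _ hC)
  have h2 := Nat.le_self_pow two_ne_zero (bits n)
  have h3 := Nat.mul_le_mul_right ((5 * κ + 7) * bits n ^ 2) hB
  nlinarith [Nat.mul_le_mul_left κ h2]

theorem transmissible_pathTokens (hB : 1 ≤ B) : Transmissible C n (bits n ^ 2)
    {x : Option (ℕ × ℕ × ℕ × List (ℕ × ℕ)) |
      ∀ y ∈ x, y ∈ small κ n ×ˢ small κ n ×ˢ small κ n ×ˢ smallPaths κ n} := by
  have := bits_pos n
  refine (coded_small.prod (coded_small.prod (coded_small.prod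
    coded_smallPaths))).option.transmissible ?_
  refine le_trans ?_ (Nat.mul_le_mul_right _ hC)
  have h2 := Nat.le_self_pow two_ne_zero (bits n)
  have h3 := Nat.mul_le_mul_right ((5 * κ + 7) * bits n ^ 2) hB
  nlinarith [Nat.mul_le_mul_left κ h2]

end Capacity

/-! ### Path descriptions built from local data -/

section Paths

variable {n κ : ℕ} {V : Type u} [Fintype V] {N : Network n κ V} {X : TreeFamily N} {i : Fin n}
  {rnd back H : V → ℕ → ℕ} {v c : V}

variable (X rnd) in
/-- The results of the first downward wave. -/
def TreeFamily.KnowsFragments (s : V → ℕ → Option (ℕ × ℕ)) : Prop :=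
  ∀ i c v, (X.rooted i).IsChild c v → s c (X.name i) =
    some (X.sendTimes rnd i v, N.ident ((X.rooted i).frag (X.topIn rnd i) v))

variable (X) in
/-- `H v` are the encoded ports to the heavy children of `v`. -/
def TreeFamily.HeavyPorts (H : V → ℕ → ℕ) : Prop :=
  ∀ i v, (H v (X.name i) = 0 ∧ ∀ c, ¬(X.rooted i).IsChild c v) ∨
    ∃ p : Fin (N.deg v), H v (X.name i) = p + 1 ∧ (X.rooted i).IsChild (N.port v p) v ∧
      ∀ c, (X.rooted i).IsChild c v → (X.rooted i).sz c ≤ (X.rooted i).sz (N.port v p)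

variable (X rnd back H i) in
/-- The part of the path description of `v` within its fragment. -/
noncomputable def TreeFamily.fragPath (v : V) : List (ℕ × ℕ) :=
  (X.rooted i).fragLights (X.topIn rnd i) (X.behind i H) (X.childPort i back) v

variable (X back H i) in
/-- The path description of `v`. -/
noncomputable def TreeFamily.fullPath (v : V) : List (ℕ × ℕ) :=
  (X.rooted i).lights (X.behind i H) (X.childPort i back) v

theorem TreeFamily.HeavyPorts.exists_port (hH : X.HeavyPorts H) (hc : (X.rooted i).IsChild c v) :
    ∃ p : Fin (N.deg v), H v (X.name i) = p + 1 ∧ (X.rooted i).IsChild (N.port v p) v ∧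
      ∀ c, (X.rooted i).IsChild c v → (X.rooted i).sz c ≤ (X.rooted i).sz (N.port v p) :=
  (hH i v).resolve_left fun h => h.2 c hc

theorem TreeFamily.HeavyPorts.isHeavy (hH : X.HeavyPorts H) :
    (X.rooted i).IsHeavy (X.behind i H) := by
  intro v c hc
  obtain ⟨p, hp, h1, h2⟩ := hH.exists_port hc
  rw [TreeFamily.behind_eq hp]
  exact ⟨h1, h2 c hc⟩

theorem TreeFamily.HeavyPorts.le (hH : X.HeavyPorts H) : H v (X.name i) ≤ n := by
  rcases hH i v with h | ⟨p, hp, -⟩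
  · omega
  · have := N.deg_le v
    omega

section

variable (hback : ∀ v (p : Fin (N.deg v)), back v p = N.backPort v p) (hH : X.HeavyPorts H)

include hback hH

/-- A child learns whether it is heavy by comparing its parent's announced heavy port with the port
that leads from the parent to it. -/
theorem TreeFamily.eq_behind_iff (hc : (X.rooted i).IsChild c v) :
    X.childPort i back c = H v (X.name i) ↔ c = X.behind i H v := by
  obtain ⟨p, hp, -⟩ := hH.exists_port hc
  obtain ⟨q, hq, rfl⟩ := TreeFamily.childPort_child hback hc
  rw [TreeFamily.behind_eq hp, hq, hp]
  constructor
  · intro h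
    rw [show q = p from Fin.ext (by omega)]
  · intro h
    rw [(N.port v).injective (Subtype.ext h)]

open Classical in
theorem TreeFamily.extendPath_eq (hc : (X.rooted i).IsChild c v) (l : List (ℕ × ℕ)) :
    extendPath (X.childPort i back c) ((X.rooted i).sz v, H v (X.name i), l) =
      l ++ if c = X.behind i H v then [] else [((X.rooted i).sz v, X.childPort i back c)] := by
  rw [extendPath]
  simp only [TreeFamily.eq_behind_iff hback hH hc]

theorem TreeFamily.fragPath_child (hc : (X.rooted i).IsChild c v)
    (h : ¬X.top rnd c (X.name i)) : X.fragPath i rnd back H c =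
      extendPath (X.childPort i back c)
        ((X.rooted i).sz v, H v (X.name i), X.fragPath i rnd back H v) := by
  rw [TreeFamily.extendPath_eq hback hH hc]
  exact hc.fragLights h

/-- This is the recursion over fragments that `tokenPath` evaluates when `c` is a sampled vertex. -/
theorem TreeFamily.fullPath_child (hc : (X.rooted i).IsChild c v) : X.fullPath i back H c =
    X.fullPath i back H ((X.rooted i).frag (X.topIn rnd i) v) ++
      extendPath (X.childPort i back c)
        ((X.rooted i).sz v, H v (X.name i), X.fragPath i rnd back H v) := by
  rw [TreeFamily.extendPath_eq hback hH hc]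
  exact RootedTree.lights_top (top := X.topIn rnd i) TreeFamily.top_root hc

theorem TreeFamily.fullPath_mem (hv : v ∈ (X.tree i).verts) :
    X.fullPath i back H v ∈ smallPaths κ n := by
  refine ⟨(Nat.le_succ _).trans (TreeFamily.length_lights hH.isHeavy hv), fun z hz => ?_⟩
  have := TreeFamily.mem_lights (B := n) (fun c hc hr => ?_) v hv z hz
  · exact ⟨mem_small_of_le this.1, mem_small_of_le this.2⟩
  · obtain ⟨q, hq, -⟩ := TreeFamily.childPort_child (X := X) (i := i) hback
      (v := (X.rooted i).par c) ⟨hc, hr, rfl⟩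
    have := N.deg_le ((X.rooted i).par c)
    omega

end

theorem TreeFamily.fragPath_top (hv : v ∈ (X.tree i).verts) (h : X.top rnd v (X.name i)) :
    X.fragPath i rnd back H v = [] :=
  RootedTree.fragLights_top (T := X.rooted i) hv h

theorem TreeFamily.fullPath_frag (hv : v ∈ (X.tree i).verts) : X.fullPath i back H v =
    X.fullPath i back H ((X.rooted i).frag (X.topIn rnd i) v) ++ X.fragPath i rnd back H v :=
  RootedTree.lights_frag (T := X.rooted i) (top := X.topIn rnd i) TreeFamily.top_root v hv

/-- Relative descriptions are suffixes of full ones, so the logarithmic bound for full descriptions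
also limits what is sent. -/
theorem smallPaths_of_append {l l' : List (ℕ × ℕ)} (h : l ++ l' ∈ smallPaths κ n) :
    l' ∈ smallPaths κ n := by
  obtain ⟨h1, h2⟩ := h
  rw [List.length_append] at h1
  exact ⟨by omega, fun y hy => h2 y (List.mem_append_right _ hy)⟩

end Paths

/-! ### Correctness of the individual stages -/

section Stages

variable {n κ : ℕ} {V : Type u} [Fintype V] {N : Network n κ V} {X : TreeFamily N}
  {rnd back H : V → ℕ → ℕ}

theorem TreeFamily.slot_sendTimes {i : Fin n} {c v : V} (hc : (X.rooted i).IsChild c v)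
    (h : ¬X.top rnd c (X.name i)) : X.sendTimes rnd i c = X.sendTimes rnd i v + 1 :=
  TreeFamily.slot_child hc h

open Classical in
/-- The tokens with the fragment sizes. -/
theorem TreeFamily.sizeToken_eq {s₁ : V → ℕ → Option (ℕ × ℕ)} {s₂ : V → ℕ → ℕ → Option ℕ}
    (h₁ : X.KnowsFragments rnd s₁)
    (h₂ : ∀ i v (p : Fin (N.deg v)), (X.rooted i).IsChild (N.port v p) v →
      s₂ v (X.name i) p = if X.top rnd (N.port v p) (X.name i) then none
        else some ((X.rooted i).fragSz (X.topIn rnd i) (N.port v p)))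
    (i : Fin n) (c v : V) (hc : (X.rooted i).IsChild c v) :
    (X.name i, N.ident c, (parentItem (s₁ c) (X.name i)).getD 0,
      upVal (X.localInput c) (fun _ => 1) (s₂ c) (X.name i)) =
    (X.name i, N.ident c, N.ident ((X.rooted i).frag (X.topIn rnd i) v),
      (X.rooted i).fragSz (X.topIn rnd i) c) := by
  rw [TreeFamily.upVal_eq (rnd := rnd) (h₂ i c), parentItem, h₁ i c v hc]
  refine congrArg (fun z => (X.name i, N.ident c,
    N.ident ((X.rooted i).frag (X.topIn rnd i) v), z)) ?_
  exact (RootedTree.fragSz_eq (T := X.rooted i) (top := X.topIn rnd i) TreeFamily.top_root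
    hc.1).symm

/-- The items of the second downward wave. -/
theorem TreeFamily.item_path
    (hback : ∀ v (p : Fin (N.deg v)), back v p = N.backPort v p) (hH : X.HeavyPorts H)
    {sz : V → ℕ → ℕ} (hsz : ∀ i, ∀ v ∈ (X.tree i).verts, sz v (X.name i) = (X.rooted i).sz v)
    (i : Fin n) (v : V) (hv : v ∈ (X.tree i).verts) :
    X.item (X.top rnd) (fun v a o => (sz v a, H v a,
      o.elim [] (extendPath ((X.localInput v).ownPort (back v) a)))) i v =
    ((X.rooted i).sz v, H v (X.name i), X.fragPath i rnd back H v) := by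
  refine RootedTree.induction_down (T := X.rooted i) (Q := fun v =>
    X.item (X.top rnd) (fun v a o => (sz v a, H v a,
      o.elim [] (extendPath ((X.localInput v).ownPort (back v) a)))) i v =
    ((X.rooted i).sz v, H v (X.name i), X.fragPath i rnd back H v)) ?_ ?_ v hv
  · have ht : X.top rnd (X.rooted i).root (X.name i) := TreeFamily.top_root
    rw [TreeFamily.item_top (v := (X.rooted i).root) (X.root_mem i) ht,
      TreeFamily.fragPath_top (v := (X.rooted i).root) (X.root_mem i) ht, hsz i (X.rooted i).root (X.root_mem i)]
    rfl
  · intro c v hc ih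
    by_cases ht : X.top rnd c (X.name i)
    · rw [TreeFamily.item_top hc.1 ht, TreeFamily.fragPath_top hc.1 ht, hsz i _ hc.1]
      rfl
    · rw [TreeFamily.item_child hc ht, TreeFamily.fragPath_child hback hH hc ht, ih, hsz i _ hc.1]
      rfl

/-- The tokens give the description of the fragment root, and the second downward wave gives the
part inside the fragment; for a top that part is empty. -/
theorem TreeFamily.path_eq
    (hback : ∀ v (p : Fin (N.deg v)), back v p = N.backPort v p) (hH : X.HeavyPorts H)
    {s₁ : V → ℕ → Option (ℕ × ℕ)} (h₁ : X.KnowsFragments rnd s₁)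
    {s₂ : V → ℕ → Option (ℕ × ℕ × ℕ × List (ℕ × ℕ))}
    (h₂ : ∀ i c v, (X.rooted i).IsChild c v → (X.localInput c).relPath (back c) (s₂ c) (X.name i) =
      extendPath (X.childPort i back c)
        ((X.rooted i).sz v, H v (X.name i), X.fragPath i rnd back H v))
    {K : Finset (ℕ × ℕ × ℕ × List (ℕ × ℕ))} {i : Fin n}
    (hK : RootedTree.TokensOf (X.rooted i) (X.topIn rnd i) N.ident (X.name i)
      (fun c => (X.localInput c).relPath (back c) (s₂ c) (X.name i)) K)
    {v : V} (hv : v ∈ (X.tree i).verts) :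
    (X.localInput v).path (rnd v) (back v) n (s₁ v) (s₂ v) K (X.name i) = X.fullPath i back H v := by
  have hf := RootedTree.frag_spec (T := X.rooted i) (top := X.topIn rnd i) TreeFamily.top_root v hv
  have hfv := hf.2.mem hv
  rw [LocalInput.path, TreeFamily.fragId_eq hv fun u hu => by rw [parentItem, h₁ i v u hu]; rfl,
    RootedTree.tokenPath_eq (path := X.fullPath i back H) TreeFamily.top_root N.ident_injective hK
      RootedTree.lights_root ?_ n hfv hf.1 ?_, TreeFamily.fullPath_frag (rnd := rnd) hv]
  · congr 1
    split_ifs with ht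
    · exact (TreeFamily.fragPath_top hv ht).symm
    · have hr : v ≠ (X.rooted i).root := by
        rintro rfl
        exact ht TreeFamily.top_root
      have hc : (X.rooted i).IsChild v ((X.rooted i).par v) := ⟨hv, hr, rfl⟩
      rw [h₂ i v _ hc, TreeFamily.fragPath_child hback hH hc ht]
  · intro w hw ht hr
    have hc : (X.rooted i).IsChild w ((X.rooted i).par w) := ⟨hw, hr, rfl⟩
    rw [h₂ i w _ hc]
    exact TreeFamily.fullPath_child hback hH hc
  · have := RootedTree.dep_add_sz_le (T := X.rooted i) _ hfv
    have := N.card_eq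
    omega

end Stages

/-! ### One trial with a guessed parameter -/

/-- Try to compute the routing schemes within `O(R)` time units: `T` is the time for a wave, `G` is
the time for gossip, and `B` is the number of items per message. -/
noncomputable def Prog.attempt {C n : ℕ} (κ B T G R : ℕ) (I : LocalInput) (back rnd : ℕ → ℕ) :
    Prog C n (Option (NodeOutput C n)) :=
  (Prog.leader (bits n ^ 2) (small κ n) I.deg R I.ident).bind fun b =>
  (Prog.down (bits n ^ 2) (small κ n ×ˢ small κ n) B T I (I.IsTop rnd) (I.start rnd)
    fun _ o => o.getD I.ident).bind fun r₁ =>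
  (Prog.up (bits n ^ 2) (small κ n ×ˢ small κ n) B T I (I.IsTop rnd) (I.sendTime rnd r₁.1)
    fun _ => 1).bind fun r₂ =>
  (Prog.gossip (bits n ^ 2) (small κ n ×ˢ small κ n ×ˢ small κ n ×ˢ small κ n) I.deg G
    (I.tokens rnd fun a => (a, I.ident, (parentItem r₁.1 a).getD 0,
      upVal I (fun _ => 1) r₂.1 a))).bind fun r₃ =>
  (Prog.up (bits n ^ 2) (small κ n ×ˢ small κ n) B T I (I.IsTop rnd) (I.sendTime rnd r₁.1)
    (I.cutWeight r₃.1)).bind fun r₄ =>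
  (Prog.down (bits n ^ 2) (small κ n ×ˢ small κ n ×ˢ small κ n ×ˢ smallPaths κ n) B T I
    (I.IsTop rnd) (I.start rnd) (I.pathItem back r₃.1 r₄.1)).bind fun r₅ =>
  (Prog.gossip (bits n ^ 2) (small κ n ×ˢ small κ n ×ˢ small κ n ×ˢ smallPaths κ n) I.deg G
    (I.tokens rnd fun a => (a, I.ident, (parentItem r₁.1 a).getD 0,
      I.relPath back r₅.1 a))).bind fun r₆ =>
  (Prog.flood (bits n ^ 2) I.deg (2 * R + 1)
    (b || r₁.2 || r₂.2 || r₃.2 || r₄.2 || r₅.2 || r₆.2)).bind fun f =>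
  .ret (if f then none else some
    { table := fun a => encodeTable C n (I.size r₃.1 r₄.1 a) (I.upPort a)
        (I.heavyPort r₃.1 r₄.1 a) (I.path rnd back n r₁.1 r₅.1 r₆.1 a)
      label := fun a => encodeLabel C n
        (I.path rnd back n r₁.1 r₅.1 r₆.1 a ++ [(I.size r₃.1 r₄.1 a, 0)]) })

section Attempt

variable {C n κ B : ℕ} {V : Type u} [Fintype V] {N : Network n κ V} {X : TreeFamily N}

variable (X) in
/-- The pairs of a tree and a sampled vertex. -/
def TreeFamily.sampled (rnd : V → ℕ → ℕ) : Set (Fin n × V) :=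
  {p | p.2 ∈ (X.tree p.1).verts ∧ p.2 ≠ X.root p.1 ∧ rnd p.2 (X.name p.1) = 0}

variable (X) in
/-- The conditions on the random numbers under which an attempt succeeds. -/
structure TreeFamily.Good (rnd : V → ℕ → ℕ) (B T G R : ℕ) : Prop where
  dist_le : ∀ u v, N.graph.dist u v ≤ R
  slots : X.SlotsLt (X.sendTimes rnd) T
  load : X.LoadLe (X.sendTimes rnd) B
  sampled : R + (X.sampled rnd).ncard ≤ G

/-- The tokens of all vertices form a small set. -/
theorem TreeFamily.exists_tokens {γ : Type} {rnd : V → ℕ → ℕ} {f : V → ℕ → γ} {S : Set γ}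
    (hS : ∀ i c v, (X.rooted i).IsChild c v → f c (X.name i) ∈ S) :
    ∃ A : Finset γ, (∀ u, (X.localInput u).tokens (rnd u) (f u) ⊆ A) ∧ (∀ x ∈ A, x ∈ S) ∧
      A.card ≤ (X.sampled rnd).ncard := by
  classical
  have hfin : (X.sampled rnd).Finite := Set.toFinite _
  refine ⟨hfin.toFinset.image fun p => f p.2 (X.name p.1), ?_, ?_, ?_⟩
  · intro u x hx
    obtain ⟨i, h1, h2, h3, rfl⟩ := TreeFamily.mem_tokens.1 hx
    exact Finset.mem_image.2 ⟨(i, u), hfin.mem_toFinset.2 ⟨h1, h2, h3⟩, rfl⟩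
  · intro x hx
    obtain ⟨⟨i, u⟩, h, rfl⟩ := Finset.mem_image.1 hx
    obtain ⟨h1, h2, -⟩ := hfin.mem_toFinset.1 h
    exact hS i u _ ⟨h1, h2, rfl⟩
  · rw [Set.ncard_eq_toFinset_card _ hfin]
    exact Finset.card_image_le

/-- Either all vertices fail, or all of them output correct routing schemes. If the random numbers
are good, they do not fail. -/
theorem Runs.attempt (hB : 1 ≤ B) (hC : B * (5 * κ + 7) ≤ C * bits n) (hC5 : 5 ≤ C)
    {rnd back : V → ℕ → ℕ}
    (hback : ∀ v (p : Fin (N.deg v)), back v p = N.backPort v p) (T G R : ℕ) :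
    ∃ (b : Bool) (out : V → NodeOutput C n),
      Runs N ((3 * R + 2 + 4 * T + 2 * G) * bits n ^ 2)
        (fun v => Prog.attempt κ B T G R (X.localInput v) (back v) (rnd v))
        (fun v => if b then none else some (out v)) ∧
      (b = false → X.HasStretchOne (forwarding C n) out ∧ X.HasSmallSize out) ∧
      (X.Good rnd B T G R → b = false) := by
  classical
  have hC1 : 1 ≤ C := by omega
  have hn : Fintype.card V = n := N.card_eq
  have hszn : ∀ i v, (X.rooted i).sz v ≤ n := fun i v => (RootedTree.sz_le _).trans_eq hn
  have hname : ∀ i, X.name i ∈ small κ n := fun i => mem_small_of_lt (X.name_lt i)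
  have hident : ∀ v, N.ident v ∈ small κ n := fun v => mem_small_of_lt (N.ident_lt v)
  obtain ⟨r₀, hr₀, a₀, b₀⟩ := Runs.leader hC1 N (transmissible_small hC hB) hident R
  obtain ⟨r₁, hr₁, a₁, b₁⟩ := Runs.down (X := X) (top := X.top rnd)
    (st := fun v => (X.localInput v).start (rnd v)) (out := fun v _ o => o.getD (N.ident v)) hC1
    (fun i => TreeFamily.top_root) (transmissible_numbers hC) T
  obtain ⟨r₂, hr₂, h₂⟩ := Runs.up (X := X) (top := X.top rnd)
    (sl := fun v => (X.localInput v).sendTime (rnd v) (r₁ v).1) (w := fun _ _ => 1) hC1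
    (transmissible_numbers hC) T
  obtain ⟨r₃, hr₃, a₃, b₃⟩ := Runs.gossip hC1 N (transmissible_sizeTokens hC hB) G
    fun v => (X.localInput v).tokens (rnd v) fun a => (a, N.ident v,
      (parentItem (r₁ v).1 a).getD 0, upVal (X.localInput v) (fun _ => 1) (r₂ v).1 a)
  obtain ⟨r₄, hr₄, h₄⟩ := Runs.up (X := X) (top := X.top rnd)
    (sl := fun v => (X.localInput v).sendTime (rnd v) (r₁ v).1)
    (w := fun v => (X.localInput v).cutWeight (r₃ v).1) hC1 (transmissible_numbers hC) T
  obtain ⟨r₅, hr₅, a₅, b₅⟩ := Runs.down (X := X) (top := X.top rnd)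
    (st := fun v => (X.localInput v).start (rnd v))
    (out := fun v => (X.localInput v).pathItem (back v) (r₃ v).1 (r₄ v).1) hC1
    (fun i => TreeFamily.top_root) (transmissible_items hC) T
  obtain ⟨r₆, hr₆, a₆, b₆⟩ := Runs.gossip hC1 N (transmissible_pathTokens hC hB) G
    fun v => (X.localInput v).tokens (rnd v) fun a => (a, N.ident v,
      (parentItem (r₁ v).1 a).getD 0, (X.localInput v).relPath (back v) (r₅ v).1 a)
  have hr₇ := Runs.flood hC1 N (transmissible_bool hC hB) (2 * R + 1) fun v =>
    (r₀ v || (r₁ v).2 || (r₂ v).2 || (r₃ v).2 || (r₄ v).2 || (r₅ v).2 || (r₆ v).2)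
  -- the first wave and the fragments
  have c₁ : (∀ v, (r₁ v).2 = false) →
      X.SlotsLt (X.sendTimes rnd) T ∧ X.KnowsFragments rnd fun v => (r₁ v).1 := by
    intro hf
    obtain ⟨h1, -, h2⟩ := a₁ hf
    refine ⟨h1, fun i c v hc => ?_⟩
    have := h2 i c v hc
    rwa [TreeFamily.item_ident hc.parent_mem] at this
  -- In what follows, the facts `cᵢ` use only that flags are absent, and the facts `gᵢ` show that
  -- good random numbers keep them absent.
  have g₁ : X.Good rnd B T G R → ∀ v, (r₁ v).2 = false := by
    intro hg
    refine b₁ hg.slots hg.load fun i v hv => ?_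
    rw [TreeFamily.item_ident hv]
    exact ⟨hname i, hident _⟩
  have hsl : (X.KnowsFragments rnd fun v => (r₁ v).1) → ∀ i, ∀ v ∈ (X.tree i).verts,
      (X.localInput v).sendTime (rnd v) (r₁ v).1 (X.name i) = X.sendTimes rnd i v :=
    fun h i v hv => TreeFamily.sendTime_eq hv fun u hu => ⟨_, h i v u hu⟩
  -- the sizes of the fragments
  have h₂' := fun h : X.SlotsLt (X.sendTimes rnd) T ∧ X.KnowsFragments rnd fun v => (r₁ v).1 =>
    h₂ (X.sendTimes rnd) (fun i => (X.rooted i).fragSz (X.topIn rnd i)) (hsl h.2) h.1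
      (fun i c v hc ht => TreeFamily.slot_sendTimes hc ht)
      (fun i v hv => RootedTree.fragSz_eq (T := X.rooted i) TreeFamily.top_root hv)
  clear h₂
  have g₂ : (X.SlotsLt (X.sendTimes rnd) T ∧ X.KnowsFragments rnd fun v => (r₁ v).1) →
      X.Good rnd B T G R → ∀ v, (r₂ v).2 = false := fun h hg => (h₂' h).2 hg.load fun i v _ =>
    ⟨hname i, mem_small_of_le ((RootedTree.fragSz_le _).trans_eq hn)⟩
  have t₃ : (X.SlotsLt (X.sendTimes rnd) T ∧ X.KnowsFragments rnd fun v => (r₁ v).1) →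
      (∀ v, (r₂ v).2 = false) → _ := fun h hf =>
    TreeFamily.sizeToken_eq h.2 ((h₂' h).1 hf)
  clear h₂'
  have c₃ : (X.SlotsLt (X.sendTimes rnd) T ∧ X.KnowsFragments rnd fun v => (r₁ v).1) →
      (∀ v, (r₂ v).2 = false) → (∀ v, (r₃ v).2 = false) → ∀ i v,
      RootedTree.TokensOf (X.rooted i) (X.topIn rnd i) N.ident (X.name i)
        ((X.rooted i).fragSz (X.topIn rnd i)) (r₃ v).1 := fun h h' hf i v =>
    TreeFamily.tokensOf (t₃ h h') (a₃ hf v) i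
  have g₃ : (X.SlotsLt (X.sendTimes rnd) T ∧ X.KnowsFragments rnd fun v => (r₁ v).1) →
      (∀ v, (r₂ v).2 = false) → X.Good rnd B T G R → ∀ v, (r₃ v).2 = false := by
    intro h h' hg
    obtain ⟨A, hA, hA1, hA2⟩ := TreeFamily.exists_tokens (X := X) (rnd := rnd)
      (f := fun v a => (a, N.ident v, (parentItem (r₁ v).1 a).getD 0,
        upVal (X.localInput v) (fun _ => 1) (r₂ v).1 a))
      (S := small κ n ×ˢ small κ n ×ˢ small κ n ×ˢ small κ n) fun i c v hc => by
        rw [t₃ h h' i c v hc]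
        exact ⟨hname i, hident _, hident _,
          mem_small_of_le ((RootedTree.fragSz_le _).trans_eq hn)⟩
    exact b₃ A R hA hA1 hg.dist_le ((Nat.add_le_add_left hA2 R).trans hg.sampled)
  clear t₃ a₃ b₃
  -- the subtree sizes
  have h₄' := fun (h : X.SlotsLt (X.sendTimes rnd) T ∧ X.KnowsFragments rnd fun v => (r₁ v).1)
      (hK : ∀ i v, RootedTree.TokensOf (X.rooted i) (X.topIn rnd i) N.ident (X.name i)
        ((X.rooted i).fragSz (X.topIn rnd i)) (r₃ v).1) =>
    h₄ (X.sendTimes rnd) (fun i => (X.rooted i).sz) (hsl h.2) h.1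
      (fun i c v hc ht => TreeFamily.slot_sendTimes hc ht)
      (fun i v hv => TreeFamily.sz_eq_cutWeight (hK i v) hv)
  clear h₄
  have g₄ : (X.SlotsLt (X.sendTimes rnd) T ∧ X.KnowsFragments rnd fun v => (r₁ v).1) →
      (∀ i v, RootedTree.TokensOf (X.rooted i) (X.topIn rnd i) N.ident (X.name i)
        ((X.rooted i).fragSz (X.topIn rnd i)) (r₃ v).1) →
      X.Good rnd B T G R → ∀ v, (r₄ v).2 = false := fun h hK hg => (h₄' h hK).2 hg.load
    fun i v _ => ⟨hname i, mem_small_of_le (hszn i v)⟩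
  let H : V → ℕ → ℕ := fun v => (X.localInput v).heavyPort (r₃ v).1 (r₄ v).1
  have c₄ : (X.SlotsLt (X.sendTimes rnd) T ∧ X.KnowsFragments rnd fun v => (r₁ v).1) →
      (∀ i v, RootedTree.TokensOf (X.rooted i) (X.topIn rnd i) N.ident (X.name i)
        ((X.rooted i).fragSz (X.topIn rnd i)) (r₃ v).1) → (∀ v, (r₄ v).2 = false) →
      (∀ i, ∀ v ∈ (X.tree i).verts,
        (X.localInput v).size (r₃ v).1 (r₄ v).1 (X.name i) = (X.rooted i).sz v) ∧
      X.HeavyPorts H := by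
    intro h hK hf
    have hs : ∀ i v (p : Fin (N.deg v)), (X.rooted i).IsChild (N.port v p) v →
        ¬X.top rnd (N.port v p) (X.name i) →
        (r₄ v).1 (X.name i) p = some ((X.rooted i).sz (N.port v p)) := fun i v p hp ht =>
      ((h₄' h hK).1 hf i v p hp).trans (if_neg ht)
    exact ⟨fun i v hv => TreeFamily.size_eq (hK i v) (hs i v) hv,
      fun i v => TreeFamily.heavyPort_spec (hK i v) (hs i v)⟩
  clear h₄'
  -- the second wave
  have hitem := fun (h : (∀ i, ∀ v ∈ (X.tree i).verts,
      (X.localInput v).size (r₃ v).1 (r₄ v).1 (X.name i) = (X.rooted i).sz v) ∧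
      X.HeavyPorts H) => TreeFamily.item_path (rnd := rnd) hback h.2
    (sz := fun v => (X.localInput v).size (r₃ v).1 (r₄ v).1) h.1
  have c₅ : ((∀ i, ∀ v ∈ (X.tree i).verts,
        (X.localInput v).size (r₃ v).1 (r₄ v).1 (X.name i) = (X.rooted i).sz v) ∧
      X.HeavyPorts H) → (∀ v, (r₅ v).2 = false) → ∀ i c v, (X.rooted i).IsChild c v →
      (X.localInput c).relPath (back c) (r₅ c).1 (X.name i) = extendPath (X.childPort i back c)
        ((X.rooted i).sz v, H v (X.name i), X.fragPath i rnd back H v) := by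
    intro h hf i c v hc
    rw [LocalInput.relPath, parentItem, (a₅ hf).2.2 i c v hc]
    exact congrArg (extendPath (X.childPort i back c)) (hitem h i v hc.parent_mem)
  have g₅ : ((∀ i, ∀ v ∈ (X.tree i).verts,
        (X.localInput v).size (r₃ v).1 (r₄ v).1 (X.name i) = (X.rooted i).sz v) ∧
      X.HeavyPorts H) → X.Good rnd B T G R → ∀ v, (r₅ v).2 = false := by
    intro h hg
    refine b₅ hg.slots hg.load fun i v hv => ?_
    have h1 := TreeFamily.fullPath_mem hback h.2 hv
    rw [TreeFamily.fullPath_frag (rnd := rnd) hv] at h1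
    have h2 : X.item (X.top rnd) (fun v => (X.localInput v).pathItem (back v) (r₃ v).1 (r₄ v).1) i v =
        ((X.rooted i).sz v, H v (X.name i), X.fragPath i rnd back H v) := hitem h i v hv
    rw [h2]
    exact ⟨hname i, mem_small_of_le (hszn i v), mem_small_of_le h.2.le, smallPaths_of_append h1⟩
  clear hitem a₅ b₅
  -- the path descriptions
  have t₆ : (X.KnowsFragments rnd fun v => (r₁ v).1) → ∀ i c v, (X.rooted i).IsChild c v →
      (X.name i, N.ident c, (parentItem (r₁ c).1 (X.name i)).getD 0,
        (X.localInput c).relPath (back c) (r₅ c).1 (X.name i)) =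
      (X.name i, N.ident c, N.ident ((X.rooted i).frag (X.topIn rnd i) v),
        (X.localInput c).relPath (back c) (r₅ c).1 (X.name i)) := by
    intro h i c v hc
    have := h i c v hc
    simp only at this
    rw [parentItem, this]
    rfl
  have c₆ : (X.KnowsFragments rnd fun v => (r₁ v).1) → (∀ v, (r₆ v).2 = false) → ∀ i v,
      RootedTree.TokensOf (X.rooted i) (X.topIn rnd i) N.ident (X.name i)
        (fun c => (X.localInput c).relPath (back c) (r₅ c).1 (X.name i)) (r₆ v).1 :=
    fun h hf i v => TreeFamily.tokensOf
      (val := fun i c => (X.localInput c).relPath (back c) (r₅ c).1 (X.name i)) (t₆ h) (a₆ hf v) i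
  have g₆ : (X.KnowsFragments rnd fun v => (r₁ v).1) → X.HeavyPorts H →
      (∀ i c v, (X.rooted i).IsChild c v →
        (X.localInput c).relPath (back c) (r₅ c).1 (X.name i) = extendPath (X.childPort i back c)
          ((X.rooted i).sz v, H v (X.name i), X.fragPath i rnd back H v)) →
      X.Good rnd B T G R → ∀ v, (r₆ v).2 = false := by
    intro h hH hp hg
    obtain ⟨A, hA, hA1, hA2⟩ := TreeFamily.exists_tokens (X := X) (rnd := rnd)
      (f := fun v a => (a, N.ident v, (parentItem (r₁ v).1 a).getD 0,
        (X.localInput v).relPath (back v) (r₅ v).1 a))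
      (S := small κ n ×ˢ small κ n ×ˢ small κ n ×ˢ smallPaths κ n) fun i c v hc => by
        rw [t₆ h i c v hc, hp i c v hc]
        refine ⟨hname i, hident _, hident _, ?_⟩
        have h1 := TreeFamily.fullPath_mem (κ := κ) hback hH hc.1
        rw [TreeFamily.fullPath_child (rnd := rnd) hback hH hc] at h1
        exact smallPaths_of_append h1
    exact b₆ A R hA hA1 hg.dist_le ((Nat.add_le_add_left hA2 R).trans hg.sampled)
  clear t₆ a₆ b₆
  -- the flags
  let F : V → Bool := fun v =>
    (r₀ v || (r₁ v).2 || (r₂ v).2 || (r₃ v).2 || (r₄ v).2 || (r₅ v).2 || (r₆ v).2)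
  -- All vertices reach the same verdict: either the flooding radius covers the graph, or the
  -- diameter test has put a flag within this radius of each vertex.
  have hflag : ∀ v, decide (∃ u, N.graph.dist v u ≤ 2 * R + 1 ∧ F u = true) =
      decide (∃ u, F u = true) := by
    intro v
    refine decide_eq_decide.2 ⟨fun ⟨u, _, hu⟩ => ⟨u, hu⟩, fun ⟨u, hu⟩ => ?_⟩
    rcases a₀ with h | h
    · exact ⟨u, h v u, hu⟩
    · obtain ⟨w, hw, hw'⟩ := h v
      exact ⟨w, hw, by simp [F, hw']⟩
  let out : V → NodeOutput C n := fun v =>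
    { table := fun a => encodeTable C n ((X.localInput v).size (r₃ v).1 (r₄ v).1 a)
        ((X.localInput v).upPort a) (H v a)
        ((X.localInput v).path (rnd v) (back v) n (r₁ v).1 (r₅ v).1 (r₆ v).1 a)
      label := fun a => encodeLabel C n
        ((X.localInput v).path (rnd v) (back v) n (r₁ v).1 (r₅ v).1 (r₆ v).1 a ++
          [((X.localInput v).size (r₃ v).1 (r₄ v).1 a, 0)]) }
  refine ⟨decide (∃ u, F u = true), out, ?_, fun hb => ?_, fun hg => ?_⟩
  -- The diameter test takes `R + 1` simulated rounds, the flooding `2 * R + 1`, the four waves `T`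
  -- each, and the two gossips `G` each.
  · have htime : (3 * R + 2 + 4 * T + 2 * G) * bits n ^ 2 = (R * bits n ^ 2 + bits n ^ 2) +
        (T * bits n ^ 2 + (T * bits n ^ 2 + (G * bits n ^ 2 + (T * bits n ^ 2 + (T * bits n ^ 2 +
        (G * bits n ^ 2 + ((2 * R + 1) * bits n ^ 2 + 0))))))) := by ring
    rw [htime]
    unfold Prog.attempt
    refine Runs.bind hr₀ <| Runs.bind hr₁ <| Runs.bind hr₂ <| Runs.bind hr₃ <| Runs.bind hr₄ <|
      Runs.bind hr₅ <| Runs.bind hr₆ <| Runs.bind hr₇ fun v => ?_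
    exact congrArg (fun f : Bool => Prog.ret (if f then none else some (out v))) (hflag v)
  · rw [decide_eq_false_iff_not, not_exists] at hb
    simp only [F, Bool.or_eq_true, not_or, Bool.not_eq_true] at hb
    have d₁ := c₁ fun v => (hb v).1.1.1.1.1.2
    have d₃ := c₃ d₁ (fun v => (hb v).1.1.1.1.2) fun v => (hb v).1.1.1.2
    have d₄ := c₄ d₁ d₃ fun v => (hb v).1.1.2
    have d₅ := c₅ d₄ fun v => (hb v).1.2
    have d₆ := c₆ d₁.2 fun v => (hb v).2
    have hpath : ∀ i, ∀ v ∈ (X.tree i).verts,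
        (X.localInput v).path (rnd v) (back v) n (r₁ v).1 (r₅ v).1 (r₆ v).1 (X.name i) =
          X.fullPath i back H v := fun i v hv =>
      TreeFamily.path_eq hback d₄.2 d₁.2 (s₂ := fun v => (r₅ v).1) d₅ (d₆ i v) hv
    refine TreeFamily.isRoutingScheme hC5 (hv := fun i => X.behind i H)
      (pt := fun i => X.childPort i back) (up := fun v => (X.localInput v).upPort) (H := H)
      (fun i => d₄.2.isHeavy) (fun i c v hc => TreeFamily.childPort_child hback hc)
      (fun i c => TreeFamily.childPort_ne_zero) (fun i c v hc => TreeFamily.upPort_child hc)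
      (fun i => TreeFamily.upPort_root) (fun i v _ => d₄.2.le)
      (fun i c v hc h => ((TreeFamily.eq_behind_iff hback d₄.2 hc).2 h).symm)
      (fun i v hv => ?_) fun i v hv => ?_
    · simp only [out, hpath i v hv, d₄.1 i v hv]
      rfl
    · simp only [out, hpath i v hv, d₄.1 i v hv]
      rfl
  · rw [decide_eq_false_iff_not, not_exists]
    have e₁ := g₁ hg
    have e₂ := g₂ (c₁ e₁) hg
    have e₃ := g₃ (c₁ e₁) e₂ hg
    have d₃ := c₃ (c₁ e₁) e₂ e₃
    have e₄ := g₄ (c₁ e₁) d₃ hg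
    have d₄ := c₄ (c₁ e₁) d₃ e₄
    have e₅ := g₅ d₄ hg
    have e₆ := g₆ (c₁ e₁).2 d₄.2 (c₅ d₄ e₅) hg
    intro v
    simp [F, b₀ hg.dist_le v, e₁ v, e₂ v, e₃ v, e₄ v, e₅ v, e₆ v]

end Attempt

/-! ### Doubling the guess until a trial succeeds -/

section Algorithm

variable {C n κ : ℕ}

/-- Learn, for each port, the port of the neighbour that leads back. -/
def Prog.backPorts : Prog C n (ℕ → ℕ) :=
  .comm (fun p => Message.single (Fin.ofNat _ p)) fun x => .ret fun p => ((x p).1.map Fin.val).headD 0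

/-- The time for an attempt with parameter `2 ^ k` is `2 ^ k` times this factor. -/
def attemptFactor (n lam : ℕ) : ℕ := (5 + 4 * (1 + lam * bits n) + 2 * (1 + 6 * lam * bits n)) * bits n ^ 2

/-- Attempts with the parameters `2 ^ k, 2 ^ (k + 1), …`, until one of them succeeds. -/
noncomputable def Prog.attempts (κ lam : ℕ) (I : LocalInput) (back : ℕ → ℕ) (rnd : ℕ → ℕ → ℕ) :
    (fuel k : ℕ) → Prog C n (NodeOutput C n)
  | 0, _ => .ret ⟨fun _ => [], fun _ => []⟩
  | fuel + 1, k => (Prog.attempt κ (2 * lam * bits n) (2 ^ k * (1 + lam * bits n))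
      (2 ^ k * (1 + 6 * lam * bits n)) (2 ^ k) I back (rnd k)).bind fun o =>
        o.elim (Prog.attempts κ lam I back rnd fuel (k + 1)) .ret

/-- The number that is given by the first `k` bits of the `a`-th block of length `L`. -/
def randomNumber {m : ℕ} (L : ℕ) (ω : Fin m → Bool) (k a : ℕ) : ℕ :=
  ∑ j ∈ Finset.range k, if h : a * L + j < m then (ω ⟨a * L + j, h⟩).toNat * 2 ^ j else 0

variable (C n κ) in
/-- The distributed algorithm. -/
noncomputable def treeRouting (lam : ℕ) : CongestAlgorithm C n :=
  Prog.toAlgorithm (n ^ κ * bits n) fun I ω => Prog.backPorts.bind fun back =>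
    Prog.attempts κ lam I back (randomNumber (bits n) ω) (bits n + 1) 0

variable {V : Type u} [Fintype V] {N : Network n κ V} {X : TreeFamily N}

theorem Runs.backPorts (hC : 1 ≤ C) (N : Network n κ V) : ∃ back : V → ℕ → ℕ,
    Runs (C := C) N 1 (fun _ => Prog.backPorts) back ∧
      ∀ v (p : Fin (N.deg v)), back v p = N.backPort v p := by
  refine ⟨_, ⟨_, _, fun v => rfl, fun v => rfl⟩, fun v p => ?_⟩
  have h1 : (N.backPort v p : ℕ) < 2 ^ (C * bits n) :=
    (((N.backPort v p).2.le.trans (N.deg_le _)).trans_lt (lt_two_pow_bits n)).trans_le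
      (Nat.pow_le_pow_right two_pos (Nat.le_mul_of_pos_left _ hC))
  simp [Network.inbox, Message.single, hC, Nat.mod_eq_of_lt h1]

/-- Trial `k` costs at most `2 ^ k * attemptFactor n lam`, so the geometric series is absorbed by
the term `2 ^ k * attemptFactor n lam` on the left. Trial `K` cannot fail; an earlier one may
succeed, and then its output is correct as well. -/
theorem Runs.attempts {lam : ℕ} (hlam : 1 ≤ lam) (hC : 2 * lam * (5 * κ + 7) ≤ C) (hC5 : 5 ≤ C)
    {back : V → ℕ → ℕ} {rnd : V → ℕ → ℕ → ℕ}
    (hback : ∀ v (p : Fin (N.deg v)), back v p = N.backPort v p) {K : ℕ}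
    (hK : X.Good (fun v => rnd v K) (2 * lam * bits n) (2 ^ K * (1 + lam * bits n))
      (2 ^ K * (1 + 6 * lam * bits n)) (2 ^ K)) (fuel k : ℕ) (hk : k ≤ K) (hf : K < k + fuel) :
    ∃ (T : ℕ) (out : V → NodeOutput C n),
      Runs N T (fun v => Prog.attempts κ lam (X.localInput v) (back v) (rnd v) fuel k) out ∧
      T + 2 ^ k * attemptFactor n lam ≤ 2 ^ (K + 1) * attemptFactor n lam ∧
      X.HasStretchOne (forwarding C n) out ∧ X.HasSmallSize out := by
  induction fuel generalizing k with
  | zero => omega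
  | succ fuel ih =>
    have hb := bits_pos n
    obtain ⟨b, out, hr, h1, h2⟩ := Runs.attempt (C := C) (X := X) (rnd := fun v => rnd v k)
      (B := 2 * lam * bits n) (Nat.mul_pos (by omega) hb)
      (by calc 2 * lam * bits n * (5 * κ + 7) = 2 * lam * (5 * κ + 7) * bits n := by ring
          _ ≤ _ := Nat.mul_le_mul_right _ hC) hC5 hback
      (2 ^ k * (1 + lam * bits n)) (2 ^ k * (1 + 6 * lam * bits n)) (2 ^ k)
    have htime : (3 * 2 ^ k + 2 + 4 * (2 ^ k * (1 + lam * bits n)) +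
        2 * (2 ^ k * (1 + 6 * lam * bits n))) * bits n ^ 2 ≤ 2 ^ k * attemptFactor n lam := by
      rw [attemptFactor, ← mul_assoc (2 ^ k) _ (bits n ^ 2)]
      refine Nat.mul_le_mul_right _ ?_
      -- This gives `3 * 2 ^ k + 2 ≤ 5 * 2 ^ k`, whence the `5` in `attemptFactor`.
      have := Nat.one_le_two_pow (n := k)
      nlinarith
    cases b with
    | false =>
      refine ⟨_, out, Runs.bind (T' := 0) hr fun v => rfl, ?_, h1 rfl⟩
      have : 2 ^ (k + 1) ≤ 2 ^ (K + 1) := Nat.pow_le_pow_right two_pos (by omega)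
      have h3 := Nat.mul_le_mul_right (attemptFactor n lam) this
      rw [pow_succ, mul_assoc] at h3
      linarith
    | true =>
      have hne : k ≠ K := by
        rintro rfl
        cases h2 hK
      obtain ⟨T, out', hr', ht, h⟩ := ih (k + 1) (by omega) (by omega)
      refine ⟨_, out', Runs.bind hr hr', ?_, h⟩
      rw [pow_succ, mul_assoc] at ht
      linarith

/-- Only the random numbers of trial `K` have to be good. All trials may therefore read the same
bits, and no independence between trials is needed. -/
theorem treeRouting_succeeds {lam : ℕ} (hlam : 1 ≤ lam) (hC : 2 * lam * (5 * κ + 7) ≤ C)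
    (hC5 : 5 ≤ C) {ω : V → Fin (n ^ κ * bits n) → Bool} {K R : ℕ} (hK' : K ≤ bits n)
    (hK : X.Good (fun v => randomNumber (bits n) (ω v) K) (2 * lam * bits n)
      (2 ^ K * (1 + lam * bits n)) (2 ^ K * (1 + 6 * lam * bits n)) (2 ^ K))
    (hR : 1 + 2 ^ (K + 1) * attemptFactor n lam ≤ R) :
    ω ∈ (treeRouting C n κ lam).Succeeds (forwarding C n) X R := by
  obtain ⟨back, hr, hback⟩ := Runs.backPorts (show 1 ≤ C by omega) N
  obtain ⟨T, out, hr', ht, h⟩ := Runs.attempts (rnd := fun v => randomNumber (bits n) (ω v)) hlam hC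
    hC5 hback hK (bits n + 1) 0 (Nat.zero_le _) (by omega)
  exact ⟨out, Prog.outputsWithin X (Runs.bind hr hr') (by omega), h⟩

end Algorithm

/-! ### Tail bounds for independent uniform numbers -/

section Probability

/-- Since `e < 3`, `K! ≥ (K / 3) ^ K`, so `M.choose K * (2 / R) ^ K ≤ (6 * M / (K * R)) ^ K ≤ (6 * m
/ K) ^ K ≤ 1`. -/
theorem choose_mul_two_pow_le {M K R m : ℕ} (hM : M ≤ R * m) (hK : 6 * m ≤ K) :
    M.choose K * 2 ^ K ≤ R ^ K := by
  have h1 : M.choose K * K.factorial ≤ M ^ K := by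
    rw [mul_comm, ← Nat.descFactorial_eq_factorial_mul_choose]
    exact Nat.descFactorial_le_pow M K
  have h2 : K ^ K ≤ 3 ^ K * K.factorial := by
    have h := Real.pow_div_factorial_le_exp (K : ℝ) (Nat.cast_nonneg K) K
    have h3 : Real.exp K ≤ 3 ^ K := by
      rw [← mul_one (K : ℝ), Real.exp_nat_mul]
      exact pow_le_pow_left₀ (Real.exp_pos 1).le Real.exp_one_lt_three.le K
    rw [div_le_iff₀ (by positivity)] at h
    have h4 := h.trans (mul_le_mul_of_nonneg_right h3 (Nat.cast_nonneg K.factorial))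
    exact_mod_cast h4
  have h3 : 0 < K ^ K := by
    rcases K.eq_zero_or_pos with rfl | h
    · simp
    · positivity
  refine Nat.le_of_mul_le_mul_left ?_ h3
  calc K ^ K * (M.choose K * 2 ^ K) ≤ 3 ^ K * K.factorial * (M.choose K * 2 ^ K) :=
        Nat.mul_le_mul_right _ h2
    _ = 6 ^ K * (M.choose K * K.factorial) := by
        rw [show 6 = 3 * 2 from rfl, mul_pow]
        ring
    _ ≤ 6 ^ K * (R * m) ^ K :=
        Nat.mul_le_mul_left _ (h1.trans (Nat.pow_le_pow_left hM K))
    _ = (6 * m) ^ K * R ^ K := by rw [mul_pow, mul_pow]; ring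
    _ ≤ K ^ K * R ^ K := Nat.mul_le_mul_right _ (Nat.pow_le_pow_left hK K)

/-- This is `(1 - 1 / R) ^ R ≤ 1 / 2`, raised to the power `l`. -/
theorem pred_pow_mul_two_pow_le {R : ℕ} (hR : 1 ≤ R) (l : ℕ) :
    (R - 1) ^ (R * l) * 2 ^ l ≤ R ^ (R * l) := by
  obtain ⟨a, rfl⟩ : ∃ a, R = a + 1 := ⟨R - 1, by omega⟩
  rw [Nat.add_sub_cancel, pow_mul, pow_mul, ← mul_pow]
  refine Nat.pow_le_pow_left ?_ l
  -- Bernoulli's inequality `1 + k / a ≤ (1 + 1 / a) ^ k` without denominators; it is used with `k =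
  -- a + 1`.
  have h : ∀ k, a ^ k * (a + k) ≤ (a + 1) ^ k * a := by
    intro k
    induction k with
    | zero => simp
    | succ k ih =>
      have h1 : a ^ k ≤ (a + 1) ^ k := Nat.pow_le_pow_left (Nat.le_succ a) k
      calc a ^ (k + 1) * (a + (k + 1)) = a * (a ^ k * (a + k)) + a * a ^ k := by ring
        _ ≤ a * ((a + 1) ^ k * a) + a * (a + 1) ^ k := by gcongr
        _ = _ := by ring
  rcases a.eq_zero_or_pos with rfl | ha
  · simp
  · have := h (a + 1)
    refine Nat.le_of_mul_le_mul_right ?_ ha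
    refine le_trans ?_ this
    rw [mul_assoc]
    exact Nat.mul_le_mul_left _ (by omega)

theorem ncard_iUnion_le {Ω ι : Type*} (s : Finset ι) (F : ι → Set Ω) :
    (⋃ i ∈ s, F i).ncard ≤ ∑ i ∈ s, (F i).ncard := by
  classical
  induction s using Finset.induction_on with
  | empty => simp
  | insert a s ha ih =>
    rw [Finset.set_biUnion_insert, Finset.sum_insert ha]
    exact (Set.ncard_union_le _ _).trans (Nat.add_le_add_left ih _)

variable {Ω E ι : Type*} [Finite Ω]

/-- The numbers `y ω e` for `e ∈ E` are independent and uniformly distributed on `{0, …, R - 1}`,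
if `ω` is. -/
structure IsUniform (y : Ω → E → ℕ) (R : ℕ) : Prop where
  lt : ∀ ω e, y ω e < R
  card_le : ∀ (S : Finset E) (c : E → ℕ),
    {ω | ∀ e ∈ S, y ω e = c e}.ncard * R ^ S.card ≤ Nat.card Ω

variable {y : Ω → E → ℕ} {R : ℕ}

open Classical in
-- Union bound over the `K`-element subsets of `I`: each prescribes `K` different numbers and so has
-- probability at most `R ^ (-K)`.
theorem IsUniform.many (h : IsUniform y R) {I : Finset ι} {e : ι → E} (he : Set.InjOn e I)
    (c : ι → ℕ) {m K : ℕ} (hM : I.card ≤ R * m) (hK : 6 * m ≤ K) (hR : 1 ≤ R) :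
    {ω | K ≤ (I.filter fun i => y ω (e i) = c i).card}.ncard * 2 ^ K ≤ Nat.card Ω := by
  have h1 : {ω | K ≤ (I.filter fun i => y ω (e i) = c i).card} ⊆
      ⋃ S ∈ I.powersetCard K, {ω | ∀ i ∈ S, y ω (e i) = c i} := by
    intro ω hω
    obtain ⟨S, hS, hc⟩ := Finset.exists_subset_card_eq (Set.mem_ofPred_eq.mp hω)
    refine Set.mem_iUnion₂.2 ⟨S, Finset.mem_powersetCard.2
      ⟨hS.trans (Finset.filter_subset _ _), hc⟩, fun i hi => ?_⟩
    exact (Finset.mem_filter.1 (hS hi)).2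
  have h2 : ∀ S ∈ I.powersetCard K,
      {ω | ∀ i ∈ S, y ω (e i) = c i}.ncard * R ^ K ≤ Nat.card Ω := by
    intro S hS
    obtain ⟨hSI, rfl⟩ := Finset.mem_powersetCard.1 hS
    have hinj : Set.InjOn e S := he.mono hSI
    have h3 := h.card_le (S.image e) fun x =>
      if h : ∃ i ∈ S, e i = x then c h.choose else 0
    rw [Finset.card_image_of_injOn hinj] at h3
    refine le_trans (Nat.mul_le_mul_right _ (Set.ncard_le_ncard ?_ (Set.toFinite _))) h3
    intro ω hω x hx
    obtain ⟨i, hi, rfl⟩ := Finset.mem_image.1 hx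
    have hex : ∃ j ∈ S, e j = e i := ⟨i, hi, rfl⟩
    rw [dif_pos hex, hinj hex.choose_spec.1 hi hex.choose_spec.2]
    exact hω i hi
  refine Nat.le_of_mul_le_mul_right ?_ (show 0 < R ^ K by positivity)
  calc _ = {ω | K ≤ (I.filter fun i => y ω (e i) = c i).card}.ncard * R ^ K * 2 ^ K := by ring
    _ ≤ (∑ S ∈ I.powersetCard K, {ω | ∀ i ∈ S, y ω (e i) = c i}.ncard) * R ^ K * 2 ^ K := by
        gcongr
        exact (Set.ncard_le_ncard h1 (Set.toFinite _)).trans (ncard_iUnion_le _ _)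
    _ ≤ (I.card.choose K * Nat.card Ω) * 2 ^ K := by
        refine Nat.mul_le_mul_right _ ?_
        rw [Finset.sum_mul]
        refine (Finset.sum_le_sum h2).trans_eq ?_
        rw [Finset.sum_const, Finset.card_powersetCard, smul_eq_mul]
    _ = Nat.card Ω * (I.card.choose K * 2 ^ K) := by ring
    _ ≤ Nat.card Ω * R ^ K := Nat.mul_le_mul_left _ (choose_mul_two_pow_le hM hK)

/-- Union bound over the `(R - 1) ^ (R * l)` assignments of nonzero values to `S`. -/
theorem IsUniform.none (h : IsUniform y R) {S : Finset E} {l : ℕ} (hS : S.card = R * l)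
    (hR : 1 ≤ R) : {ω | ∀ e ∈ S, y ω e ≠ 0}.ncard * 2 ^ l ≤ Nat.card Ω := by
  classical
  have h1 : {ω | ∀ e ∈ S, y ω e ≠ 0} ⊆ ⋃ c ∈ S.pi fun _ => Finset.Ico 1 R,
      {ω | ∀ e ∈ S, y ω e = if h : e ∈ S then c e h else 0} := by
    intro ω hω
    refine Set.mem_iUnion₂.2 ⟨fun e _ => y ω e, Finset.mem_pi.2 fun e he => ?_, fun e he => ?_⟩
    · exact Finset.mem_Ico.2 ⟨Nat.one_le_iff_ne_zero.2 (hω e he), h.lt ω e⟩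
    · rw [dif_pos he]
  refine Nat.le_of_mul_le_mul_right ?_ (show 0 < R ^ (R * l) by positivity)
  calc _ = {ω | ∀ e ∈ S, y ω e ≠ 0}.ncard * R ^ (R * l) * 2 ^ l := by ring
    _ ≤ (∑ c ∈ S.pi fun _ => Finset.Ico 1 R,
        {ω | ∀ e ∈ S, y ω e = if h : e ∈ S then c e h else 0}.ncard) * R ^ (R * l) * 2 ^ l := by
        gcongr
        exact (Set.ncard_le_ncard h1 (Set.toFinite _)).trans (ncard_iUnion_le _ _)
    _ ≤ ((R - 1) ^ (R * l) * Nat.card Ω) * 2 ^ l := by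
        refine Nat.mul_le_mul_right _ ?_
        rw [Finset.sum_mul]
        refine (Finset.sum_le_sum fun c _ => hS ▸ h.card_le S _).trans_eq ?_
        rw [Finset.sum_const, Finset.card_pi, smul_eq_mul, Finset.prod_const, hS, Nat.card_Ico]
    _ = Nat.card Ω * ((R - 1) ^ (R * l) * 2 ^ l) := by ring
    _ ≤ Nat.card Ω * R ^ (R * l) := Nat.mul_le_mul_left _ (pred_pow_mul_two_pow_le hR l)

end Probability

/-! ### Uniform numbers from random bits -/

section RandomNumbers

/-- Prescribing the values of some bits. -/
theorem ncard_bits_mul_le {J : Type*} [Fintype J] (Q : Finset J) (b : J → Bool) :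
    {ω : J → Bool | ∀ q ∈ Q, ω q = b q}.ncard * 2 ^ Q.card ≤ Nat.card (J → Bool) := by
  classical
  have h1 : {ω : J → Bool | ∀ q ∈ Q, ω q = b q} =
      (Fintype.piFinset fun q => if q ∈ Q then {b q} else Finset.univ : Finset (J → Bool)) := by
    ext ω
    simp only [Set.mem_ofPred_eq, Finset.mem_coe, Fintype.mem_piFinset]
    refine forall_congr' fun q => ?_
    by_cases h : q ∈ Q <;> simp [h]
  rw [h1, Set.ncard_coe_finset, Fintype.card_piFinset]
  have h2 : ∀ q, (if q ∈ Q then {b q} else Finset.univ : Finset Bool).card =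
      if q ∈ Q then 1 else 2 := by
    intro q
    split_ifs <;> simp
  have h3 : 2 ^ Q.card = ∏ q : J, if q ∈ Q then 2 else 1 := by
    rw [Finset.prod_ite_mem, Finset.univ_inter, Finset.prod_const]
  rw [Finset.prod_congr rfl fun q _ => h2 q, h3, ← Finset.prod_mul_distrib,
    Nat.card_eq_fintype_card, Fintype.card_pi]
  refine (Finset.prod_congr rfl fun q _ => ?_).le
  split_ifs <;> simp

theorem sum_toNat_lt (g : ℕ → Bool) (k : ℕ) :
    ∑ j ∈ Finset.range k, (g j).toNat * 2 ^ j < 2 ^ k := by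
  induction k with
  | zero => simp
  | succ k ih =>
    rw [Finset.sum_range_succ, pow_succ]
    have : (g k).toNat ≤ 1 := Bool.toNat_le _
    have := Nat.mul_le_mul_right (2 ^ k) this
    omega

theorem testBit_sum_toNat (g : ℕ → Bool) {k j : ℕ} (hj : j < k) :
    (∑ j ∈ Finset.range k, (g j).toNat * 2 ^ j).testBit j = g j := by
  induction k with
  | zero => omega
  | succ k ih =>
    have hlt := sum_toNat_lt g k
    rw [Finset.sum_range_succ, add_comm, mul_comm]
    rcases (Nat.le_of_lt_succ hj).lt_or_eq with h | rfl
    · rw [Nat.testBit_two_pow_mul_add _ hlt, if_pos h, ih h]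
    · rw [Nat.testBit_two_pow_mul_add _ hlt, if_neg (lt_irrefl _), Nat.sub_self]
      cases g j <;> simp

/-- Different names own disjoint blocks of `L ≥ k` bits, and different vertices have different
strings, so prescribing the numbers at `S` prescribes `S.card * k` distinct bits. -/
theorem isUniform_randomNumber {V ι : Type*} [Fintype V] {A L k : ℕ} (hk : k ≤ L) {name : ι → ℕ}
    (hname : Function.Injective name) (hA : ∀ i, name i < A) :
    IsUniform (fun (ω : V → Fin (A * L) → Bool) (e : ι × V) =>
      randomNumber L (ω e.2) k (name e.1)) (2 ^ k) := by
  classical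
  have hidx : ∀ i j, j < k → name i * L + j < A * L := by
    intro i j hj
    have := Nat.mul_le_mul_right L (Nat.succ_le_of_lt (hA i))
    rw [Nat.succ_mul] at this
    omega
  have hnum : ∀ (ω : Fin (A * L) → Bool) i, randomNumber L ω k (name i) =
      ∑ j ∈ Finset.range k,
        (if h : name i * L + j < A * L then ω ⟨_, h⟩ else false).toNat * 2 ^ j := by
    intro ω i
    refine Finset.sum_congr rfl fun j hj => ?_
    rw [dif_pos (hidx i j (Finset.mem_range.1 hj)), dif_pos (hidx i j (Finset.mem_range.1 hj))]
  refine ⟨fun ω e => ?_, fun S c => ?_⟩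
  · simp only [hnum]
    exact sum_toNat_lt _ k
  · let pos : (ι × V) × Fin k → V × Fin (A * L) := fun x =>
      (x.1.2, ⟨name x.1.1 * L + x.2, hidx _ _ x.2.2⟩)
    have hpos : Function.Injective pos := by
      rintro ⟨⟨i, v⟩, j⟩ ⟨⟨i', v'⟩, j'⟩ h
      simp only [pos, Prod.mk.injEq, Fin.mk.injEq] at h
      obtain ⟨rfl, h⟩ := h
      have hj : (j : ℕ) < L := j.2.trans_le hk
      have hj' : (j' : ℕ) < L := j'.2.trans_le hk
      have hL : 0 < L := by omega
      have h1 : name i = name i' := by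
        have := congrArg (· / L) h
        simpa [Nat.mul_comm _ L, Nat.mul_add_div hL, Nat.div_eq_of_lt hj, Nat.div_eq_of_lt hj']
          using this
      have h2 : j = j' := Fin.ext (by rw [h1] at h; omega)
      rw [hname h1, h2]
    let Q : Finset (V × Fin (A * L)) := (S ×ˢ (Finset.univ : Finset (Fin k))).image pos
    have hQ : Q.card = S.card * k := by
      rw [Finset.card_image_of_injective _ hpos, Finset.card_product, Finset.card_univ,
        Fintype.card_fin]
    let b : V × Fin (A * L) → Bool := fun q =>
      if h : ∃ x, pos x = q then (c h.choose.1).testBit h.choose.2 else false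
    have hb : ∀ x, b (pos x) = (c x.1).testBit x.2 := by
      intro x
      have hex : ∃ x', pos x' = pos x := ⟨x, rfl⟩
      simp only [b, dif_pos hex]
      rw [hpos hex.choose_spec]
    have h1 := ncard_bits_mul_le Q b
    rw [hQ, Nat.mul_comm S.card, pow_mul] at h1
    have h2 : Nat.card (V × Fin (A * L) → Bool) = Nat.card (V → Fin (A * L) → Bool) :=
      Nat.card_congr (Equiv.curry _ _ _)
    rw [h2] at h1
    refine le_trans (Nat.mul_le_mul_right _ ?_) h1
    refine Set.ncard_le_ncard_of_injOn Function.uncurry ?_ Function.uncurry_injective.injOn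
      (Set.toFinite _)
    intro ω hω q hq
    obtain ⟨x, hx, rfl⟩ := Finset.mem_image.1 hq
    rw [hb, ← hω x.1 (Finset.mem_product.1 hx).1, hnum, testBit_sum_toNat _ x.2.2,
      dif_pos (hidx _ _ x.2.2)]
    rfl

end RandomNumbers

/-! ### How the random numbers determine the schedule -/

section SendTimes

variable {n κ : ℕ} {V : Type u} [Fintype V] {N : Network n κ V} {X : TreeFamily N} {i : Fin n}
  {rnd : V → ℕ → ℕ} {v : V}

theorem TreeFamily.sendTimes_root : X.sendTimes rnd i (X.root i) = rnd (X.root i) (X.name i) := by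
  rw [TreeFamily.sendTimes, TreeFamily.slot_top (X.root_mem i) TreeFamily.top_root,
    LocalInput.start, TreeFamily.parentPort_root, Option.elim_none]

theorem TreeFamily.sendTimes_of_ne (hv : v ∈ (X.tree i).verts) (hr : v ≠ X.root i)
    (h : rnd v (X.name i) = 0) : X.sendTimes rnd i v = 0 := by
  rw [TreeFamily.sendTimes, TreeFamily.slot_top hv ((TreeFamily.top_iff hv hr).2 h),
    LocalInput.start]
  obtain ⟨p, hp⟩ := Option.ne_none_iff_exists'.1 ((TreeFamily.parentPort_ne_none hv).2 hr)
  rw [hp, Option.elim_some]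

/-- The vertex whose random number determines that `v` sends at time `t`. -/
noncomputable def TreeFamily.witness (X : TreeFamily N) (v : V) (t : ℕ) (i : Fin n) : V :=
  if t < (X.rooted i).dep v then (X.rooted i).par^[t] v else X.root i

/-- If `v` sends at time `t` before its depth, the wave started at the sampled ancestor `t` steps
above, whose number is `0`, which is also the truncated difference. Otherwise it started at the root
with delay `t` minus the depth. In both cases vertex and value depend only on `v`, `t` and the tree.
-/
theorem TreeFamily.rnd_witness (hv : v ∈ (X.tree i).verts) :
    rnd (X.witness v (X.sendTimes rnd i v) i) (X.name i) =
      X.sendTimes rnd i v - (X.rooted i).dep v := by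
  refine RootedTree.induction_down (T := X.rooted i) (Q := fun v =>
    rnd (X.witness v (X.sendTimes rnd i v) i) (X.name i) =
      X.sendTimes rnd i v - (X.rooted i).dep v) ?_ ?_ v hv
  · rw [TreeFamily.witness, (X.rooted i).dep_root, if_neg (Nat.not_lt_zero _), Nat.sub_zero]
    exact TreeFamily.sendTimes_root.symm
  · intro c v hc ih
    by_cases h : rnd c (X.name i) = 0
    · rw [TreeFamily.sendTimes_of_ne hc.1 hc.2.1 h, TreeFamily.witness, if_pos, Nat.zero_sub]
      · exact h
      · rw [hc.dep]
        exact Nat.succ_pos _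
    · have hs := TreeFamily.slot_sendTimes (rnd := rnd) hc
        fun h' => h ((TreeFamily.top_iff hc.1 hc.2.1).1 h')
      have hw : X.witness c (X.sendTimes rnd i c) i = X.witness v (X.sendTimes rnd i v) i := by
        rw [TreeFamily.witness, TreeFamily.witness, hs, hc.dep, Function.iterate_succ_apply, hc.2.2]
        simp only [Nat.add_lt_add_iff_right]
      rw [hw, ih, hs, hc.dep, Nat.add_sub_add_right]

/-- A delay is less than `R`, so a wave that is `j + R` late has travelled more than `j` edges.
Hence the ancestor `j` steps above `v` is neither sampled nor the root. -/
theorem TreeFamily.rnd_iterate {R : ℕ} (hR : ∀ v, rnd v (X.name i) < R)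
    (hv : v ∈ (X.tree i).verts) : ∀ j, j + R ≤ X.sendTimes rnd i v →
      j < (X.rooted i).dep v ∧ rnd ((X.rooted i).par^[j] v) (X.name i) ≠ 0 := by
  refine RootedTree.induction_down (T := X.rooted i) (Q := fun v =>
    ∀ j, j + R ≤ X.sendTimes rnd i v →
      j < (X.rooted i).dep v ∧ rnd ((X.rooted i).par^[j] v) (X.name i) ≠ 0) ?_ ?_ v hv
  · intro j hj
    have h1 : X.sendTimes rnd i (X.rooted i).root = rnd (X.root i) (X.name i) :=
      TreeFamily.sendTimes_root
    have := hR (X.root i)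
    omega
  · intro c v hc ih j hj
    have := hR c
    by_cases h : rnd c (X.name i) = 0
    · have := TreeFamily.sendTimes_of_ne hc.1 hc.2.1 h
      omega
    · have hs := TreeFamily.slot_sendTimes (rnd := rnd) hc
        fun h' => h ((TreeFamily.top_iff hc.1 hc.2.1).1 h')
      rw [hc.dep]
      cases j with
      | zero => exact ⟨Nat.succ_pos _, h⟩
      | succ j =>
        rw [Function.iterate_succ_apply, hc.2.2]
        have := ih j (by omega)
        exact ⟨by omega, this.2⟩

end SendTimes

/-! ### The probability of bad random numbers -/

section Failure

variable {n κ : ℕ} {V : Type u} [Fintype V] {N : Network n κ V} {X : TreeFamily N}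
  {Ω : Type*} [Finite Ω] {rnd : Ω → V → ℕ → ℕ} {R : ℕ}
  (hu : IsUniform (fun (ω : Ω) (e : Fin n × V) => rnd ω e.2 (X.name e.1)) R) (hR : 1 ≤ R)

include hu hR

/-- A slot of at least `R * (1 + l)` requires `R * l` consecutive ancestors, all unsampled, which
has probability at most `2 ^ (-l)`. -/
theorem TreeFamily.ncard_slot_mul_le (l : ℕ) (p : Fin n × V) :
    {ω | p.2 ∈ (X.tree p.1).verts ∧ R * (1 + l) ≤ X.sendTimes (rnd ω) p.1 p.2}.ncard * 2 ^ l ≤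
      Nat.card Ω := by
  classical
  obtain ⟨i, v⟩ := p
  -- A single outcome in the event already shows that `v` has depth at least `R * l`, a fact
  -- independent of the random numbers; it makes the ancestors in question distinct.
  rcases Set.eq_empty_or_nonempty
    {ω | v ∈ (X.tree i).verts ∧ R * (1 + l) ≤ X.sendTimes (rnd ω) i v} with h | ⟨ω₀, hv, h₀⟩
  · simp [h]
  have hlt : ∀ ω v, rnd ω v (X.name i) < R := fun ω v => hu.lt ω (i, v)
  have hdep : ∀ j < R * l, j < (X.rooted i).dep v := fun j hj =>
    (TreeFamily.rnd_iterate (hlt ω₀) hv j (by rw [Nat.mul_add] at h₀; omega)).1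
  have hinj : Set.InjOn (fun j => (i, (X.rooted i).par^[j] v)) (Finset.range (R * l)) := by
    intro j hj j' hj' h
    have hj := hdep j (Finset.mem_range.1 hj)
    have hj' := hdep j' (Finset.mem_range.1 hj')
    have h1 := RootedTree.dep_iterate (T := X.rooted i) hv hj.le
    have h2 := RootedTree.dep_iterate (T := X.rooted i) hv hj'.le
    rw [(Prod.mk.inj h).2] at h1
    omega
  refine le_trans (Nat.mul_le_mul_right _ (Set.ncard_le_ncard ?_ (Set.toFinite _)))
    (hu.none (S := (Finset.range (R * l)).image fun j => (i, (X.rooted i).par^[j] v)) (l := l)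
      (by rw [Finset.card_image_of_injOn hinj, Finset.card_range]) hR)
  rintro ω ⟨-, hω⟩ e he
  replace hω : R * (1 + l) ≤ X.sendTimes (rnd ω) i v := hω
  obtain ⟨j, hj, rfl⟩ := Finset.mem_image.1 he
  rw [Finset.mem_range] at hj
  exact (TreeFamily.rnd_iterate (hlt ω) hv j (by rw [Nat.mul_add] at hω; omega)).2

variable {s : ℕ} (hs : ∀ v : V, {i : Fin n | v ∈ (X.tree i).verts}.ncard ≤ s)

include hs

/-- For fixed vertex and time, sending in tree `i` forces the number at the witness in tree `i` to a
fixed value. These are different numbers for different trees, and at most `s ≤ R` trees matter. -/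
theorem TreeFamily.ncard_load_mul_le (hsR : s ≤ R) {K : ℕ} (hK : 6 ≤ K) (p : V × ℕ) :
    {ω | K ≤ {i | p.1 ∈ (X.tree i).verts ∧ X.sendTimes (rnd ω) i p.1 = p.2}.ncard}.ncard * 2 ^ K ≤
      Nat.card Ω := by
  classical
  obtain ⟨v, t⟩ := p
  have hfin : {i : Fin n | v ∈ (X.tree i).verts}.Finite := Set.toFinite _
  refine le_trans (Nat.mul_le_mul_right _ (Set.ncard_le_ncard ?_ (Set.toFinite _)))
    (hu.many (I := hfin.toFinset) (e := fun i => (i, X.witness v t i))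
      (fun i _ j _ h => (Prod.mk.inj h).1) (fun i => t - (X.rooted i).dep v) (m := 1) (K := K)
      ?_ (by omega) hR)
  · intro ω hω
    refine le_trans (Set.mem_ofPred_eq.mp hω) ?_
    rw [← Set.ncard_coe_finset]
    refine Set.ncard_le_ncard ?_ (Set.toFinite _)
    rintro i ⟨hv, ht⟩
    replace ht : X.sendTimes (rnd ω) i v = t := ht
    refine Finset.mem_coe.2 (Finset.mem_filter.2 ⟨hfin.mem_toFinset.2 hv, ?_⟩)
    rw [← ht]
    exact TreeFamily.rnd_witness hv
  · rw [← Set.ncard_eq_toFinset_card _ hfin]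
    have := hs v
    omega

/-- There are at most `n * s ≤ R * R` pairs of a tree and a vertex in it, each sampled with
probability `1 / R`. -/
theorem TreeFamily.ncard_sampled_mul_le (hsR : n * s ≤ R * R) {K : ℕ} (hK : 6 * R ≤ K) :
    {ω | K ≤ (X.sampled (rnd ω)).ncard}.ncard * 2 ^ K ≤ Nat.card Ω := by
  classical
  let I : Finset (Fin n × V) := Finset.univ.filter fun p =>
    p.2 ∈ (X.tree p.1).verts ∧ p.2 ≠ X.root p.1
  have hI : I.card ≤ n * s := by
    have h1 : I ⊆ Finset.univ.biUnion fun v : V =>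
        (Finset.univ.filter fun i : Fin n => v ∈ (X.tree i).verts).image fun i => (i, v) := by
      rintro ⟨i, v⟩ h
      exact Finset.mem_biUnion.2 ⟨v, Finset.mem_univ _, Finset.mem_image.2
        ⟨i, Finset.mem_filter.2 ⟨Finset.mem_univ _, (Finset.mem_filter.1 h).2.1⟩, rfl⟩⟩
    refine (Finset.card_le_card h1).trans ((Finset.card_biUnion_le_card_mul _ _ s fun v _ => ?_).trans_eq
      (by rw [Finset.card_univ, N.card_eq]))
    refine Finset.card_image_le.trans (le_trans (le_of_eq ?_) (hs v))
    rw [← Set.ncard_coe_finset]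
    simp
  refine le_trans (Nat.mul_le_mul_right _ (Set.ncard_le_ncard ?_ (Set.toFinite _)))
    (hu.many (I := I) (e := id) Function.injective_id.injOn (fun _ => 0) (m := R) (K := K)
      (hI.trans hsR) hK hR)
  intro ω hω
  refine le_trans (Set.mem_ofPred_eq.mp hω) ?_
  rw [← Set.ncard_coe_finset]
  refine Set.ncard_le_ncard ?_ (Set.toFinite _)
  rintro ⟨i, v⟩ ⟨h1, h2, h3⟩
  exact Finset.mem_coe.2 (Finset.mem_filter.2 ⟨Finset.mem_filter.2 ⟨Finset.mem_univ _, h1, h2⟩, h3⟩)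

/-- Union bound over late slots, excessive loads and too many sampled pairs. Loads at times beyond
the last slot are zero, so finitely many times have to be considered. -/
theorem TreeFamily.ncard_not_good_mul_le (hd : ∀ u v, N.graph.dist u v ≤ R) (hsR : s ≤ R)
    (hnsR : n * s ≤ R * R) (hRb : R ≤ 2 ^ bits n) {lam : ℕ} (hlam : 3 ≤ lam) :
    {ω | ¬X.Good (rnd ω) (2 * lam * bits n) (R * (1 + lam * bits n))
      (R * (1 + 6 * lam * bits n)) R}.ncard * 2 ^ (lam * bits n) ≤
        2 ^ (4 * bits n) * Nat.card Ω := by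
  classical
  have hb := bits_pos n
  have hn := (lt_two_pow_bits n).le
  set l := lam * bits n with hl
  have hl3 : 3 ≤ l := hlam.trans (Nat.le_mul_of_pos_right _ hb)
  have hB : 2 * lam * bits n = 2 * l := by rw [hl]; ring
  have hG : R * (1 + 6 * lam * bits n) = R + 6 * R * l := by rw [hl]; ring
  rw [hB, hG]
  let T := R * (1 + l)
  let S : Fin n × V → Set Ω := fun p =>
    {ω | p.2 ∈ (X.tree p.1).verts ∧ T ≤ X.sendTimes (rnd ω) p.1 p.2}
  let L : V × ℕ → Set Ω := fun p =>
    {ω | 2 * l ≤ {i | p.1 ∈ (X.tree i).verts ∧ X.sendTimes (rnd ω) i p.1 = p.2}.ncard}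
  let M : Set Ω := {ω | 6 * R * l ≤ (X.sampled (rnd ω)).ncard}
  let LI : Finset (V × ℕ) := Finset.univ ×ˢ Finset.range T
  have hsub : {ω | ¬X.Good (rnd ω) (2 * l) T (R + 6 * R * l) R} ⊆
      ((⋃ p ∈ (Finset.univ : Finset (Fin n × V)), S p) ∪ ⋃ p ∈ LI, L p) ∪ M := by
    intro ω hω
    by_contra h
    simp only [Set.mem_union, not_or, Set.mem_iUnion, not_exists] at h
    obtain ⟨⟨h1, h2⟩, h3⟩ := h
    have hslots : X.SlotsLt (X.sendTimes (rnd ω)) T := fun i v hv => by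
      by_contra h
      exact h1 (i, v) (Finset.mem_univ _) ⟨hv, not_lt.1 h⟩
    refine hω ⟨hd, hslots, fun v t => ?_, Nat.add_le_add_left (not_le.1 h3).le R⟩
    by_cases ht : t < T
    · exact (not_le.1 (h2 (v, t) (Finset.mem_product.2 ⟨Finset.mem_univ _,
        Finset.mem_range.2 ht⟩))).le
    · have : {i | v ∈ (X.tree i).verts ∧ X.sendTimes (rnd ω) i v = t} = ∅ := by
        refine Set.eq_empty_of_forall_notMem ?_
        rintro i ⟨hv, rfl⟩
        exact ht (hslots i v hv)
      rw [this, Set.ncard_empty]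
      exact Nat.zero_le _
  have hS : (∑ p : Fin n × V, (S p).ncard) * 2 ^ l ≤ 2 ^ (2 * bits n) * Nat.card Ω := by
    rw [Finset.sum_mul]
    refine (Finset.sum_le_sum fun p _ => TreeFamily.ncard_slot_mul_le hu hR l p).trans ?_
    rw [Finset.sum_const, smul_eq_mul, Finset.card_univ, Fintype.card_prod, Fintype.card_fin,
      N.card_eq, two_mul, pow_add]
    exact Nat.mul_le_mul_right _ (Nat.mul_le_mul hn hn)
  have hT : T ≤ 2 ^ bits n * 2 ^ l :=
    Nat.mul_le_mul hRb (by have := Nat.lt_two_pow_self (n := l); omega)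
  -- The threshold for loads is `2 * l` and not `l` because the number of times is bounded only by
  -- `2 ^ bits n * 2 ^ l`; one factor `2 ^ l` pays for that.
  have hL : (∑ p ∈ LI, (L p).ncard) * 2 ^ l ≤ 2 ^ (2 * bits n) * Nat.card Ω := by
    refine Nat.le_of_mul_le_mul_right ?_ (show 0 < 2 ^ l by positivity)
    calc _ = ∑ p ∈ LI, (L p).ncard * 2 ^ (2 * l) := by
          rw [mul_assoc, ← pow_add, ← two_mul, Finset.sum_mul]
      _ ≤ LI.card * Nat.card Ω := by
          rw [← smul_eq_mul LI.card, ← Finset.sum_const]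
          exact Finset.sum_le_sum fun p _ =>
            TreeFamily.ncard_load_mul_le hu hR hs hsR (by omega) p
      _ = n * T * Nat.card Ω := by
          rw [Finset.card_product, Finset.card_univ, N.card_eq, Finset.card_range]
      _ ≤ 2 ^ bits n * (2 ^ bits n * 2 ^ l) * Nat.card Ω := by gcongr
      _ = _ := by ring
  have hM : M.ncard * 2 ^ l ≤ 2 ^ (2 * bits n) * Nat.card Ω := by
    have h1 := TreeFamily.ncard_sampled_mul_le hu hR hs hnsR (K := 6 * R * l)
      (Nat.le_mul_of_pos_right _ (by omega))
    calc M.ncard * 2 ^ l ≤ M.ncard * 2 ^ (6 * R * l) := by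
          gcongr
          · exact one_le_two
          · exact Nat.le_mul_of_pos_left _ (by omega)
      _ ≤ 1 * Nat.card Ω := by rw [one_mul]; exact h1
      _ ≤ _ := Nat.mul_le_mul_right _ Nat.one_le_two_pow
  have hcard := (Set.ncard_le_ncard hsub (Set.toFinite _)).trans
    ((Set.ncard_union_le _ _).trans (Nat.add_le_add_right ((Set.ncard_union_le _ _).trans
      (Nat.add_le_add (ncard_iUnion_le _ _) (ncard_iUnion_le _ _))) _))
  calc _ ≤ (∑ p : Fin n × V, (S p).ncard + ∑ p ∈ LI, (L p).ncard + M.ncard) * 2 ^ l :=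
        Nat.mul_le_mul_right _ hcard
    _ ≤ 3 * 2 ^ (2 * bits n) * Nat.card Ω := by
        rw [add_mul, add_mul]
        linarith
    _ ≤ 2 ^ (4 * bits n) * Nat.card Ω := by
        refine Nat.mul_le_mul_right _ ?_
        rw [show 4 * bits n = 2 * bits n + 2 * bits n by ring, pow_add]
        refine Nat.mul_le_mul_right _ (le_trans (by norm_num : 3 ≤ 2 ^ 2) ?_)
        exact Nat.pow_le_pow_right two_pos (by omega)

end Failure

/-! ### Choice of the parameter and conclusion -/

section Main

variable {C n κ : ℕ} {V : Type u} [Fintype V] {N : Network n κ V} {X : TreeFamily N}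

theorem Network.dist_lt (N : Network n κ V) (u v : V) : N.graph.dist u v < n := by
  classical
  obtain ⟨p⟩ := N.connected u v
  exact ((SimpleGraph.dist_le p.bypass).trans_lt p.bypass_isPath.length_lt).trans_eq N.card_eq

theorem Network.dist_le_diam (N : Network n κ V) (u v : V) :
    N.graph.dist u v ≤ N.graph.diam := by
  have : Nonempty V := ⟨u⟩
  exact SimpleGraph.dist_le_diam (SimpleGraph.connected_iff_ediam_ne_top.1 N.connected)

theorem Network.diam_le (N : Network n κ V) : N.graph.diam ≤ n := by
  have : Nonempty V := N.connected.nonempty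
  obtain ⟨u, v, h⟩ := N.graph.exists_dist_eq_diam
  exact h ▸ (N.dist_lt u v).le

/-- There is a suitable parameter for an attempt. -/
theorem exists_parameter {s D : ℕ} (hn : 1 ≤ n) (hs : 1 ≤ s) (hsn : s ≤ n) (hD : D ≤ n) :
    ∃ K ≤ bits n, n * s ≤ 2 ^ K * 2 ^ K ∧ D ≤ 2 ^ K ∧
      (2 : ℝ) ^ K ≤ 2 * (√((n : ℝ) * (s : ℝ)) + (D : ℝ)) := by
  classical
  have hex : ∃ K, n * s ≤ 2 ^ K * 2 ^ K ∧ D ≤ 2 ^ K := by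
    have := (lt_two_pow_bits n).le
    exact ⟨bits n, Nat.mul_le_mul this (hsn.trans this), hD.trans this⟩
  have hle : Nat.find hex ≤ bits n := by
    have := (lt_two_pow_bits n).le
    exact Nat.find_min' hex ⟨Nat.mul_le_mul this (hsn.trans this), hD.trans this⟩
  refine ⟨Nat.find hex, hle, (Nat.find_spec hex).1, (Nat.find_spec hex).2, ?_⟩
  have hD0 : (0 : ℝ) ≤ D := Nat.cast_nonneg D
  rcases hk : Nat.find hex with _ | k
  · have h1 : (1 : ℝ) ≤ √((n : ℝ) * (s : ℝ)) := by
      rw [Real.one_le_sqrt]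
      exact_mod_cast Nat.mul_le_mul hn hs
    rw [pow_zero]
    linarith
  -- By minimality half the parameter violates one of the two conditions, so it is smaller than the
  -- square root or than `D`.
  · have hmin := Nat.find_min hex (m := k) (by omega)
    rw [not_and_or, not_le, not_le] at hmin
    rw [pow_succ]
    rcases hmin with h | h
    · have h1 : (2 : ℝ) ^ k ≤ √((n : ℝ) * (s : ℝ)) := by
        refine Real.le_sqrt_of_sq_le ?_
        rw [sq]
        exact_mod_cast h.le
      linarith
    · have h1 : (2 : ℝ) ^ k ≤ D := by exact_mod_cast h.le
      have := Real.sqrt_nonneg ((n : ℝ) * (s : ℝ))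
      linarith

/-- With `l = lam * bits n ≥ 1`, the first factor is `11 + 16 * l ≤ 27 * l`. -/
theorem attemptFactor_le {lam : ℕ} (hlam : 1 ≤ lam) :
    attemptFactor n lam ≤ 27 * lam * bits n ^ 3 := by
  have h := Nat.mul_le_mul hlam (bits_pos n)
  calc attemptFactor n lam ≤ (27 * (lam * bits n)) * bits n ^ 2 := by
        refine Nat.mul_le_mul_right _ ?_
        rw [Nat.mul_assoc 6]
        omega
    _ = _ := by ring

/-- The union bound costs `2 ^ (4 * bits n)`, so `lam = c + 4` leaves a failure probability of at
most `2 ^ (-c * bits n) ≤ n ^ (-c)`. -/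
theorem prob_treeRouting {lam : ℕ} {c s R : ℕ} (hlam : lam = c + 4)
    (hC : 2 * lam * (5 * κ + 7) ≤ C) (hC5 : 5 ≤ C)
    (hs : ∀ v : V, {i : Fin n | v ∈ (X.tree i).verts}.ncard ≤ s) (hsn : s ≤ n) {K : ℕ}
    (hK : K ≤ bits n) (hns : n * s ≤ 2 ^ K * 2 ^ K) (hD : N.graph.diam ≤ 2 ^ K)
    (hR : 1 + 2 ^ (K + 1) * attemptFactor n lam ≤ R) :
    1 - 1 / (n : ℝ) ^ c ≤ (treeRouting C n κ lam).prob
      ((treeRouting C n κ lam).Succeeds (forwarding C n) X R) := by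
  classical
  have hne : Nonempty V := N.connected.nonempty
  have hn : 0 < n := N.card_eq ▸ Fintype.card_pos
  let Ω := V → Fin (n ^ κ * bits n) → Bool
  let rnd : Ω → V → ℕ → ℕ := fun ω v => randomNumber (bits n) (ω v) K
  let good : Set Ω := {ω | X.Good (rnd ω) (2 * lam * bits n) (2 ^ K * (1 + lam * bits n))
    (2 ^ K * (1 + 6 * lam * bits n)) (2 ^ K)}
  -- Since `s ≤ n`, the bound on `n * s` also bounds `s * s`.
  have hsK : s ≤ 2 ^ K := by
    by_contra h
    have := Nat.mul_lt_mul'' (not_le.1 h) (not_le.1 h)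
    have := Nat.mul_le_mul_right s hsn
    omega
  have hbad := TreeFamily.ncard_not_good_mul_le (X := X) (Ω := Ω) (rnd := rnd) (R := 2 ^ K)
    (isUniform_randomNumber hK X.name_injective X.name_lt) Nat.one_le_two_pow hs
    (fun u v => (N.dist_le_diam u v).trans hD) hsK hns
    (Nat.pow_le_pow_right two_pos hK) (lam := lam) (by omega)
  have hbad' : goodᶜ.ncard * n ^ c ≤ Nat.card Ω := by
    have h1 : n ^ c ≤ 2 ^ (c * bits n) := by
      rw [mul_comm, pow_mul]
      exact Nat.pow_le_pow_left (lt_two_pow_bits n).le c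
    refine (Nat.mul_le_mul_left _ h1).trans ?_
    refine Nat.le_of_mul_le_mul_left ?_ (show 0 < 2 ^ (4 * bits n) by positivity)
    have hp : 2 ^ (lam * bits n) = 2 ^ (4 * bits n) * 2 ^ (c * bits n) := by
      rw [hlam, ← pow_add]
      ring
    change goodᶜ.ncard * 2 ^ (lam * bits n) ≤ _ at hbad
    rw [hp] at hbad
    linarith
  have hsum : good.ncard + goodᶜ.ncard = Nat.card Ω :=
    Set.ncard_add_ncard_compl good
  have hsub : good ⊆ (treeRouting C n κ lam).Succeeds (forwarding C n) X R := fun ω hω =>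
    treeRouting_succeeds (by omega) hC hC5 hK hω hR
  have hle := Set.ncard_le_ncard hsub (Set.toFinite _)
  have hΩ : 0 < Nat.card Ω := Nat.card_pos
  have key : (1 : ℝ) - 1 / (n : ℝ) ^ c ≤ (good.ncard : ℝ) / (Nat.card Ω : ℝ) := by
    have hnc : (0 : ℝ) < (n : ℝ) ^ c := by positivity
    have h1 : (good.ncard : ℝ) + goodᶜ.ncard = Nat.card Ω := by exact_mod_cast hsum
    have h2 : (goodᶜ.ncard : ℝ) * (n : ℝ) ^ c ≤ Nat.card Ω := by exact_mod_cast hbad'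
    have h3 : (0 : ℝ) < Nat.card Ω := by exact_mod_cast hΩ
    rw [le_div_iff₀ h3, sub_mul, one_mul, one_div_mul_eq_div]
    have := (le_div_iff₀ hnc).2 h2
    linarith
  refine key.trans ?_
  exact div_le_div_of_nonneg_right (Nat.cast_le.2 hle) (Nat.cast_nonneg _)

end Main

end TreeRouting

theorem mainTheorem6 :
    ∃ a : ℕ, ∀ κ c : ℕ, ∃ C : ℕ,
      ∃ (A : (n : ℕ) → TreeRouting.CongestAlgorithm C n) (f : (n : ℕ) → TreeRouting.Forwarding C n),
        ∀ (n : ℕ) (V : Type*) [Fintype V] (N : TreeRouting.Network n κ V)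
          (X : TreeRouting.TreeFamily N) (s : ℕ),
          (∀ v : V, {i : Fin n | v ∈ (X.tree i).verts}.ncard ≤ s) →
          1 - 1 / (n : ℝ) ^ c ≤
            (A n).prob ((A n).Succeeds (f n) X
              ⌊(C : ℝ) * (TreeRouting.bits n : ℝ) ^ a *
                (√((n : ℝ) * (s : ℝ)) + (N.graph.diam : ℝ))⌋₊) := by
  -- One logarithm comes from fragment depths and token counts, two come from the `bits n ^ 2`
  -- rounds per simulated round. The total time is at most `1 + 4 * 27 * (c + 4) * bits n ^ 3 * x`,
  -- which `109 * (c + 4)` covers together with the initial round; the other summand provides the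
  -- message capacity.
  refine ⟨3, fun κ c => ⟨109 * (c + 4) + 2 * (c + 4) * (5 * κ + 7),
    fun n => TreeRouting.treeRouting _ n κ (c + 4), fun n => TreeRouting.forwarding _ n, ?_⟩⟩
  intro n V _ N X s hs
  have hne : Nonempty V := N.connected.nonempty
  have hn : 0 < n := N.card_eq ▸ Fintype.card_pos
  -- There are only `n` trees, so `s` may be replaced by `min s n`, which keeps the parameter within
  -- `2 ^ bits n`.
  have hs' : ∀ v : V, {i : Fin n | v ∈ (X.tree i).verts}.ncard ≤ min s n := fun v =>
    le_min (hs v) ((Set.ncard_le_card _).trans_eq (Nat.card_fin n))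
  have hs1 : 1 ≤ min s n := by
    refine le_trans ?_ (hs' (X.root ⟨0, hn⟩))
    exact (Set.ncard_pos (Set.toFinite _)).2 ⟨⟨0, hn⟩, X.root_mem _⟩
  obtain ⟨K, hK, hns, hD, hKle⟩ := TreeRouting.exists_parameter (n := n) hn hs1 (min_le_right s n)
    N.diam_le
  refine TreeRouting.prob_treeRouting rfl (by omega) (by omega) hs' (min_le_right s n) hK hns hD ?_
  set x : ℝ := √((n : ℝ) * (s : ℝ)) + (N.graph.diam : ℝ)
  have hx : (2 : ℝ) ^ K ≤ 2 * x := by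
    refine hKle.trans ?_
    have : √((n : ℝ) * ((min s n : ℕ) : ℝ)) ≤ √((n : ℝ) * (s : ℝ)) :=
      Real.sqrt_le_sqrt (mul_le_mul_of_nonneg_left (Nat.cast_le.2 (min_le_left s n))
        (Nat.cast_nonneg n))
    simp only [x]
    linarith
  have hx1 : (1 : ℝ) ≤ 2 * x := (one_le_pow₀ one_le_two).trans hx
  have hb : (1 : ℝ) ≤ (TreeRouting.bits n : ℝ) ^ 3 :=
    one_le_pow₀ (by exact_mod_cast TreeRouting.bits_pos n)
  have hF : (TreeRouting.attemptFactor n (c + 4) : ℝ) ≤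
      27 * (c + 4) * (TreeRouting.bits n : ℝ) ^ 3 := by
    exact_mod_cast TreeRouting.attemptFactor_le (n := n) (lam := c + 4) (by omega)
  refine Nat.le_floor ?_
  push_cast
  have hc : (0 : ℝ) ≤ c := Nat.cast_nonneg c
  have h1 : (2 : ℝ) ^ (K + 1) * (TreeRouting.attemptFactor n (c + 4) : ℝ) ≤
      (4 * x) * (27 * (c + 4) * (TreeRouting.bits n : ℝ) ^ 3) := by
    refine mul_le_mul ?_ hF (Nat.cast_nonneg _) (by linarith)
    rw [pow_succ]
    linarith
  have h2 : (1 : ℝ) ≤ (c + 4) * (TreeRouting.bits n : ℝ) ^ 3 * x := by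
    have h3 : (1 : ℝ) ≤ (TreeRouting.bits n : ℝ) ^ 3 * (2 * x) := by nlinarith
    nlinarith
  have h4 : (0 : ℝ) ≤ 2 * (c + 4) * (5 * κ + 7) * (TreeRouting.bits n : ℝ) ^ 3 * x := by
    have : (0 : ℝ) ≤ x := by linarith
    positivity
  nlinarith
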